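/- Let $\Bbbk$ be a field. For $n\ge 0$ let $H^-_n$ be the dg $\Bbbk$-algebra with generators $\sigma_1,\dots,\sigma_{n-1}$ of cohomological degree $-1$, relations $\sigma_i^2=0$, $\sigma_i\sigma_j+\sigma_j\sigma_i=0$ for $|i-j|>1$, $\sigma_i\sigma_{i+1}\sigma_i=\sigma_{i+1}\sigma_i\sigma_{i+1}$, and differential of degree $1$ determined by $d(\sigma_i)=1$ and $d(ab)=d(a)b+(-1)^{\deg a}a\,d(b)$. View it as a graded dg algebra placed in $q$-degree $0$. Graded dg modules are left dg modules with an additional $q$-grading preserved by the action and the differential. Such a module $P$ over a dg algebra $A$ is called projective if the complex $\mathrm{Hom}_A(P,M)$ is acyclic for every acyclic graded dg module $M$; it is called compact if $\bigoplus_i \mathrm{Hom}(P,N_i)\to \mathrm{Hom}(P,\bigoplus_i N_i)$ is an isomorphism in the homotopy category for every family of projective $N_i$. Let $K_0(A)$ be the $\mathbb Z[q,q^{-1}]$-module with generators $[P]$, for compact projective graded dg $A$-modules $P$, and relations $[P[1]]=-[P]$, $[P\{n\}]=q^n[P]$ (where $\{n\}$ is the $q$-grading shift by $n$ up), and $[P_2]=[P_1]+[P_3]$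 for each distinguished triangle $P_1\to P_2\to P_3\to P_1[1]$ in the homotopy category. Let $H^-_n\otimes H^-_m\to H^-_{n+m}$ be the dg algebra homomorphism $\sigma_i\otimes 1\mapsto \sigma_i$, $1\otimes\sigma_j\mapsto\sigma_{n+j}$ (super tensor product), and put $\mathrm{Ind}(P,Q)=H^-_{n+m}\otimes_{H^-_n\otimes H^-_m}(P\otimes_{\Bbbk} Q)$; let $\mathrm{Res}$ be the restriction of $H^-_{n+m}$-modules to $H^-_n\otimes H^-_m$. Then: 1. The free modules $H^-_n$ are compact projective; $K_0(H^-_0)$ and $K_0(H^-_1)$ are free $\mathbb Z[q,q^{-1}]$-modules of rank one generated by $[H^-_0]$ and $[H^-_1]$ respectively, and $K_0(H^-_n)=0$ for $n\ge 2$. 2. $\mathrm{Ind}$, $\mathrm{Res}$ and the outer tensor product $(P,Q)\mapsto P\otimes_\Bbbk Q$ preserve compact projective modules and descend to $\mathbb Z[q,q^{-1}]$-(bi)linear maps on $K_0$; the outer tensor product induces isomorphisms $K_0(H^-_n)\otimes_{\mathbb Z[q,q^{-1}]}K_0(H^-_m)\cong K_0(H^-_n\otimes H^-_m)$. Hence induction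 and restriction give a multiplication and a comultiplication on $K_0(H^-):=\bigoplus_{n\ge 0}K_0(H^-_n)$. 3. There is an isomorphism of $\mathbb Z[q,q^{-1}]$-modules $K_0(H^-)\cong \mathbb Z[q,q^{-1},E_1]/(E_1^2)$ that takes $[H^-_0]$ to $1$ and $[H^-_1]$ to $E_1$, the multiplication to the multiplication, and the comultiplication to the one determined by $\Delta(E_1)=E_1\otimes 1+1\otimes E_1$, an algebra homomorphism to the super tensor square ($E_1$ odd). Moreover $\mathbb Z[q,q^{-1},E_1]/(E_1^2)$ is the integral form of $U_q^+(\mathfrak{gl}(1|1))=\mathbb Q(q)[E_1]/(E_1^2)$: it is identified with the $\mathbb Z[q,q^{-1}]$-subalgebra generated by $E_1$. -/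

import Mathlib

open scoped TensorProduct DirectSum

universe u

noncomputable section

namespace LOTCat

/-! ### Gradings of modules -/

section Grading

variable {R : Type*} {ι : Type*} {κ : Type*} {τ : Type*} {M : Type*} {N : Type*}
variable [CommRing R] [AddCommGroup M] [Module R M] [AddCommGroup N] [Module R N]

/-- The grading of a tensor product in which `x ⊗ y`, for `x` of degree `i` and `y` of
degree `j`, has degree `s i j`. -/
def tensorGr (s : ι → κ → τ) (grM : ι → Submodule R M) (grN : κ → Submodule R N) (t : τ) :
    Submodule R (M ⊗[R] N) :=
  Submodule.span R {z | ∃ i j, ∃ x ∈ grM i, ∃ y ∈ grN j, s i j = t ∧ x ⊗ₜ[R] y = z}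

theorem tmul_mem_tensorGr {s : ι → κ → τ} {grM : ι → Submodule R M} {grN : κ → Submodule R N}
    {i : ι} {j : κ} {t : τ} {x : M} {y : N} (hx : x ∈ grM i) (hy : y ∈ grN j) (ht : s i j = t) :
    x ⊗ₜ[R] y ∈ tensorGr s grM grN t :=
  Submodule.subset_span ⟨i, j, x, hx, y, hy, ht, rfl⟩

variable [DecidableEq ι] [DecidableEq κ] [DecidableEq τ]

theorem isInternal_of_coaction (gr : ι → Submodule R M) (hsup : ∀ x, x ∈ ⨆ i, gr i)
    (ρ : M →ₗ[R] (ι →₀ M)) (h : ∀ i, ∀ x ∈ gr i, ρ x = Finsupp.single i x) :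
    DirectSum.IsInternal gr := by
  refine DirectSum.isInternal_submodule_of_iSupIndep_of_iSup_eq_top ?_
    (eq_top_iff.2 fun x _ => hsup x)
  rw [iSupIndep_def]
  intro i
  rw [Submodule.disjoint_def]
  intro x hx hx'
  have h0 : ρ x i = 0 := by
    have hle : (⨆ j, ⨆ (_ : j ≠ i), gr j) ≤ LinearMap.ker ((Finsupp.lapply i).comp ρ) := by
      refine iSup_le fun j => iSup_le fun hj => fun y hy => ?_
      rw [LinearMap.mem_ker, LinearMap.comp_apply, h j y hy]
      exact Finsupp.single_eq_of_ne (Ne.symm hj)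
    exact hle hx'
  rw [h i x hx, Finsupp.single_eq_same] at h0
  exact h0

/-- The decomposition of a vector into homogeneous components. -/
def coact {gr : ι → Submodule R M} (h : DirectSum.IsInternal gr) : M →ₗ[R] (ι →₀ M) :=
  (DirectSum.toModule R ι (ι →₀ M) fun i => (Finsupp.lsingle i).comp (gr i).subtype).comp
    (LinearEquiv.ofBijective (DirectSum.coeLinearMap gr)
      (show Function.Bijective (DirectSum.coeLinearMap gr) from h)).symm.toLinearMap

theorem coact_of_mem {gr : ι → Submodule R M} (h : DirectSum.IsInternal gr) {i : ι} {x : M}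
    (hx : x ∈ gr i) : coact h x = Finsupp.single i x := by
  have e : (LinearEquiv.ofBijective (DirectSum.coeLinearMap gr)
      (show Function.Bijective (DirectSum.coeLinearMap gr) from h)).symm x
      = DirectSum.lof R ι (fun i => gr i) i ⟨x, hx⟩ := by
    rw [LinearEquiv.symm_apply_eq]
    exact (DirectSum.coeLinearMap_lof gr i ⟨x, hx⟩).symm
  simp only [coact, LinearMap.comp_apply, LinearEquiv.coe_coe, e, DirectSum.toModule_lof]
  simp

theorem hom_induction {gr : ι → Submodule R M} (h : DirectSum.IsInternal gr) {p : M → Prop}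
    (h0 : p 0) (hadd : ∀ x y, p x → p y → p (x + y)) (hom : ∀ i, ∀ x ∈ gr i, p x) (x : M) :
    p x :=
  Submodule.iSup_induction gr (motive := p)
    (by rw [h.submodule_iSup_eq_top]; trivial : x ∈ ⨆ i, gr i) hom h0 hadd

theorem hom_ext {gr : ι → Submodule R M} (h : DirectSum.IsInternal gr) {f g : M →ₗ[R] N}
    (hfg : ∀ i, ∀ x ∈ gr i, f x = g x) : f = g := by
  ext x
  refine hom_induction h (p := fun x => f x = g x) (by simp) (fun x y hx hy => ?_) hfg x
  simp [hx, hy]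

/-- The operator that multiplies a homogeneous vector of degree `i` by the scalar `c i`. -/
def gscale {gr : ι → Submodule R M} (h : DirectSum.IsInternal gr) (c : ι → R) : M →ₗ[R] M :=
  (Finsupp.lsum R fun i => c i • (LinearMap.id : M →ₗ[R] M)).comp (coact h)

theorem gscale_of_mem {gr : ι → Submodule R M} (h : DirectSum.IsInternal gr) (c : ι → R) {i : ι}
    {x : M} (hx : x ∈ gr i) : gscale h c x = c i • x := by
  simp [gscale, coact_of_mem h hx]

theorem tensor_hom_induction {grM : ι → Submodule R M} {grN : κ → Submodule R N}
    (hM : DirectSum.IsInternal grM) (hN : DirectSum.IsInternal grN) {p : M ⊗[R] N → Prop}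
    (h0 : p 0) (hadd : ∀ x y, p x → p y → p (x + y))
    (hom : ∀ i j, ∀ x ∈ grM i, ∀ y ∈ grN j, p (x ⊗ₜ y)) (z : M ⊗[R] N) : p z := by
  induction z using TensorProduct.induction_on with
  | zero => exact h0
  | add x y hx hy => exact hadd _ _ hx hy
  | tmul x y =>
    refine hom_induction hM (p := fun x => p (x ⊗ₜ y)) (by simpa) (fun a b ha hb => ?_)
      (fun i x hx => ?_) x
    · rw [TensorProduct.add_tmul]; exact hadd _ _ ha hb
    refine hom_induction hN (p := fun y => p (x ⊗ₜ y)) (by simpa) (fun a b ha hb => ?_)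
      (fun j y hy => hom i j x hx y hy) y
    rw [TensorProduct.tmul_add]; exact hadd _ _ ha hb

theorem tensor_isInternal (s : ι → κ → τ) {grM : ι → Submodule R M} {grN : κ → Submodule R N}
    (hM : DirectSum.IsInternal grM) (hN : DirectSum.IsInternal grN) :
    DirectSum.IsInternal (tensorGr s grM grN) := by
  refine isInternal_of_coaction _ (fun z => ?_)
    ((Finsupp.lmapDomain (M ⊗[R] N) R fun p : ι × κ => s p.1 p.2).comp
      ((finsuppTensorFinsupp R R M N ι κ).toLinearMap.comp
        (TensorProduct.map (coact hM) (coact hN)))) (fun t z hz => ?_)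
  · refine tensor_hom_induction hM hN (Submodule.zero_mem _)
      (fun x y hx hy => Submodule.add_mem _ hx hy) (fun i j x hx y hy => ?_) z
    exact (le_iSup (tensorGr s grM grN) (s i j)) (tmul_mem_tensorGr hx hy rfl)
  · induction hz using Submodule.span_induction with
    | mem z hz =>
      obtain ⟨i, j, x, hx, y, hy, rfl, rfl⟩ := hz
      simp [coact_of_mem hM hx, coact_of_mem hN hy, Finsupp.mapDomain_single]
    | zero => simp
    | add a b _ _ ha hb => rw [map_add, ha, hb, Finsupp.single_add]
    | smul r a _ ha => rw [map_smul, ha, Finsupp.smul_single]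

theorem map_isInternal (e : M ≃ₗ[R] N) {gr : ι → Submodule R M} (h : DirectSum.IsInternal gr) :
    DirectSum.IsInternal fun i => (gr i).map e.toLinearMap := by
  refine isInternal_of_coaction _ (fun z => ?_)
    ((Finsupp.mapRange.linearMap e.toLinearMap).comp ((coact h).comp e.symm.toLinearMap))
    (fun t z hz => ?_)
  · rw [← Submodule.map_iSup, h.submodule_iSup_eq_top]
    exact ⟨e.symm z, trivial, by simp⟩
  · obtain ⟨x, hx, rfl⟩ := hz
    simp [coact_of_mem h hx]

theorem quotient_isInternal {gr : ι → Submodule R M} (h : DirectSum.IsInternal gr)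
    (K : Submodule R M) (hK : ∀ x ∈ K, ∀ i, coact h x i ∈ K) :
    DirectSum.IsInternal fun i => (gr i).map K.mkQ := by
  refine isInternal_of_coaction _ (fun z => ?_)
    (K.liftQ ((Finsupp.mapRange.linearMap K.mkQ).comp (coact h)) fun x hx => ?_)
    (fun t z hz => ?_)
  · rw [← Submodule.map_iSup, h.submodule_iSup_eq_top]
    obtain ⟨x, rfl⟩ := K.mkQ_surjective z
    exact ⟨x, trivial, rfl⟩
  · rw [LinearMap.mem_ker]
    ext i
    simpa using hK x hx i
  · obtain ⟨x, hx, rfl⟩ := hz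
    simp [coact_of_mem h hx]

theorem prod_isInternal {grM : ι → Submodule R M} {grN : ι → Submodule R N}
    (hM : DirectSum.IsInternal grM) (hN : DirectSum.IsInternal grN) :
    DirectSum.IsInternal fun i => (grM i).prod (grN i) := by
  refine isInternal_of_coaction _ (fun z => ?_)
    ((Finsupp.mapRange.linearMap (LinearMap.inl R M N)).comp
        ((coact hM).comp (LinearMap.fst R M N)) +
      (Finsupp.mapRange.linearMap (LinearMap.inr R M N)).comp
        ((coact hN).comp (LinearMap.snd R M N)))
    (fun t z hz => ?_)
  · obtain ⟨x, y⟩ := z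
    have hx : ((x, 0) : M × N) ∈ ⨆ i, (grM i).prod (grN i) :=
      hom_induction hM (p := fun x => ((x, 0) : M × N) ∈ ⨆ i, (grM i).prod (grN i))
        (Submodule.zero_mem _) (fun a b ha hb => by simpa using Submodule.add_mem _ ha hb)
        (fun i x hx => (le_iSup (fun i => (grM i).prod (grN i)) i) ⟨hx, Submodule.zero_mem _⟩) x
    have hy : ((0, y) : M × N) ∈ ⨆ i, (grM i).prod (grN i) :=
      hom_induction hN (p := fun y => ((0, y) : M × N) ∈ ⨆ i, (grM i).prod (grN i))
        (Submodule.zero_mem _) (fun a b ha hb => by simpa using Submodule.add_mem _ ha hb)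
        (fun i x hx => (le_iSup (fun i => (grM i).prod (grN i)) i) ⟨Submodule.zero_mem _, hx⟩) y
    simpa using Submodule.add_mem _ hx hy
  · obtain ⟨x, y⟩ := z
    simp [coact_of_mem hM hz.1, coact_of_mem hN hz.2, ← Finsupp.single_add]

theorem reindex_isInternal {gr : ι → Submodule R M} (h : DirectSum.IsInternal gr) (e : κ ≃ ι) :
    DirectSum.IsInternal fun i => gr (e i) := by
  refine isInternal_of_coaction _ (fun z => ?_)
    ((Finsupp.lmapDomain M R e.symm).comp (coact h)) (fun t z hz => ?_)
  · rw [e.iSup_comp (g := gr), h.submodule_iSup_eq_top]; trivial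
  · simp [coact_of_mem h hz, Finsupp.mapDomain_single]

theorem directSum_isInternal {I : Type*} [DecidableEq I] {X : I → Type*}
    [∀ a, AddCommGroup (X a)] [∀ a, Module R (X a)] {gr : ∀ a, ι → Submodule R (X a)}
    (h : ∀ a, DirectSum.IsInternal (gr a)) :
    DirectSum.IsInternal fun i : ι =>
      (⨅ a, (gr a i).comap (DirectSum.component R I X a) : Submodule R (⨁ a, X a)) := by
  refine isInternal_of_coaction _ (fun z => ?_)
    (DirectSum.toModule R I _ fun a =>
      (Finsupp.mapRange.linearMap (DirectSum.lof R I X a)).comp (coact (h a))) (fun t z hz => ?_)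
  · induction z using DirectSum.induction_on with
    | zero => exact Submodule.zero_mem _
    | add x y hx hy => exact Submodule.add_mem _ hx hy
    | of a x =>
      refine hom_induction (h a) (p := fun x => DirectSum.of X a x ∈ _) (by simp)
        (fun x y hx hy => by simpa using Submodule.add_mem _ hx hy) (fun i x hx => ?_) x
      refine (le_iSup (fun i : ι =>
        (⨅ a, (gr a i).comap (DirectSum.component R I X a) : Submodule R (⨁ a, X a))) i) ?_
      rw [Submodule.mem_iInf]
      intro b
      rw [Submodule.mem_comap]
      by_cases hab : a = b
      · subst hab
        rw [← DirectSum.lof_eq_of R, DirectSum.component.lof_self]; exact hx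
      · rw [← DirectSum.lof_eq_of R, DirectSum.component.of, dif_neg hab]
        exact Submodule.zero_mem _
  · rw [Submodule.mem_iInf] at hz
    have hz' : ∀ a, z a ∈ gr a t := fun a => hz a
    classical
    rw [← DirectSum.sum_support_of z, map_sum]
    have : (Finsupp.single t (∑ i ∈ DFinsupp.support z, DirectSum.of X i (z i)) :
        ι →₀ ⨁ a, X a) = ∑ i ∈ DFinsupp.support z, Finsupp.single t (DirectSum.of X i (z i)) :=
      map_sum (Finsupp.singleAddHom t) _ _
    rw [this]
    refine Finset.sum_congr rfl fun a _ => ?_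
    rw [← DirectSum.lof_eq_of R, DirectSum.toModule_lof, LinearMap.comp_apply,
      coact_of_mem (h a) (hz' a)]
    simp

end Grading

/-! ### Dg algebras and graded dg modules -/

section DG

variable (k : Type u) [Field k]

/-- The sign `(-1) ^ i` as a scalar. -/
def sg (i : ℤ) : k := ((i.negOnePow : ℤ) : k)

theorem sg_zero : sg k 0 = 1 := by simp [sg]

theorem sg_one : sg k 1 = -1 := by simp [sg]

theorem sg_add (i j : ℤ) : sg k (i + j) = sg k i * sg k j := by
  simp [sg, Int.negOnePow_add]

theorem sg_mul_self (i : ℤ) : sg k i * sg k i = 1 := by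
  rw [← sg_add]; simp [sg, Int.negOnePow_even (i + i) ⟨i, rfl⟩]

theorem sg_succ (i : ℤ) : sg k (i + 1) = -sg k i := by rw [sg_add, sg_one]; ring

theorem sg_even {i : ℤ} (h : Even i) : sg k i = 1 := by simp [sg, Int.negOnePow_even i h]

theorem sg_odd {i : ℤ} (h : Odd i) : sg k i = -1 := by simp [sg, Int.negOnePow_odd i h]

theorem units_smul_eq {M : Type*} [AddCommGroup M] [Module k M] (i : ℤ) (x : M) :
    ((-1 : ℤˣ) ^ i) • x = sg k i • x := by
  rw [Units.smul_def, sg, Int.cast_smul_eq_zsmul]; rfl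

/-- A dg algebra over `k`: a `ℤ`-graded (cohomological grading) associative unital algebra with a
differential of degree `1` satisfying the graded Leibniz rule. As a graded dg algebra it is
understood to sit entirely in `q`-degree `0`. -/
structure DGAlg where
  carrier : Type u
  [ring : Ring carrier]
  [algebra : Algebra k carrier]
  gr : ℤ → Submodule k carrier
  internal : DirectSum.IsInternal gr
  one_mem : (1 : carrier) ∈ gr 0
  mul_mem : ∀ {i j : ℤ} {a b : carrier}, a ∈ gr i → b ∈ gr j → a * b ∈ gr (i + j)
  d : carrier →ₗ[k] carrier
  d_mem : ∀ {i : ℤ} {a : carrier}, a ∈ gr i → d a ∈ gr (i + 1)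
  d_d : ∀ a, d (d a) = 0
  leibniz : ∀ {i : ℤ} {a : carrier}, a ∈ gr i → ∀ b, d (a * b) = d a * b + sg k i • (a * d b)

attribute [instance] DGAlg.ring DGAlg.algebra

variable {k}

instance (A : DGAlg k) : SetLike.GradedMonoid A.gr where
  one_mem := A.one_mem
  mul_mem _ _ _ _ ha hb := A.mul_mem ha hb

instance (A : DGAlg k) : GradedAlgebra A.gr where
  toGradedMonoid := inferInstance
  toDecomposition := A.internal.chooseDecomposition

/-- The sign automorphism `a ↦ (-1) ^ deg a • a`. -/
def DGAlg.eps (A : DGAlg k) : A.carrier →ₐ[k] A.carrier :=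
  AlgHom.ofLinearMap (gscale A.internal (sg k))
    (by rw [gscale_of_mem A.internal _ A.one_mem, sg_zero, one_smul])
    (by
      intro a b
      refine hom_induction A.internal (p := fun a => gscale A.internal (sg k) (a * b) =
        gscale A.internal (sg k) a * gscale A.internal (sg k) b) (by simp)
        (fun x y hx hy => by simp only [add_mul, map_add, hx, hy]) (fun i a ha => ?_) a
      refine hom_induction A.internal (p := fun b => gscale A.internal (sg k) (a * b) =
        gscale A.internal (sg k) a * gscale A.internal (sg k) b) (by simp)
        (fun x y hx hy => by simp only [mul_add, map_add, hx, hy]) (fun j b hb => ?_) b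
      rw [gscale_of_mem _ _ ha, gscale_of_mem _ _ hb, gscale_of_mem _ _ (A.mul_mem ha hb), sg_add,
        smul_mul_smul_comm])

theorem DGAlg.eps_of_mem (A : DGAlg k) {i : ℤ} {a : A.carrier} (ha : a ∈ A.gr i) :
    A.eps a = sg k i • a :=
  gscale_of_mem A.internal (sg k) ha

/-- A homomorphism of dg algebras. -/
structure DGHom (A B : DGAlg k) where
  toAlgHom : A.carrier →ₐ[k] B.carrier
  map_mem : ∀ {i : ℤ} {a : A.carrier}, a ∈ A.gr i → toAlgHom a ∈ B.gr i
  map_d : ∀ a, toAlgHom (A.d a) = B.d (toAlgHom a)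

/-- A graded (left) dg module over `A`: a module with a bigrading (cohomological degree,
`q`-degree), an action of `A` adding the cohomological degrees and preserving the `q`-degree, and
a differential of bidegree `(1, 0)` satisfying the Leibniz rule. The action is given as an algebra
homomorphism from `A` to the `k`-linear endomorphisms. -/
structure DGMod (A : DGAlg k) where
  carrier : Type u
  [addCommGroup : AddCommGroup carrier]
  [module : Module k carrier]
  gr : ℤ × ℤ → Submodule k carrier
  internal : DirectSum.IsInternal gr
  act : A.carrier →ₐ[k] Module.End k carrier
  act_mem : ∀ {i p q : ℤ} {a : A.carrier} {m : carrier}, a ∈ A.gr i → m ∈ gr (p, q) →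
    act a m ∈ gr (i + p, q)
  d : carrier →ₗ[k] carrier
  d_mem : ∀ {p q : ℤ} {m : carrier}, m ∈ gr (p, q) → d m ∈ gr (p + 1, q)
  d_d : ∀ m, d (d m) = 0
  leibniz : ∀ {i : ℤ} {a : A.carrier}, a ∈ A.gr i → ∀ m,
    d (act a m) = act (A.d a) m + sg k i • act a (d m)

attribute [instance] DGMod.addCommGroup DGMod.module

namespace DGMod

variable {A : DGAlg k}

/-- The homogeneous `A`-linear maps of bidegree `(n, 0)`, which satisfy
`f (a m) = (-1) ^ (n * deg a) a f(m)`. -/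
def homDeg (n : ℤ) (M N : DGMod A) : Submodule k (M.carrier →ₗ[k] N.carrier) where
  carrier := {f | (∀ p q, ∀ m ∈ M.gr (p, q), f m ∈ N.gr (p + n, q)) ∧
    ∀ i, ∀ a ∈ A.gr i, ∀ m, f (M.act a m) = sg k (n * i) • N.act a (f m)}
  zero_mem' := ⟨fun _ _ _ _ => Submodule.zero_mem _, fun _ _ _ _ => by simp⟩
  add_mem' := fun hf hg => ⟨fun p q m hm => Submodule.add_mem _ (hf.1 p q m hm) (hg.1 p q m hm),
    fun i a ha m => by simp [hf.2 i a ha m, hg.2 i a ha m]⟩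
  smul_mem' := fun c f hf => ⟨fun p q m hm => Submodule.smul_mem _ _ (hf.1 p q m hm),
    fun i a ha m => by simp [hf.2 i a ha m, smul_comm c]⟩

/-- The differential `f ↦ d ∘ f - (-1) ^ n f ∘ d` of the complex `Hom_A(M, N)`, in degree `n`. -/
def homD (n : ℤ) (M N : DGMod A) :
    (M.carrier →ₗ[k] N.carrier) →ₗ[k] (M.carrier →ₗ[k] N.carrier) :=
  LinearMap.llcomp k M.carrier N.carrier N.carrier N.d - sg k n • LinearMap.lcomp k N.carrier M.d

theorem homD_apply (n : ℤ) (M N : DGMod A) (f : M.carrier →ₗ[k] N.carrier) (m : M.carrier) :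
    homD n M N f m = N.d (f m) - sg k n • f (M.d m) := by
  simp [homD]

/-- The `n`-cocycles of the complex `Hom_A(M, N)`. -/
def homZ (n : ℤ) (M N : DGMod A) : Submodule k (M.carrier →ₗ[k] N.carrier) :=
  homDeg n M N ⊓ LinearMap.ker (homD n M N)

/-- The `n`-coboundaries of the complex `Hom_A(M, N)`. -/
def homB (n : ℤ) (M N : DGMod A) : Submodule k (M.carrier →ₗ[k] N.carrier) :=
  (homDeg (n - 1) M N).map (homD (n - 1) M N)

/-- A dg module with zero homology. -/
def IsAcyclic (M : DGMod A) : Prop := ∀ m, M.d m = 0 → ∃ m', M.d m' = m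

/-- Projective (also called `K`-projective) dg modules: `Hom_A(P, M)` has zero homology whenever
`M` does. -/
def IsProjective (P : DGMod A) : Prop :=
  ∀ M : DGMod A, M.IsAcyclic → ∀ n : ℤ, homZ n P M ≤ homB n P M

/-- Morphisms in the homotopy category of graded dg modules: degree `0` homomorphisms of dg modules
modulo homotopy. -/
abbrev HomK (M N : DGMod A) : Type u :=
  homZ 0 M N ⧸ (homB 0 M N).comap (homZ 0 M N).subtype

/-- Two dg modules are isomorphic in the homotopy category. -/
def HtpyEquiv (M N : DGMod A) : Prop :=
  ∃ f ∈ homZ 0 M N, ∃ g ∈ homZ 0 N M,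
    g.comp f - LinearMap.id ∈ homB 0 M M ∧ f.comp g - LinearMap.id ∈ homB 0 N N

/-- The direct sum of a family of graded dg modules. -/
abbrev sum {I : Type u} (N : I → DGMod A) : DGMod A where
  carrier := ⨁ a, (N a).carrier
  gr i := ⨅ a, ((N a).gr i).comap (DirectSum.component k I (fun a => (N a).carrier) a)
  internal := by classical exact directSum_isInternal fun a => (N a).internal
  act := AlgHom.ofLinearMap
    { toFun := fun x => DirectSum.lmap fun a => (N a).act x
      map_add' := fun x y => LinearMap.ext fun m => DFinsupp.ext fun b =>
        LinearMap.congr_fun (map_add (N b).act x y) (m b)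
      map_smul' := fun c x => LinearMap.ext fun m => DFinsupp.ext fun b =>
        LinearMap.congr_fun (map_smul (N b).act c x) (m b) }
    (LinearMap.ext fun m => DFinsupp.ext fun b => LinearMap.congr_fun (map_one (N b).act) (m b))
    (fun x y => LinearMap.ext fun m => DFinsupp.ext fun b =>
      LinearMap.congr_fun (map_mul (N b).act x y) (m b))
  act_mem := by
    intro i p q a m ha hm
    rw [Submodule.mem_iInf] at hm ⊢
    exact fun b => (N b).act_mem ha (hm b)
  d := DirectSum.lmap fun a => (N a).d
  d_mem := by
    intro p q m hm
    rw [Submodule.mem_iInf] at hm ⊢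
    exact fun b => (N b).d_mem (hm b)
  d_d m := DFinsupp.ext fun b => (N b).d_d (m b)
  leibniz := fun ha m => DFinsupp.ext fun b => (N b).leibniz ha (m b)

theorem homZ_comm {M N : DGMod A} {f : M.carrier →ₗ[k] N.carrier} (hf : f ∈ homZ 0 M N)
    (m : M.carrier) : N.d (f m) = f (M.d m) := by
  have h := LinearMap.congr_fun (LinearMap.mem_ker.1 hf.2) m
  rwa [homD_apply, sg_zero, one_smul, LinearMap.zero_apply, sub_eq_zero] at h

theorem homZ_act {M N : DGMod A} {f : M.carrier →ₗ[k] N.carrier} (hf : f ∈ homZ 0 M N)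
    (a : A.carrier) (m : M.carrier) : f (M.act a m) = N.act a (f m) := by
  refine hom_induction A.internal (p := fun a => f (M.act a m) = N.act a (f m)) (by simp)
    (fun x y hx hy => by simp [hx, hy]) (fun i a ha => ?_) a
  rw [hf.1.2 i a ha m, zero_mul, sg_zero, one_smul]

theorem comp_mem_homDeg {n : ℤ} {M N N' : DGMod A} {f : M.carrier →ₗ[k] N.carrier}
    {g : N.carrier →ₗ[k] N'.carrier} (hf : f ∈ homDeg n M N) (hg : g ∈ homZ 0 N N') :
    g.comp f ∈ homDeg n M N' := by
  refine ⟨fun p q m hm => ?_, fun i a ha m => ?_⟩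
  · have := hg.1.1 _ _ _ (hf.1 p q m hm)
    rwa [add_zero] at this
  · rw [LinearMap.comp_apply, hf.2 i a ha m, map_smul, homZ_act hg, LinearMap.comp_apply]

theorem homD_comp {n : ℤ} {M N N' : DGMod A} (f : M.carrier →ₗ[k] N.carrier)
    {g : N.carrier →ₗ[k] N'.carrier} (hg : g ∈ homZ 0 N N') :
    homD n M N' (g.comp f) = g.comp (homD n M N f) := by
  ext m
  simp [homD_apply, homZ_comm hg]

/-- Composition with a homomorphism of dg modules, on the level of the homotopy category. -/
def postcomp (M : DGMod A) {N N' : DGMod A} (g : homZ 0 N N') : HomK M N →ₗ[k] HomK M N' :=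
  Submodule.mapQ _ _
    ((LinearMap.llcomp k M.carrier N.carrier N'.carrier g.1).restrict
      (p := homZ 0 M N) (q := homZ 0 M N') fun f hf => ⟨comp_mem_homDeg hf.1 g.2, by
        have h : homD 0 M N f = 0 := hf.2
        change homD 0 M N' (g.1.comp f) = 0
        rw [homD_comp f g.2, h, LinearMap.comp_zero]⟩)
    (by
      rintro ⟨f, hf⟩ ⟨s, hs, h⟩
      exact ⟨g.1.comp s, comp_mem_homDeg hs g.2, by
        rw [homD_comp s g.2, h]; rfl⟩)

open Classical in
/-- The inclusion of a summand into a direct sum of dg modules. -/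
def sumIncl {I : Type u} (N : I → DGMod A) (i : I) : homZ 0 (N i) (sum N) :=
  ⟨DirectSum.lof k I (fun a => (N a).carrier) i, by
    have key : ∀ (m : (N i).carrier) (φ : ∀ a, (N a).carrier →ₗ[k] (N a).carrier),
        DirectSum.lmap φ (DirectSum.lof k I (fun a => (N a).carrier) i m) =
          DirectSum.lof k I (fun a => (N a).carrier) i (φ i m) :=
      fun m φ => DirectSum.lmap_lof φ i m
    refine ⟨⟨fun p q m hm => ?_, fun j a ha m => ?_⟩, ?_⟩
    · rw [add_zero]
      refine (Submodule.mem_iInf _).2 fun b => ?_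
      rw [Submodule.mem_comap]
      by_cases h : i = b
      · subst h
        rw [DirectSum.component.lof_self]; exact hm
      · rw [DirectSum.component.of, dif_neg h]; exact Submodule.zero_mem _
    · rw [zero_mul, sg_zero, one_smul]
      exact (key m fun a' => (N a').act a).symm
    · refine LinearMap.mem_ker.2 (LinearMap.ext fun m => ?_)
      rw [homD_apply, sg_zero, one_smul, LinearMap.zero_apply, sub_eq_zero]
      exact key m fun a' => (N a').d⟩

open Classical in
/-- The canonical map from `⨁ i, Hom(M, N i)` to `Hom(M, ⨁ i, N i)` in the homotopy category. -/
def sumHomK (M : DGMod A) {I : Type u} (N : I → DGMod A) :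
    (⨁ i, HomK M (N i)) →ₗ[k] HomK M (sum N) :=
  DirectSum.toModule k I _ fun i => postcomp M (sumIncl N i)

/-- Compactness of an object of the homotopy category of projective graded dg modules. -/
def IsCompact (M : DGMod A) : Prop :=
  ∀ (I : Type u) (N : I → DGMod A), (∀ i, (N i).IsProjective) → Function.Bijective (sumHomK M N)

/-- The cohomological shift `M[1]`: `M[1]^i = M^(i+1)`, the differential changes sign and the left
action of `a` is multiplied by `(-1) ^ deg a`. -/
abbrev shift (M : DGMod A) : DGMod A where
  carrier := M.carrier
  gr i := M.gr (i.1 + 1, i.2)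
  internal := reindex_isInternal M.internal ((Equiv.addRight (1 : ℤ)).prodCongr (Equiv.refl ℤ))
  act := M.act.comp A.eps
  act_mem := by
    intro i p q a m ha hm
    rw [AlgHom.comp_apply, A.eps_of_mem ha, map_smul, LinearMap.smul_apply]
    have := M.act_mem ha hm
    rw [← add_assoc] at this
    exact Submodule.smul_mem _ _ this
  d := -M.d
  d_mem := fun hm => Submodule.neg_mem _ (M.d_mem hm)
  d_d m := by simp [M.d_d]
  leibniz := by
    intro i a ha m
    simp only [AlgHom.comp_apply, A.eps_of_mem ha, A.eps_of_mem (A.d_mem ha), map_smul,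
      LinearMap.smul_apply, LinearMap.neg_apply, M.leibniz ha, sg_succ, map_neg, smul_add,
      smul_neg, neg_smul, neg_add]

/-- The `q`-grading shift `M{n}` by `n` degrees up. -/
abbrev qshift (n : ℤ) (M : DGMod A) : DGMod A where
  carrier := M.carrier
  gr i := M.gr (i.1, i.2 - n)
  internal := reindex_isInternal M.internal ((Equiv.refl ℤ).prodCongr (Equiv.subRight n))
  act := M.act
  act_mem := fun ha hm => M.act_mem ha hm
  d := M.d
  d_mem := fun hm => M.d_mem hm
  d_d := M.d_d
  leibniz := fun ha m => M.leibniz ha m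

/-- The cone `N ⊕ M[1]` of a homomorphism `f : M → N` of dg modules, with differential
`(n, m) ↦ (d n + f m, - d m)`. -/
abbrev cone {M N : DGMod A} (f : homZ 0 M N) : DGMod A where
  carrier := N.carrier × M.carrier
  gr i := (N.gr i).prod (M.shift.gr i)
  internal := prod_isInternal N.internal M.shift.internal
  act := AlgHom.ofLinearMap
    { toFun := fun a => (N.act a).prodMap (M.act (A.eps a))
      map_add' := fun a b => by ext <;> simp
      map_smul' := fun c a => by ext <;> simp }
    (by ext <;> simp) (fun a b => by ext <;> simp)
  act_mem := fun ha hm => ⟨N.act_mem ha hm.1, M.shift.act_mem ha hm.2⟩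
  d := (N.d.comp (LinearMap.fst k _ _) + f.1.comp (LinearMap.snd k _ _)).prod
    ((-M.d).comp (LinearMap.snd k _ _))
  d_mem := by
    intro p q m hm
    refine ⟨Submodule.add_mem _ (N.d_mem hm.1) ?_, M.shift.d_mem hm.2⟩
    have := f.2.1.1 _ _ _ hm.2
    rwa [add_zero] at this
  d_d := by
    rintro ⟨n, m⟩
    simp [N.d_d, M.d_d, homZ_comm f.2]
  leibniz := by
    rintro i a ha ⟨n, m⟩
    refine Prod.ext ?_ (M.shift.leibniz ha m)
    change N.d (N.act a n) + f.1 (M.act (A.eps a) m) =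
      N.act (A.d a) n + sg k i • N.act a (N.d n + f.1 m)
    rw [N.leibniz ha, A.eps_of_mem ha, map_smul, LinearMap.smul_apply, map_smul, homZ_act f.2,
      map_add, smul_add, add_assoc]

/-- There is a distinguished triangle `P₁ → P₂ → P₃ → P₁[1]` in the homotopy category: up to
isomorphism in that category it is `X → Y → cone f → X[1]` for some `f : X → Y`. -/
def IsTriangle (P₁ P₂ P₃ : DGMod A) : Prop :=
  ∃ (X Y : DGMod A) (f : homZ 0 X Y),
    HtpyEquiv P₁ X ∧ HtpyEquiv P₂ Y ∧ HtpyEquiv P₃ (cone f)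

/-- The free module `A` of rank one, with its generator in bidegree `(0, 0)`. -/
abbrev regular (A : DGAlg k) : DGMod A where
  carrier := A.carrier
  gr i := if i.2 = 0 then A.gr i.1 else ⊥
  internal := by
    refine isInternal_of_coaction _ (fun x => ?_)
      ((Finsupp.lmapDomain A.carrier k fun i : ℤ => (i, (0 : ℤ))).comp (coact A.internal))
      (fun i x hx => ?_)
    · refine hom_induction A.internal (p := fun x => x ∈ _) (Submodule.zero_mem _)
        (fun x y hx hy => Submodule.add_mem _ hx hy) (fun i x hx => ?_) x
      refine (le_iSup (fun i : ℤ × ℤ => if i.2 = 0 then A.gr i.1 else ⊥) (i, 0)) ?_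
      simpa using hx
    · obtain ⟨p, q⟩ := i
      by_cases hq : q = 0
      · subst hq
        rw [if_pos rfl] at hx
        simp [coact_of_mem A.internal hx, Finsupp.mapDomain_single]
      · rw [if_neg hq, Submodule.mem_bot] at hx
        simp [hx]
  act := Algebra.lmul k A.carrier
  act_mem := by
    intro i p q a m ha hm
    by_cases hq : q = 0
    · simp only [hq, if_true] at hm ⊢
      exact A.mul_mem ha hm
    · simp only [hq, if_false, Submodule.mem_bot] at hm ⊢
      simp [hm]
  d := A.d
  d_mem := by
    intro p q m hm
    by_cases hq : q = 0
    · simp only [hq, if_true] at hm ⊢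
      exact A.d_mem hm
    · simp only [hq, if_false, Submodule.mem_bot] at hm ⊢
      simp [hm]
  d_d := A.d_d
  leibniz := fun ha m => A.leibniz ha m

/-- The restriction of a dg module along a homomorphism of dg algebras. -/
abbrev restrict {B : DGAlg k} (φ : DGHom A B) (M : DGMod B) : DGMod A where
  carrier := M.carrier
  gr := M.gr
  internal := M.internal
  act := M.act.comp φ.toAlgHom
  act_mem := fun ha hm => M.act_mem (φ.map_mem ha) hm
  d := M.d
  d_mem := fun hm => M.d_mem hm
  d_d := M.d_d
  leibniz := fun ha m => by
    rw [AlgHom.comp_apply, AlgHom.comp_apply, φ.map_d]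
    exact M.leibniz (φ.map_mem ha) m

end DGMod

/-! ### The Grothendieck group -/

/-- The ring `ℤ[q, q⁻¹]`. -/
abbrev Zq : Type := LaurentPolynomial ℤ

/-- Compact projective graded dg modules. -/
def DGMod.IsPerf {A : DGAlg k} (P : DGMod A) : Prop := P.IsProjective ∧ P.IsCompact

/-- Objects of the category of compact projective graded dg modules. -/
def Perf (A : DGAlg k) : Type (u + 1) := {P : DGMod A // P.IsPerf}

/-- The defining relations of the Grothendieck group. -/
inductive K0Rel (A : DGAlg k) : (Perf A →₀ Zq) → Prop
  | shift (P P' : Perf A) (h : P'.1.HtpyEquiv P.1.shift) :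
      K0Rel A (Finsupp.single P' 1 + Finsupp.single P 1)
  | triangle (P₁ P₂ P₃ : Perf A) (h : DGMod.IsTriangle P₁.1 P₂.1 P₃.1) :
      K0Rel A (Finsupp.single P₂ 1 - (Finsupp.single P₁ 1 + Finsupp.single P₃ 1))
  | qshift (n : ℤ) (P P' : Perf A) (h : P'.1.HtpyEquiv (P.1.qshift n)) :
      K0Rel A (Finsupp.single P' 1 - Finsupp.single P (LaurentPolynomial.T n))

/-- The Grothendieck group of the category of compact projective graded dg modules, as a
`ℤ[q, q⁻¹]`-module: generators `[P]`, relations `[P[1]] = -[P]`, `[P₂] = [P₁] + [P₃]` for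
distinguished triangles, `[P{n}] = q ^ n [P]`. -/
abbrev K0 (A : DGAlg k) : Type (u + 1) :=
  (Perf A →₀ Zq) ⧸ Submodule.span Zq {x | K0Rel A x}

/-- The symbol `[P]` of a compact projective dg module. -/
def K0.cls {A : DGAlg k} (P : DGMod A) (hP : P.IsPerf) : K0 A :=
  Submodule.Quotient.mk (Finsupp.single (⟨P, hP⟩ : Perf A) 1)

/-! ### The LOT dg algebras -/

section LOT

variable (k) (n : ℕ)

/-- Indices of the generators of `H⁻ₙ`: the index `i : ℕ` with `i + 1 < n` stands for the
generator `σ_{i+1}` among `σ_1, …, σ_{n-1}`. -/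
abbrev LIdx (n : ℕ) : Type := {i : ℕ // i + 1 < n}

/-- The defining relations of `H⁻ₙ`. -/
inductive LOTRel : FreeAlgebra k (LIdx n) → FreeAlgebra k (LIdx n) → Prop
  | sq (i : LIdx n) : LOTRel (FreeAlgebra.ι k i * FreeAlgebra.ι k i) 0
  | anti (i j : LIdx n) (h : i.1 + 1 < j.1 ∨ j.1 + 1 < i.1) :
      LOTRel (FreeAlgebra.ι k i * FreeAlgebra.ι k j + FreeAlgebra.ι k j * FreeAlgebra.ι k i) 0
  | braid (i j : LIdx n) (h : i.1 + 1 = j.1) :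
      LOTRel (FreeAlgebra.ι k i * FreeAlgebra.ι k j * FreeAlgebra.ι k i)
        (FreeAlgebra.ι k j * FreeAlgebra.ι k i * FreeAlgebra.ι k j)

/-- The algebra `H⁻ₙ` (without grading and differential). -/
def LOTAlg : Type u := RingQuot (LOTRel k n)

instance : Ring (LOTAlg k n) := inferInstanceAs (Ring (RingQuot (LOTRel k n)))

instance : Algebra k (LOTAlg k n) := inferInstanceAs (Algebra k (RingQuot (LOTRel k n)))

/-- The quotient map from the free algebra. -/
def LOTmk : FreeAlgebra k (LIdx n) →ₐ[k] LOTAlg k n := RingQuot.mkAlgHom k (LOTRel k n)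

theorem LOTmk_rel {x y : FreeAlgebra k (LIdx n)} (h : LOTRel k n x y) :
    LOTmk k n x = LOTmk k n y :=
  RingQuot.mkAlgHom_rel k h

variable {n}

/-- The generators of `H⁻ₙ`. -/
def sig (i : LIdx n) : LOTAlg k n := LOTmk k n (FreeAlgebra.ι k i)

theorem sig_sq (i : LIdx n) : sig k i * sig k i = 0 := by
  have h := LOTmk_rel k n (LOTRel.sq (k := k) i)
  rwa [map_mul, map_zero] at h

theorem sig_anti (i j : LIdx n) (h : i.1 + 1 < j.1 ∨ j.1 + 1 < i.1) :
    sig k i * sig k j + sig k j * sig k i = 0 := by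
  have h := LOTmk_rel k n (LOTRel.anti (k := k) i j h)
  rwa [map_add, map_mul, map_mul, map_zero] at h

theorem sig_braid (i j : LIdx n) (h : i.1 + 1 = j.1) :
    sig k i * sig k j * sig k i = sig k j * sig k i * sig k j := by
  have h := LOTmk_rel k n (LOTRel.braid (k := k) i j h)
  rwa [map_mul, map_mul, map_mul, map_mul] at h

/-- The universal property of `H⁻ₙ`. -/
def LOTlift {B : Type*} [Ring B] [Algebra k B] (f : LIdx n → B) (h1 : ∀ i, f i * f i = 0)
    (h2 : ∀ i j : LIdx n, i.1 + 1 < j.1 ∨ j.1 + 1 < i.1 → f i * f j + f j * f i = 0)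
    (h3 : ∀ i j : LIdx n, i.1 + 1 = j.1 → f i * f j * f i = f j * f i * f j) :
    LOTAlg k n →ₐ[k] B :=
  show RingQuot (LOTRel k n) →ₐ[k] B from RingQuot.liftAlgHom k ⟨FreeAlgebra.lift k f, by
    intro x y h
    cases h with
    | sq i => simp [h1]
    | anti i j h => simp [h2 i j h]
    | braid i j h => simp [h3 i j h]⟩

theorem LOTlift_sig {B : Type*} [Ring B] [Algebra k B] (f : LIdx n → B) (h1 : ∀ i, f i * f i = 0)
    (h2 : ∀ i j : LIdx n, i.1 + 1 < j.1 ∨ j.1 + 1 < i.1 → f i * f j + f j * f i = 0)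
    (h3 : ∀ i j : LIdx n, i.1 + 1 = j.1 → f i * f j * f i = f j * f i * f j) (i : LIdx n) :
    LOTlift k f h1 h2 h3 (sig k i) = f i :=
  (RingQuot.liftAlgHom_mkAlgHom_apply k (FreeAlgebra.lift k f) _ (FreeAlgebra.ι k i)).trans
    (FreeAlgebra.lift_ι_apply f i)

/-- The product of a sequence of generators. -/
def word (l : List (LIdx n)) : LOTAlg k n := (l.map (sig k)).prod

theorem word_nil : word k ([] : List (LIdx n)) = 1 := rfl

theorem word_cons (i : LIdx n) (l : List (LIdx n)) : word k (i :: l) = sig k i * word k l := by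
  simp [word]

theorem word_append (l l' : List (LIdx n)) : word k (l ++ l') = word k l * word k l' := by
  simp [word]

variable (n) in
/-- The cohomological grading of `H⁻ₙ`, with `deg σ_i = -1`. -/
def LOTgr (i : ℤ) : Submodule k (LOTAlg k n) :=
  Submodule.span k {x | ∃ l : List (LIdx n), (l.length : ℤ) = -i ∧ word k l = x}

theorem word_mem (l : List (LIdx n)) : word k l ∈ LOTgr k n (-(l.length : ℤ)) :=
  Submodule.subset_span ⟨l, by simp, rfl⟩

theorem LOT_span (x : LOTAlg k n) : x ∈ Submodule.span k (Set.range (word k (n := n))) := by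
  obtain ⟨y, rfl⟩ : ∃ y, LOTmk k n y = x := RingQuot.mkAlgHom_surjective k (LOTRel k n) x
  induction y using FreeAlgebra.induction with
  | grade0 r =>
    rw [AlgHom.commutes, Algebra.algebraMap_eq_smul_one]
    exact Submodule.smul_mem _ _ (Submodule.subset_span ⟨[], rfl⟩)
  | grade1 i => exact Submodule.subset_span ⟨[i], by simp [word, sig]⟩
  | add a b ha hb => rw [map_add]; exact Submodule.add_mem _ ha hb
  | mul a b ha hb =>
    rw [map_mul]
    have h := Submodule.mul_mem_mul ha hb
    rw [Submodule.span_mul_span] at h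
    refine Submodule.span_mono ?_ h
    rintro _ ⟨_, ⟨l, rfl⟩, _, ⟨l', rfl⟩, rfl⟩
    exact ⟨l ++ l', word_append k l l'⟩

/-- The algebra homomorphism that encodes the grading. -/
def LOTcoact : LOTAlg k n →ₐ[k] AddMonoidAlgebra (LOTAlg k n) ℤ :=
  LOTlift k (fun i => AddMonoidAlgebra.single (-1) (sig k i))
    (fun i => by
      rw [AddMonoidAlgebra.single_mul_single, sig_sq, AddMonoidAlgebra.single_zero])
    (fun i j h => by
      rw [AddMonoidAlgebra.single_mul_single, AddMonoidAlgebra.single_mul_single,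
        ← AddMonoidAlgebra.single_add, sig_anti k i j h, AddMonoidAlgebra.single_zero])
    (fun i j h => by simp only [AddMonoidAlgebra.single_mul_single, sig_braid k i j h])

theorem LOTcoact_word (l : List (LIdx n)) :
    LOTcoact k (word k l) = AddMonoidAlgebra.single (-(l.length : ℤ)) (word k l) := by
  induction l with
  | nil => rw [word_nil, map_one, List.length_nil, Nat.cast_zero, neg_zero, AddMonoidAlgebra.one_def]
  | cons i l ih =>
    rw [word_cons, map_mul, ih, LOTcoact, LOTlift_sig, AddMonoidAlgebra.single_mul_single]
    congr 1
    push_cast [List.length_cons]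
    ring

theorem LOT_internal : DirectSum.IsInternal (LOTgr k n) := by
  refine isInternal_of_coaction _ (fun x => ?_)
    { toFun := fun x => (LOTcoact k x).coeff
      map_add' := fun x y => by simp
      map_smul' := fun c x => by simp } (fun i x hx => ?_)
  · refine (Submodule.span_le.2 ?_) (LOT_span k x)
    rintro _ ⟨l, rfl⟩
    exact (le_iSup (LOTgr k n) _) (word_mem k l)
  · induction hx using Submodule.span_induction with
    | mem x hx =>
      obtain ⟨l, hl, rfl⟩ := hx
      change (LOTcoact k (word k l)).coeff = _
      rw [LOTcoact_word, hl, neg_neg, AddMonoidAlgebra.coeff_single]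
    | zero => simp
    | add a b _ _ ha hb => rw [map_add, ha, hb, Finsupp.single_add]
    | smul r a _ ha => rw [map_smul, ha, Finsupp.smul_single]

/-- The algebra homomorphism `a ↦ !![(-1) ^ deg a • a, d a; 0, a]` that encodes the differential. -/
def LOTmat : LOTAlg k n →ₐ[k] Matrix (Fin 2) (Fin 2) (LOTAlg k n) :=
  LOTlift k (fun i => !![-sig k i, 1; 0, sig k i])
    (fun i => by
      ext a b
      fin_cases a <;> fin_cases b <;> simp [Matrix.mul_apply, sig_sq])
    (fun i j h => by
      ext a b
      fin_cases a <;> fin_cases b <;> simp [sig_anti k i j h])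
    (fun i j h => by
      ext a b
      fin_cases a <;> fin_cases b <;>
        simp [Matrix.mul_apply, sig_braid k i j h, sig_sq, add_mul]
      abel)

theorem LOTmat_sig (i : LIdx n) : LOTmat k (sig k i) = !![-sig k i, 1; 0, sig k i] := by
  rw [LOTmat, LOTlift_sig]

/-- The differential of `H⁻ₙ`. -/
def LOTd : LOTAlg k n →ₗ[k] LOTAlg k n :=
  (Matrix.entryLinearMap k (LOTAlg k n) (0 : Fin 2) (1 : Fin 2)).comp (LOTmat k).toLinearMap

theorem LOTd_apply (x : LOTAlg k n) : LOTd k x = LOTmat k x 0 1 := rfl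

theorem LOTd_sig (i : LIdx n) : LOTd k (sig k i) = 1 := by simp [LOTd_apply, LOTmat_sig]

theorem LOTd_one : LOTd k (1 : LOTAlg k n) = 0 := by simp [LOTd_apply]

theorem LOTmat_word (l : List (LIdx n)) : LOTmat k (word k l) 1 0 = 0 ∧
    LOTmat k (word k l) 1 1 = word k l ∧
    LOTmat k (word k l) 0 0 = sg k (-(l.length : ℤ)) • word k l := by
  induction l with
  | nil => simp [word_nil, sg_zero]
  | cons i l ih =>
    have e : sg k (-((i :: l).length : ℤ)) = -sg k (-(l.length : ℤ)) := by
      rw [← neg_eq_iff_eq_neg, ← sg_succ]; simp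
    rw [e, word_cons, map_mul, LOTmat_sig]
    simp [Matrix.mul_apply, ih]

theorem LOTmat_one_one (x : LOTAlg k n) : LOTmat k x 1 1 = x := by
  induction LOT_span k x using Submodule.span_induction with
  | mem x hx => obtain ⟨l, rfl⟩ := hx; exact (LOTmat_word k l).2.1
  | zero => simp
  | add a b _ _ ha hb => simp [ha, hb]
  | smul r a _ ha => simp [ha]

theorem LOTmat_zero_zero {i : ℤ} {x : LOTAlg k n} (hx : x ∈ LOTgr k n i) :
    LOTmat k x 0 0 = sg k i • x := by
  induction hx using Submodule.span_induction with
  | mem x hx =>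
    obtain ⟨l, hl, rfl⟩ := hx
    rw [(LOTmat_word k l).2.2, hl, neg_neg]
  | zero => simp
  | add a b _ _ ha hb => simp [ha, hb]
  | smul r a _ ha => simp [ha, smul_comm r]

theorem LOTd_leibniz {i : ℤ} {x : LOTAlg k n} (hx : x ∈ LOTgr k n i) (y : LOTAlg k n) :
    LOTd k (x * y) = LOTd k x * y + sg k i • (x * LOTd k y) := by
  rw [LOTd_apply, map_mul, Matrix.mul_apply, Fin.sum_univ_two, LOTmat_zero_zero k hx,
    LOTmat_one_one, LOTd_apply, LOTd_apply, add_comm, smul_mul_assoc]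

theorem LOTd_sig_mul (i : LIdx n) (x : LOTAlg k n) :
    LOTd k (sig k i * x) = x - sig k i * LOTd k x := by
  rw [LOTd_apply, map_mul, Matrix.mul_apply, Fin.sum_univ_two, LOTmat_sig, LOTmat_one_one,
    LOTd_apply]
  simp; abel

theorem LOTgr_mul {i j : ℤ} {x y : LOTAlg k n} (hx : x ∈ LOTgr k n i) (hy : y ∈ LOTgr k n j) :
    x * y ∈ LOTgr k n (i + j) := by
  have h := Submodule.mul_mem_mul hx hy
  rw [LOTgr, LOTgr, Submodule.span_mul_span] at h
  refine Submodule.span_mono ?_ h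
  rintro _ ⟨_, ⟨l, hl, rfl⟩, _, ⟨l', hl', rfl⟩, rfl⟩
  exact ⟨l ++ l', by rw [List.length_append]; push_cast; omega, word_append k l l'⟩

theorem LOTd_word_mem (l : List (LIdx n)) : LOTd k (word k l) ∈ LOTgr k n (-(l.length : ℤ) + 1) := by
  induction l with
  | nil => rw [word_nil, LOTd_one]; exact Submodule.zero_mem _
  | cons i l ih =>
    rw [word_cons, LOTd_sig_mul]
    have e1 : -((i :: l).length : ℤ) + 1 = -(l.length : ℤ) := by simp
    have e2 : -(l.length : ℤ) = -1 + (-(l.length : ℤ) + 1) := by ring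
    have h := LOTgr_mul k (word_mem k [i]) ih
    rw [word_cons, word_nil, mul_one] at h
    rw [e1]
    refine Submodule.sub_mem _ (word_mem k l) ?_
    rw [e2]
    exact h

theorem LOTd_d_word (l : List (LIdx n)) : LOTd k (LOTd k (word k l)) = 0 := by
  induction l with
  | nil => rw [word_nil, LOTd_one, map_zero]
  | cons i l ih => rw [word_cons, LOTd_sig_mul, map_sub, LOTd_sig_mul, ih]; simp

variable (n) in
/-- The dg algebra `H⁻ₙ`. -/
def LOT : DGAlg k where
  carrier := LOTAlg k n
  gr := LOTgr k n
  internal := LOT_internal k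
  one_mem := Submodule.subset_span ⟨[], by simp, rfl⟩
  mul_mem := LOTgr_mul k
  d := LOTd k
  d_mem := by
    intro i x hx
    induction hx using Submodule.span_induction with
    | mem x hx =>
      obtain ⟨l, hl, rfl⟩ := hx
      have h := LOTd_word_mem k l
      rwa [hl, neg_neg] at h
    | zero => simp
    | add a b _ _ ha hb => rw [map_add]; exact Submodule.add_mem _ ha hb
    | smul r a _ ha => rw [map_smul]; exact Submodule.smul_mem _ _ ha
  d_d := by
    intro x
    induction LOT_span k x using Submodule.span_induction with
    | mem x hx => obtain ⟨l, rfl⟩ := hx; exact LOTd_d_word k l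
    | zero => simp
    | add a b _ _ ha hb => simp [ha, hb]
    | smul r a _ ha => simp [ha]
  leibniz := LOTd_leibniz k

end LOT

/-! ### Super tensor products, outer tensor products and induction -/

section Tensor

/-- The differential `x ⊗ y ↦ d x ⊗ y + (-1) ^ deg x • x ⊗ d y`, where the sign is given by the
function `c` of the degree. -/
def tensorD {ι M N : Type*} [DecidableEq ι] [AddCommGroup M] [Module k M] [AddCommGroup N]
    [Module k N] {gr : ι → Submodule k M} (h : DirectSum.IsInternal gr) (c : ι → k)
    (dM : M →ₗ[k] M) (dN : N →ₗ[k] N) : M ⊗[k] N →ₗ[k] M ⊗[k] N :=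
  TensorProduct.map dM LinearMap.id + TensorProduct.map (gscale h c) dN

theorem tensorD_tmul {ι M N : Type*} [DecidableEq ι] [AddCommGroup M] [Module k M]
    [AddCommGroup N] [Module k N] {gr : ι → Submodule k M} (h : DirectSum.IsInternal gr)
    (c : ι → k) (dM : M →ₗ[k] M) (dN : N →ₗ[k] N) {i : ι} {x : M} (hx : x ∈ gr i) (y : N) :
    tensorD h c dM dN (x ⊗ₜ y) = dM x ⊗ₜ y + c i • (x ⊗ₜ dN y) := by
  simp [tensorD, gscale_of_mem h c hx, TensorProduct.smul_tmul']

/-- Scalars in the proofs of Leibniz rules. -/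
theorem sg_mul_succ (i j : ℤ) : sg k (j * (i + 1)) = sg k (j * i) * sg k j := by
  rw [mul_add, mul_one, sg_add]

theorem sg_succ_mul (i j : ℤ) : sg k ((j + 1) * i) = sg k (j * i) * sg k i := by
  rw [add_mul, one_mul, sg_add]

namespace DGAlg

variable (A B : DGAlg k)

/-- The tensor product of two elements, in the super tensor product. -/
def tm (a : A.carrier) (b : B.carrier) : GradedTensorProduct k A.gr B.gr :=
  GradedTensorProduct.tmul k a b

variable {A B}

theorem tm_mul_tm {i j : ℤ} (a : A.carrier) {b : B.carrier} (hb : b ∈ B.gr j) {a' : A.carrier}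
    (ha' : a' ∈ A.gr i) (b' : B.carrier) :
    tm A B a b * tm A B a' b' = sg k (j * i) • tm A B (a * a') (b * b') := by
  rw [← units_smul_eq]
  exact GradedTensorProduct.tmul_coe_mul_coe_tmul A.gr B.gr a ⟨b, hb⟩ ⟨a', ha'⟩ b'

theorem tm_induction {p : GradedTensorProduct k A.gr B.gr → Prop} (h0 : p 0)
    (hadd : ∀ x y, p x → p y → p (x + y))
    (hom : ∀ i j, ∀ a ∈ A.gr i, ∀ b ∈ B.gr j, p (tm A B a b)) (z) : p z :=
  tensor_hom_induction A.internal B.internal (p := p) h0 hadd hom z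

variable (A B)

/-- The grading of the super tensor product. -/
def tensorGrading (t : ℤ) : Submodule k (GradedTensorProduct k A.gr B.gr) :=
  (tensorGr (fun i j : ℤ => i + j) A.gr B.gr t).map (GradedTensorProduct.of k A.gr B.gr).toLinearMap

variable {A B}

theorem tm_mem {i j t : ℤ} {a : A.carrier} (ha : a ∈ A.gr i) {b : B.carrier} (hb : b ∈ B.gr j)
    (ht : i + j = t) : tm A B a b ∈ tensorGrading A B t :=
  ⟨_, tmul_mem_tensorGr ha hb ht, rfl⟩

theorem tensorGrading_induction {t : ℤ} {p : GradedTensorProduct k A.gr B.gr → Prop} (h0 : p 0)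
    (hadd : ∀ x y, p x → p y → p (x + y)) (hsmul : ∀ (c : k) x, p x → p (c • x))
    (hom : ∀ i j, i + j = t → ∀ a ∈ A.gr i, ∀ b ∈ B.gr j, p (tm A B a b))
    {z : GradedTensorProduct k A.gr B.gr} (hz : z ∈ tensorGrading A B t) : p z := by
  obtain ⟨z, hz, rfl⟩ := hz
  refine Submodule.span_induction (p := fun z _ => p (GradedTensorProduct.of k A.gr B.gr z))
    ?_ h0 (fun x y _ _ hx hy => hadd _ _ hx hy) (fun c x _ hx => hsmul c _ hx) hz
  rintro _ ⟨i, j, a, ha, b, hb, hij, rfl⟩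
  exact hom i j hij a ha b hb

variable (A B)

/-- The differential of the super tensor product. -/
def tensorDiff : GradedTensorProduct k A.gr B.gr →ₗ[k] GradedTensorProduct k A.gr B.gr :=
  (GradedTensorProduct.of k A.gr B.gr).toLinearMap.comp
    ((tensorD A.internal (sg k) A.d B.d).comp (GradedTensorProduct.of k A.gr B.gr).symm.toLinearMap)

variable {A B}

theorem tensorDiff_tm {i : ℤ} {a : A.carrier} (ha : a ∈ A.gr i) (b : B.carrier) :
    tensorDiff A B (tm A B a b) = tm A B (A.d a) b + sg k i • tm A B a (B.d b) := by
  change GradedTensorProduct.of k A.gr B.gr (tensorD A.internal (sg k) A.d B.d (a ⊗ₜ b)) = _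
  rw [tensorD_tmul A.internal (sg k) A.d B.d ha, map_add, map_smul]
  rfl

theorem tm_add_left (a a' : A.carrier) (b : B.carrier) :
    tm A B (a + a') b = tm A B a b + tm A B a' b :=
  TensorProduct.add_tmul a a' b

theorem tm_add_right (a : A.carrier) (b b' : B.carrier) :
    tm A B a (b + b') = tm A B a b + tm A B a b' :=
  TensorProduct.tmul_add a b b'

theorem tm_smul_left (c : k) (a : A.carrier) (b : B.carrier) :
    tm A B (c • a) b = c • tm A B a b :=
  (TensorProduct.smul_tmul' c a b).symm

theorem tm_smul_right (c : k) (a : A.carrier) (b : B.carrier) :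
    tm A B a (c • b) = c • tm A B a b :=
  TensorProduct.tmul_smul c a b

theorem tm_zero_left (b : B.carrier) : tm A B 0 b = 0 :=
  TensorProduct.zero_tmul _ b

theorem tm_zero_right (a : A.carrier) : tm A B a 0 = 0 :=
  TensorProduct.tmul_zero _ a

variable (A B)

/-- The tensor product of dg algebras in the category of super vector spaces:
`(a ⊗ b) (a' ⊗ b') = (-1) ^ (deg b * deg a') a a' ⊗ b b'`. -/
abbrev tensor : DGAlg k where
  carrier := GradedTensorProduct k A.gr B.gr
  gr := tensorGrading A B
  internal := map_isInternal (GradedTensorProduct.of k A.gr B.gr)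
    (tensor_isInternal _ A.internal B.internal)
  one_mem := tm_mem A.one_mem B.one_mem rfl
  mul_mem := by
    intro i j z w hz hw
    refine tensorGrading_induction (p := fun z => z * w ∈ tensorGrading A B (i + j))
      (by simp) (fun x y hx hy => by rw [add_mul]; exact Submodule.add_mem _ hx hy)
      (fun c x hx => by rw [smul_mul_assoc]; exact Submodule.smul_mem _ _ hx)
      (fun i1 i2 hi a ha b hb => ?_) hz
    refine tensorGrading_induction (p := fun w => tm A B a b * w ∈ tensorGrading A B (i + j))
      (by simp) (fun x y hx hy => by rw [mul_add]; exact Submodule.add_mem _ hx hy)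
      (fun c x hx => by rw [mul_smul_comm]; exact Submodule.smul_mem _ _ hx)
      (fun j1 j2 hj a' ha' b' hb' => ?_) hw
    rw [tm_mul_tm a hb ha' b']
    exact Submodule.smul_mem _ _ (tm_mem (A.mul_mem ha ha') (B.mul_mem hb hb') (by omega))
  d := tensorDiff A B
  d_mem := by
    intro i z hz
    refine tensorGrading_induction (p := fun z => tensorDiff A B z ∈ tensorGrading A B (i + 1))
      (by simp) (fun x y hx hy => by rw [map_add]; exact Submodule.add_mem _ hx hy)
      (fun c x hx => by rw [map_smul]; exact Submodule.smul_mem _ _ hx)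
      (fun i1 i2 hi a ha b hb => ?_) hz
    rw [tensorDiff_tm ha]
    exact Submodule.add_mem _ (tm_mem (A.d_mem ha) hb (by omega))
      (Submodule.smul_mem _ _ (tm_mem ha (B.d_mem hb) (by omega)))
  d_d := by
    refine tm_induction (p := fun z => tensorDiff A B (tensorDiff A B z) = 0) (by simp)
      (fun x y hx hy => by rw [map_add, map_add, hx, hy, add_zero]) (fun i j a ha b hb => ?_)
    rw [tensorDiff_tm ha, map_add, map_smul, tensorDiff_tm (A.d_mem ha), tensorDiff_tm ha, A.d_d,
      B.d_d, tm_zero_left, tm_zero_right, sg_succ]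
    module
  leibniz := by
    intro t z hz w
    refine tensorGrading_induction (p := fun z => tensorDiff A B (z * w) =
        tensorDiff A B z * w + sg k t • (z * tensorDiff A B w)) (by simp)
      (fun x y hx hy => by rw [add_mul, map_add, hx, hy, map_add, add_mul, add_mul]; module)
      (fun c x hx => by
        rw [smul_mul_assoc, map_smul, hx, map_smul, smul_mul_assoc, smul_mul_assoc]; module)
      (fun i j hij a ha b hb => ?_) hz
    refine tm_induction (p := fun w => tensorDiff A B (tm A B a b * w) =
        tensorDiff A B (tm A B a b) * w + sg k t • (tm A B a b * tensorDiff A B w)) (by simp)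
      (fun x y hx hy => by rw [mul_add, map_add, hx, hy, map_add, mul_add, mul_add]; module)
      (fun i' j' a' ha' b' hb' => ?_) w
    subst hij
    rw [tm_mul_tm a hb ha' b', map_smul, tensorDiff_tm (A.mul_mem ha ha'), tensorDiff_tm ha,
      tensorDiff_tm ha', A.leibniz ha, B.leibniz hb, add_mul, smul_mul_assoc, mul_add,
      mul_smul_comm, tm_mul_tm _ hb ha', tm_mul_tm _ (B.d_mem hb) ha', tm_mul_tm _ hb (A.d_mem ha'),
      tm_mul_tm _ hb ha', tm_add_left, tm_add_right, tm_smul_left, tm_smul_right, sg_add, sg_add,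
      sg_mul_succ, sg_succ_mul]
    have hj := sg_mul_self k j
    generalize tm A B (A.d a * a') (b * b') = t1
    generalize tm A B (a * A.d a') (b * b') = t2
    generalize tm A B (a * a') (B.d b * b') = t3
    generalize tm A B (a * a') (b * B.d b') = t4
    match_scalars
    · ring
    · linear_combination (-(sg k (j * i') * sg k i)) * hj
    · ring
    · ring

/-- The automorphism `eps ^ p`. -/
def epsPow (p : ℤ) : A.carrier →ₐ[k] A.carrier :=
  if Even p then AlgHom.id k A.carrier else A.eps

theorem epsPow_of_mem (p : ℤ) {j : ℤ} {a : A.carrier} (ha : a ∈ A.gr j) :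
    A.epsPow p a = sg k (j * p) • a := by
  by_cases hp : Even p
  · rw [epsPow, if_pos hp, sg_even k (hp.mul_left j), one_smul]; rfl
  · rw [epsPow, if_neg hp, A.eps_of_mem ha]
    have hp' := Int.not_even_iff_odd.1 hp
    by_cases hj : Even j
    · rw [sg_even k hj, sg_even k (hj.mul_right p)]
    · have hj' := Int.not_even_iff_odd.1 hj
      rw [sg_odd k hj', sg_odd k (hj'.mul hp')]

end DGAlg

end Tensor

section Modules

namespace DGMod

section Outer

variable {A B : DGAlg k}

/-- The action of `1 ⊗ b` on `P ⊗ Q`: `p ⊗ q ↦ (-1) ^ (deg b * deg p) p ⊗ b q`. -/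
def outerActR (P : DGMod A) (Q : DGMod B) :
    B.carrier →ₗ[k] Module.End k (P.carrier ⊗[k] Q.carrier) where
  toFun b :=
    TensorProduct.map (gscale P.internal fun x => if Even x.1 then 1 else 0) (Q.act b) +
    TensorProduct.map (gscale P.internal fun x => if Even x.1 then 0 else 1) (Q.act (B.eps b))
  map_add' b b' := by
    simp only [map_add, TensorProduct.map_add_right]; abel
  map_smul' c b := by
    simp only [map_smul, TensorProduct.map_smul_right, RingHom.id_apply, smul_add]

theorem outerActR_tmul (P : DGMod A) (Q : DGMod B) (b : B.carrier) {x : ℤ × ℤ} {p : P.carrier}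
    (hp : p ∈ P.gr x) (q : Q.carrier) :
    outerActR P Q b (p ⊗ₜ q) = p ⊗ₜ Q.act (B.epsPow x.1 b) q := by
  simp only [outerActR, LinearMap.coe_mk, AddHom.coe_mk, LinearMap.add_apply,
    TensorProduct.map_tmul, gscale_of_mem P.internal _ hp, DGAlg.epsPow]
  by_cases hx : Even x.1 <;> simp [hx]

theorem outer_ext {P : DGMod A} {Q : DGMod B} {N : Type*} [AddCommGroup N] [Module k N]
    {f g : P.carrier ⊗[k] Q.carrier →ₗ[k] N}
    (h : ∀ x y, ∀ p ∈ P.gr x, ∀ q ∈ Q.gr y, f (p ⊗ₜ q) = g (p ⊗ₜ q)) : f = g := by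
  ext1
  refine LOTCat.hom_ext P.internal fun x p hp => LOTCat.hom_ext Q.internal fun y q hq => ?_
  exact h x y p hp q hq

/-- The action of `A ⊗ B` on `P ⊗ Q`: `(a ⊗ b) (p ⊗ q) = (-1) ^ (deg b * deg p) a p ⊗ b q`. -/
def outerAct (P : DGMod A) (Q : DGMod B) :
    GradedTensorProduct k A.gr B.gr →ₐ[k] Module.End k (P.carrier ⊗[k] Q.carrier) :=
  GradedTensorProduct.lift A.gr B.gr
    ((Module.End.rTensorAlgHom k P.carrier Q.carrier).comp P.act)
    (AlgHom.ofLinearMap (outerActR P Q)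
      (outer_ext fun x y p hp q hq => by
        rw [outerActR_tmul P Q _ hp, map_one, map_one]; rfl)
      (fun b b' => outer_ext fun x y p hp q hq => by
        rw [outerActR_tmul P Q _ hp, map_mul, map_mul, Module.End.mul_apply, Module.End.mul_apply,
          outerActR_tmul P Q _ hp, outerActR_tmul P Q _ hp]))
    (by
      rintro i j ⟨a, ha⟩ ⟨b, hb⟩
      rw [units_smul_eq k]
      refine outer_ext fun x y p hp q hq => ?_
      change (P.act a).rTensor Q.carrier (outerActR P Q b (p ⊗ₜ q)) =
        sg k (j * i) • outerActR P Q b ((P.act a).rTensor Q.carrier (p ⊗ₜ q))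
      obtain ⟨x1, x2⟩ := x
      rw [outerActR_tmul P Q _ hp, LinearMap.rTensor_tmul, LinearMap.rTensor_tmul,
        outerActR_tmul P Q _ (P.act_mem ha hp), B.epsPow_of_mem _ hb, B.epsPow_of_mem _ hb,
        map_smul, map_smul, LinearMap.smul_apply, LinearMap.smul_apply, TensorProduct.tmul_smul,
        TensorProduct.tmul_smul, smul_smul, mul_add, sg_add, ← mul_assoc, sg_mul_self, one_mul])

theorem outerAct_tmul (P : DGMod A) (Q : DGMod B) (a : A.carrier) {b : B.carrier} {j : ℤ}
    (hb : b ∈ B.gr j) {x : ℤ × ℤ} {p : P.carrier} (hp : p ∈ P.gr x) (q : Q.carrier) :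
    outerAct P Q (DGAlg.tm A B a b) (p ⊗ₜ q) =
      sg k (j * x.1) • (P.act a p ⊗ₜ[k] Q.act b q) := by
  change (P.act a).rTensor Q.carrier (outerActR P Q b (p ⊗ₜ q)) = _
  rw [outerActR_tmul P Q _ hp, B.epsPow_of_mem _ hb, map_smul, LinearMap.smul_apply,
    TensorProduct.tmul_smul, map_smul, LinearMap.rTensor_tmul]

/-- The outer tensor product `P ⊠ Q` of dg modules over `A` and `B`, a dg module over the super
tensor product `A ⊗ B`. -/
abbrev outer (P : DGMod A) (Q : DGMod B) : DGMod (A.tensor B) where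
  carrier := P.carrier ⊗[k] Q.carrier
  gr := tensorGr (fun x y : ℤ × ℤ => x + y) P.gr Q.gr
  internal := tensor_isInternal _ P.internal Q.internal
  act := outerAct P Q
  act_mem := by
    intro i p q z m hz hm
    refine DGAlg.tensorGrading_induction (p := fun z => outerAct P Q z m ∈
        tensorGr (fun x y : ℤ × ℤ => x + y) P.gr Q.gr (i + p, q))
      (by rw [map_zero]; exact Submodule.zero_mem _)
      (fun x y hx hy => by rw [map_add]; exact Submodule.add_mem _ hx hy)
      (fun c x hx => by rw [map_smul]; exact Submodule.smul_mem _ _ hx)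
      (fun i1 i2 hi a ha b hb => ?_) hz
    induction hm using Submodule.span_induction with
    | mem m hm =>
      obtain ⟨⟨x1, x2⟩, ⟨y1, y2⟩, u, hu, v, hv, hxy, rfl⟩ := hm
      rw [outerAct_tmul P Q a hb hu]
      refine Submodule.smul_mem _ _ (tmul_mem_tensorGr (P.act_mem ha hu) (Q.act_mem hb hv) ?_)
      simp only [Prod.mk_add_mk, Prod.mk.injEq] at hxy ⊢
      omega
    | zero => rw [map_zero]; exact Submodule.zero_mem _
    | add x y _ _ hx hy => rw [map_add]; exact Submodule.add_mem _ hx hy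
    | smul c x _ hx => rw [map_smul]; exact Submodule.smul_mem _ _ hx
  d := tensorD P.internal (fun x => sg k x.1) P.d Q.d
  d_mem := by
    intro p q m hm
    induction hm using Submodule.span_induction with
    | mem m hm =>
      obtain ⟨⟨x1, x2⟩, ⟨y1, y2⟩, u, hu, v, hv, hxy, rfl⟩ := hm
      simp only [Prod.mk_add_mk, Prod.mk.injEq] at hxy
      rw [tensorD_tmul _ _ _ _ hu]
      refine Submodule.add_mem _ (tmul_mem_tensorGr (P.d_mem hu) hv ?_)
        (Submodule.smul_mem _ _ (tmul_mem_tensorGr hu (Q.d_mem hv) ?_)) <;>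
      · simp only [Prod.mk_add_mk, Prod.mk.injEq]
        omega
    | zero => rw [map_zero]; exact Submodule.zero_mem _
    | add x y _ _ hx hy => rw [map_add]; exact Submodule.add_mem _ hx hy
    | smul c x _ hx => rw [map_smul]; exact Submodule.smul_mem _ _ hx
  d_d := by
    refine tensor_hom_induction P.internal Q.internal (by simp)
      (fun x y hx hy => by rw [map_add, map_add, hx, hy, add_zero]) (fun x y p hp q hq => ?_)
    obtain ⟨x1, x2⟩ := x
    rw [tensorD_tmul _ _ _ _ hp, map_add, map_smul, tensorD_tmul _ _ _ _ (P.d_mem hp),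
      tensorD_tmul _ _ _ _ hp, P.d_d, Q.d_d, TensorProduct.zero_tmul, TensorProduct.tmul_zero,
      sg_succ]
    module
  leibniz := by
    intro t z hz m
    refine DGAlg.tensorGrading_induction (p := fun z =>
        tensorD P.internal (fun x => sg k x.1) P.d Q.d (outerAct P Q z m) =
        outerAct P Q (DGAlg.tensorDiff A B z) m +
          sg k t • outerAct P Q z (tensorD P.internal (fun x => sg k x.1) P.d Q.d m))
      (by simp)
      (fun x y hx hy => by
        simp only [map_add, LinearMap.add_apply, hx, hy]; module)
      (fun c x hx => by
        simp only [map_smul, LinearMap.smul_apply, hx]; module)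
      (fun i j hij a ha b hb => ?_) hz
    refine tensor_hom_induction P.internal Q.internal (p := fun m =>
        tensorD P.internal (fun x => sg k x.1) P.d Q.d (outerAct P Q (DGAlg.tm A B a b) m) =
        outerAct P Q (DGAlg.tensorDiff A B (DGAlg.tm A B a b)) m +
          sg k t • outerAct P Q (DGAlg.tm A B a b)
            (tensorD P.internal (fun x => sg k x.1) P.d Q.d m))
      (by simp)
      (fun x y hx hy => by
        simp only [map_add, hx, hy]; module)
      (fun x y p hp q hq => ?_) m
    obtain ⟨x1, x2⟩ := x
    subst hij
    rw [outerAct_tmul P Q a hb hp, map_smul, tensorD_tmul _ _ _ _ (P.act_mem ha hp),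
      tensorD_tmul _ _ _ _ hp, DGAlg.tensorDiff_tm ha, map_add, map_smul, LinearMap.add_apply,
      LinearMap.smul_apply, map_add, map_smul, outerAct_tmul P Q _ hb hp,
      outerAct_tmul P Q _ (B.d_mem hb) hp, outerAct_tmul P Q _ hb (P.d_mem hp),
      outerAct_tmul P Q _ hb hp, P.leibniz ha, Q.leibniz hb, TensorProduct.add_tmul,
      TensorProduct.tmul_add, ← TensorProduct.smul_tmul', TensorProduct.tmul_smul]
    simp only [sg_add, sg_mul_succ, sg_succ_mul]
    have hj := sg_mul_self k j
    generalize P.act (A.d a) p ⊗ₜ[k] Q.act b q = t1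
    generalize P.act a (P.d p) ⊗ₜ[k] Q.act b q = t2
    generalize P.act a p ⊗ₜ[k] Q.act (B.d b) q = t3
    generalize P.act a p ⊗ₜ[k] Q.act b (Q.d q) = t4
    match_scalars
    · ring
    · linear_combination (-(sg k (j * x1) * sg k i)) * hj
    · ring
    · ring

end Outer

section Extend

variable {A C : DGAlg k} (φ : DGHom A C) (M : DGMod A)

/-- The relations `c φ(a) ⊗ m = c ⊗ a m` that define `C ⊗_A M` as a quotient of `C ⊗_k M`. -/
def extRel : Submodule k (C.carrier ⊗[k] M.carrier) :=
  Submodule.span k {z | ∃ c a m, (c * φ.toAlgHom a) ⊗ₜ[k] m - c ⊗ₜ[k] M.act a m = z}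

theorem extRel_le {S : Submodule k (C.carrier ⊗[k] M.carrier)}
    (h : ∀ i j x, ∀ c ∈ C.gr i, ∀ a ∈ A.gr j, ∀ m ∈ M.gr x,
      (c * φ.toAlgHom a) ⊗ₜ[k] m - c ⊗ₜ[k] M.act a m ∈ S) : extRel φ M ≤ S := by
  refine Submodule.span_le.2 ?_
  rintro _ ⟨c, a, m, rfl⟩
  rw [SetLike.mem_coe]
  refine hom_induction C.internal
    (p := fun c => (c * φ.toAlgHom a) ⊗ₜ[k] m - c ⊗ₜ[k] M.act a m ∈ S) (by simp)
    (fun x y hx hy => ?_) (fun i c hc => ?_) c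
  · rw [add_mul, TensorProduct.add_tmul, TensorProduct.add_tmul, add_sub_add_comm]
    exact S.add_mem hx hy
  refine hom_induction A.internal
    (p := fun a => (c * φ.toAlgHom a) ⊗ₜ[k] m - c ⊗ₜ[k] M.act a m ∈ S) (by simp)
    (fun x y hx hy => ?_) (fun j a ha => ?_) a
  · rw [map_add, map_add, mul_add, TensorProduct.add_tmul, LinearMap.add_apply,
      TensorProduct.tmul_add, add_sub_add_comm]
    exact S.add_mem hx hy
  refine hom_induction M.internal
    (p := fun m => (c * φ.toAlgHom a) ⊗ₜ[k] m - c ⊗ₜ[k] M.act a m ∈ S) (by simp)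
    (fun x y hx hy => ?_) (fun x m hm => h i j x c hc a ha m hm) m
  rw [map_add, TensorProduct.tmul_add, TensorProduct.tmul_add, add_sub_add_comm]
  exact S.add_mem hx hy

theorem rel_mem_extRel (c : C.carrier) (a : A.carrier) (m : M.carrier) :
    (c * φ.toAlgHom a) ⊗ₜ[k] m - c ⊗ₜ[k] M.act a m ∈ extRel φ M :=
  Submodule.subset_span ⟨c, a, m, rfl⟩

/-- The bigrading of `C ⊗_k M`. -/
def extGr : ℤ × ℤ → Submodule k (C.carrier ⊗[k] M.carrier) :=
  tensorGr (fun (i : ℤ) (x : ℤ × ℤ) => (i + x.1, x.2)) C.gr M.gr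

theorem extGr_internal : DirectSum.IsInternal (extGr (C := C) M) :=
  tensor_isInternal _ C.internal M.internal

theorem extRel_homogeneous (z : C.carrier ⊗[k] M.carrier) (hz : z ∈ extRel φ M) (x : ℤ × ℤ) :
    coact (extGr_internal (C := C) M) z x ∈ extRel φ M := by
  have h : extRel φ M ≤ (extRel φ M).comap
      ((Finsupp.lapply x).comp (coact (extGr_internal (C := C) M))) := by
    refine extRel_le φ M fun i j y c hc a ha m hm => ?_
    obtain ⟨y1, y2⟩ := y
    have h1 : (c * φ.toAlgHom a) ⊗ₜ[k] m - c ⊗ₜ[k] M.act a m ∈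
        extGr (C := C) M (i + j + y1, y2) :=
      Submodule.sub_mem _ (tmul_mem_tensorGr (C.mul_mem hc (φ.map_mem ha)) hm rfl)
        (tmul_mem_tensorGr hc (M.act_mem ha hm) (by rw [add_assoc]))
    rw [Submodule.mem_comap, LinearMap.comp_apply, coact_of_mem _ h1, Finsupp.lapply_apply,
      Finsupp.single_apply]
    split_ifs
    · exact rel_mem_extRel φ M c a m
    · exact Submodule.zero_mem _
  exact h hz

theorem extRel_mul (c' : C.carrier) :
    extRel φ M ≤ (extRel φ M).comap ((LinearMap.mulLeft k c').rTensor M.carrier) := by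
  refine Submodule.span_le.2 ?_
  rintro _ ⟨c, a, m, rfl⟩
  rw [SetLike.mem_coe, Submodule.mem_comap, map_sub, LinearMap.rTensor_tmul,
    LinearMap.rTensor_tmul, LinearMap.mulLeft_apply, LinearMap.mulLeft_apply, ← mul_assoc]
  exact rel_mem_extRel φ M (c' * c) a m

theorem extRel_d : extRel φ M ≤ (extRel φ M).comap (tensorD C.internal (sg k) C.d M.d) := by
  refine extRel_le φ M fun i j y c hc a ha m hm => ?_
  rw [Submodule.mem_comap, map_sub, tensorD_tmul _ _ _ _ (C.mul_mem hc (φ.map_mem ha)),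
    tensorD_tmul _ _ _ _ hc, C.leibniz hc, ← φ.map_d, M.leibniz ha]
  have h1 := rel_mem_extRel φ M (C.d c) a m
  have h2 := Submodule.smul_mem _ (sg k i) (rel_mem_extRel φ M c (A.d a) m)
  have h3 := Submodule.smul_mem _ (sg k (i + j)) (rel_mem_extRel φ M c a (M.d m))
  convert Submodule.add_mem _ (Submodule.add_mem _ h1 h2) h3 using 1
  simp only [TensorProduct.add_tmul, TensorProduct.tmul_add, ← TensorProduct.smul_tmul',
    TensorProduct.tmul_smul, sg_add]
  module

theorem extMk_ext {N : Type*} [AddCommGroup N] [Module k N]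
    {f g : (C.carrier ⊗[k] M.carrier) ⧸ extRel φ M →ₗ[k] N}
    (h : ∀ c m, f ((extRel φ M).mkQ (c ⊗ₜ m)) = g ((extRel φ M).mkQ (c ⊗ₜ m))) : f = g := by
  refine Submodule.linearMap_qext _ (TensorProduct.ext' fun c m => ?_)
  exact h c m

/-- The action of `C` on `C ⊗_A M`. -/
def extAct : C.carrier →ₐ[k] Module.End k ((C.carrier ⊗[k] M.carrier) ⧸ extRel φ M) :=
  AlgHom.ofLinearMap
    { toFun := fun c => Submodule.mapQ _ _ _ (extRel_mul φ M c)
      map_add' := fun c c' => extMk_ext φ M fun x m => by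
        simp only [Submodule.mkQ_apply, Submodule.mapQ_apply, LinearMap.add_apply,
          LinearMap.rTensor_tmul, LinearMap.mulLeft_apply, add_mul, TensorProduct.add_tmul,
          Submodule.Quotient.mk_add]
      map_smul' := fun r c => extMk_ext φ M fun x m => by
        simp only [Submodule.mkQ_apply, Submodule.mapQ_apply, LinearMap.smul_apply,
          LinearMap.rTensor_tmul, LinearMap.mulLeft_apply, smul_mul_assoc,
          ← TensorProduct.smul_tmul', Submodule.Quotient.mk_smul, RingHom.id_apply] }
    (extMk_ext φ M fun x m => by
      simp only [LinearMap.coe_mk, AddHom.coe_mk, Submodule.mkQ_apply, Submodule.mapQ_apply,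
        LinearMap.rTensor_tmul, LinearMap.mulLeft_apply, one_mul, Module.End.one_apply])
    (fun c c' => extMk_ext φ M fun x m => by
      simp only [LinearMap.coe_mk, AddHom.coe_mk, Submodule.mkQ_apply, Submodule.mapQ_apply,
        LinearMap.rTensor_tmul, LinearMap.mulLeft_apply, mul_assoc, Module.End.mul_apply])

theorem extAct_mkQ (c : C.carrier) (z : C.carrier ⊗[k] M.carrier) :
    extAct φ M c ((extRel φ M).mkQ z) =
      (extRel φ M).mkQ ((LinearMap.mulLeft k c).rTensor M.carrier z) := rfl

/-- The extension of scalars `C ⊗_A M` of a dg module along a homomorphism `φ : A → C` of dg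
algebras. -/
abbrev extend : DGMod C where
  carrier := (C.carrier ⊗[k] M.carrier) ⧸ extRel φ M
  gr x := (extGr (C := C) M x).map (extRel φ M).mkQ
  internal := quotient_isInternal (extGr_internal M) _ (extRel_homogeneous φ M)
  act := extAct φ M
  act_mem := by
    rintro i p q c _ hc ⟨z, hz, rfl⟩
    rw [extAct_mkQ]
    refine Submodule.mem_map_of_mem ?_
    induction hz using Submodule.span_induction with
    | mem z hz =>
      obtain ⟨j, ⟨x1, x2⟩, c', hc', m, hm, hx, rfl⟩ := hz
      rw [LinearMap.rTensor_tmul]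
      refine tmul_mem_tensorGr (C.mul_mem hc hc') hm ?_
      simp only [Prod.mk.injEq] at hx ⊢
      omega
    | zero => rw [map_zero]; exact Submodule.zero_mem _
    | add x y _ _ hx hy => rw [map_add]; exact Submodule.add_mem _ hx hy
    | smul r x _ hx => rw [map_smul]; exact Submodule.smul_mem _ _ hx
  d := Submodule.mapQ _ _ _ (extRel_d φ M)
  d_mem := by
    rintro p q _ ⟨z, hz, rfl⟩
    refine Submodule.mem_map_of_mem (p := extGr (C := C) M (p + 1, q))
      (r := tensorD C.internal (sg k) C.d M.d z) ?_
    induction hz using Submodule.span_induction with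
    | mem z hz =>
      obtain ⟨j, ⟨x1, x2⟩, c', hc', m, hm, hx, rfl⟩ := hz
      simp only [Prod.mk.injEq] at hx
      rw [tensorD_tmul _ _ _ _ hc']
      refine Submodule.add_mem _ (tmul_mem_tensorGr (C.d_mem hc') hm ?_)
        (Submodule.smul_mem _ _ (tmul_mem_tensorGr hc' (M.d_mem hm) ?_)) <;>
      · simp only [Prod.mk.injEq]
        omega
    | zero => rw [map_zero]; exact Submodule.zero_mem _
    | add x y _ _ hx hy => rw [map_add]; exact Submodule.add_mem _ hx hy
    | smul r x _ hx => rw [map_smul]; exact Submodule.smul_mem _ _ hx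
  d_d := by
    intro z
    obtain ⟨z, rfl⟩ := (extRel φ M).mkQ_surjective z
    rw [Submodule.mkQ_apply, Submodule.mapQ_apply, Submodule.mapQ_apply]
    refine (congrArg Submodule.Quotient.mk ?_).trans (Submodule.Quotient.mk_zero _)
    refine tensor_hom_induction C.internal M.internal (p := fun z =>
      tensorD C.internal (sg k) C.d M.d (tensorD C.internal (sg k) C.d M.d z) = 0) (by simp)
      (fun x y hx hy => by rw [map_add, map_add, hx, hy, add_zero]) (fun i x c hc m hm => ?_) z
    rw [tensorD_tmul _ _ _ _ hc, map_add, map_smul, tensorD_tmul _ _ _ _ (C.d_mem hc),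
      tensorD_tmul _ _ _ _ hc, C.d_d, M.d_d, TensorProduct.zero_tmul, TensorProduct.tmul_zero,
      sg_succ]
    module
  leibniz := by
    intro i c hc z
    obtain ⟨z, rfl⟩ := (extRel φ M).mkQ_surjective z
    rw [extAct_mkQ]
    refine Eq.trans (b := (extRel φ M).mkQ (tensorD C.internal (sg k) C.d M.d
      ((LinearMap.mulLeft k c).rTensor M.carrier z))) rfl ?_
    refine Eq.trans (b := (extRel φ M).mkQ ((LinearMap.mulLeft k (C.d c)).rTensor M.carrier z +
      sg k i • (LinearMap.mulLeft k c).rTensor M.carrier (tensorD C.internal (sg k) C.d M.d z)))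
      (congrArg _ ?_) rfl
    refine tensor_hom_induction C.internal M.internal (p := fun z =>
      tensorD C.internal (sg k) C.d M.d ((LinearMap.mulLeft k c).rTensor M.carrier z) =
      (LinearMap.mulLeft k (C.d c)).rTensor M.carrier z + sg k i •
        (LinearMap.mulLeft k c).rTensor M.carrier (tensorD C.internal (sg k) C.d M.d z)) (by simp)
      (fun x y hx hy => by simp only [map_add, hx, hy]; module) (fun j x c' hc' m hm => ?_) z
    rw [LinearMap.rTensor_tmul, LinearMap.rTensor_tmul, LinearMap.mulLeft_apply,
      LinearMap.mulLeft_apply, tensorD_tmul _ _ _ _ (C.mul_mem hc hc'), tensorD_tmul _ _ _ _ hc',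
      map_add, map_smul, LinearMap.rTensor_tmul, LinearMap.rTensor_tmul, LinearMap.mulLeft_apply,
      LinearMap.mulLeft_apply, C.leibniz hc, TensorProduct.add_tmul, ← TensorProduct.smul_tmul',
      sg_add]
    module

end Extend

end DGMod

end Modules

/-! ### The inclusions of LOT algebras, induction and restriction -/

section Inclusion

/-- The homomorphism `a ⊗ b ↦ f a * g b` out of a super tensor product, for two supercommuting
homomorphisms `f` and `g` of dg algebras. -/
def DGHom.ofTensor {A B C : DGAlg k} (f : DGHom A C) (g : DGHom B C)
    (hfg : ∀ {i j : ℤ} {a : A.carrier} {b : B.carrier}, a ∈ A.gr i → b ∈ B.gr j →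
      f.toAlgHom a * g.toAlgHom b = sg k (j * i) • (g.toAlgHom b * f.toAlgHom a)) :
    DGHom (A.tensor B) C where
  toAlgHom := GradedTensorProduct.lift A.gr B.gr f.toAlgHom g.toAlgHom (by
    rintro i j ⟨a, ha⟩ ⟨b, hb⟩
    rw [units_smul_eq k]
    exact hfg ha hb)
  map_mem := by
    intro i z hz
    generalize_proofs hF
    refine DGAlg.tensorGrading_induction (p := fun z =>
        GradedTensorProduct.lift A.gr B.gr f.toAlgHom g.toAlgHom hF z ∈ C.gr i)
      (by rw [map_zero]; exact Submodule.zero_mem _)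
      (fun x y hx hy => by rw [map_add]; exact Submodule.add_mem _ hx hy)
      (fun c x hx => by rw [map_smul]; exact Submodule.smul_mem _ _ hx)
      (fun i1 i2 hi a ha b hb => ?_) hz
    subst hi
    exact C.mul_mem (f.map_mem ha) (g.map_mem hb)
  map_d := by
    generalize_proofs hF
    refine DGAlg.tm_induction (p := fun z =>
        GradedTensorProduct.lift A.gr B.gr f.toAlgHom g.toAlgHom hF (DGAlg.tensorDiff A B z) =
        C.d (GradedTensorProduct.lift A.gr B.gr f.toAlgHom g.toAlgHom hF z)) (by simp)
      (fun x y hx hy => by simp only [map_add, hx, hy]) (fun i j a ha b hb => ?_)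
    rw [DGAlg.tensorDiff_tm ha, map_add, map_smul]
    change f.toAlgHom (A.d a) * g.toAlgHom b + sg k i • (f.toAlgHom a * g.toAlgHom (B.d b)) =
      C.d (f.toAlgHom a * g.toAlgHom b)
    rw [C.leibniz (f.map_mem ha), f.map_d, g.map_d]

variable (k)

/-- The generator `σ_{i+c}` of `H⁻_N`, for a generator `σ_i` of `H⁻ₙ`. -/
def idxShift {n N : ℕ} (c : ℕ) (h : n + c ≤ N) (i : LIdx n) : LIdx N :=
  ⟨i.1 + c, by have := i.2; omega⟩

/-- The homomorphism `H⁻ₙ → H⁻_N`, `σ_i ↦ σ_{i+c}`, which adds `c` vertical lines on the left and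
`N - n - c` vertical lines on the right of a diagram. -/
def LOTshift {n N : ℕ} (c : ℕ) (h : n + c ≤ N) : LOTAlg k n →ₐ[k] LOTAlg k N :=
  LOTlift k (fun i => sig k (idxShift c h i)) (fun i => sig_sq k _)
    (fun i j hij => sig_anti k _ _ (by simp only [idxShift]; omega))
    (fun i j hij => sig_braid k _ _ (by simp only [idxShift]; omega))

theorem LOTshift_word {n N : ℕ} (c : ℕ) (h : n + c ≤ N) (l : List (LIdx n)) :
    LOTshift k c h (word k l) = word k (l.map (idxShift c h)) := by
  induction l with
  | nil => rw [word_nil, map_one]; rfl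
  | cons i l ih => rw [word_cons, map_mul, ih, LOTshift, LOTlift_sig, List.map_cons, word_cons]

theorem LOTshift_mem {n N : ℕ} (c : ℕ) (h : n + c ≤ N) {i : ℤ} {x : LOTAlg k n}
    (hx : x ∈ LOTgr k n i) : LOTshift k c h x ∈ LOTgr k N i := by
  induction hx using Submodule.span_induction with
  | mem x hx =>
    obtain ⟨l, hl, rfl⟩ := hx
    rw [LOTshift_word]
    exact Submodule.subset_span ⟨l.map (idxShift c h), by rw [List.length_map, hl], rfl⟩
  | zero => simp
  | add a b _ _ ha hb => rw [map_add]; exact Submodule.add_mem _ ha hb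
  | smul r a _ ha => rw [map_smul]; exact Submodule.smul_mem _ _ ha

theorem LOTshift_d {n N : ℕ} (c : ℕ) (h : n + c ≤ N) (x : LOTAlg k n) :
    LOTshift k c h (LOTd k x) = LOTd k (LOTshift k c h x) := by
  induction LOT_span k x using Submodule.span_induction with
  | mem x hx =>
    obtain ⟨l, rfl⟩ := hx
    induction l with
    | nil => rw [word_nil, LOTd_one, map_zero, map_one, LOTd_one]
    | cons i l ih =>
      have e : LOTshift k c h (sig k i) = sig k (idxShift c h i) := by rw [LOTshift, LOTlift_sig]
      rw [word_cons, LOTd_sig_mul, map_sub, map_mul, map_mul, ih, e, LOTd_sig_mul]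
  | zero => simp
  | add a b _ _ ha hb => simp only [map_add, ha, hb]
  | smul r a _ ha => simp only [map_smul, ha]

theorem word_anti {N : ℕ} (i : LIdx N) (l : List (LIdx N)) (hl : ∀ j ∈ l, i.1 + 1 < j.1) :
    sig k i * word k l = sg k l.length • (word k l * sig k i) := by
  induction l with
  | nil => simp [word_nil, sg_zero]
  | cons j l ih =>
    have h1 := eq_neg_of_add_eq_zero_left (sig_anti k i j (Or.inl (hl j (by simp))))
    have h2 := ih fun j' hj' => hl j' (by simp [hj'])
    rw [word_cons, ← mul_assoc, h1, neg_mul, mul_assoc, h2, List.length_cons, Nat.cast_add,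
      Nat.cast_one, sg_succ, mul_smul_comm, mul_assoc, neg_smul]

theorem word_word_anti {N : ℕ} (l l' : List (LIdx N)) (h : ∀ i ∈ l, ∀ j ∈ l', i.1 + 1 < j.1) :
    word k l * word k l' = sg k (l'.length * l.length) • (word k l' * word k l) := by
  induction l with
  | nil => simp [word_nil, sg_zero]
  | cons i l ih =>
    have h1 := word_anti k i l' (h i (by simp))
    have h2 := ih fun i' hi' => h i' (by simp [hi'])
    rw [word_cons, mul_assoc, h2, mul_smul_comm, ← mul_assoc, h1, smul_mul_assoc, smul_smul,
      List.length_cons, Nat.cast_add, Nat.cast_one, sg_mul_succ, mul_assoc]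

theorem LOTshift_anti {n m N : ℕ} (h : n + m = N) {i j : ℤ} {a : LOTAlg k n} {b : LOTAlg k m}
    (ha : a ∈ LOTgr k n i) (hb : b ∈ LOTgr k m j) :
    LOTshift k (N := N) 0 (by omega) a * LOTshift k (N := N) n (by omega) b =
      sg k (j * i) • (LOTshift k (N := N) n (by omega) b *
        LOTshift k (N := N) 0 (by omega) a) := by
  induction ha using Submodule.span_induction with
  | mem x hx =>
    obtain ⟨l, hl, rfl⟩ := hx
    induction hb using Submodule.span_induction with
    | mem y hy =>
      obtain ⟨l', hl', rfl⟩ := hy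
      rw [LOTshift_word, LOTshift_word, word_word_anti]
      · rw [List.length_map, List.length_map, hl, hl', neg_mul_neg]
      · intro i hi j hj
        obtain ⟨i', _, rfl⟩ := List.mem_map.1 hi
        obtain ⟨j', _, rfl⟩ := List.mem_map.1 hj
        have := i'.2
        simp only [idxShift]
        omega
    | zero => simp
    | add x y _ _ hx hy => rw [map_add, mul_add, add_mul, hx, hy, smul_add]
    | smul r x _ hx => rw [map_smul, mul_smul_comm, smul_mul_assoc, hx, smul_comm]
  | zero => simp
  | add x y _ _ hx hy => rw [map_add, mul_add, add_mul, hx, hy, smul_add]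
  | smul r x _ hx => rw [map_smul, mul_smul_comm, smul_mul_assoc, hx, smul_comm]

/-- `LOTshift` as a homomorphism of dg algebras. -/
def LOTshiftHom {n N : ℕ} (c : ℕ) (h : n + c ≤ N) : DGHom (LOT k n) (LOT k N) where
  toAlgHom := LOTshift k c h
  map_mem := fun ha => LOTshift_mem k c h ha
  map_d := LOTshift_d k c h

/-- The homomorphism `H⁻ₙ ⊗ H⁻ₘ → H⁻_N`, `N = n + m`, of dg algebras given by placing a diagram
from `H⁻ₙ` above and to the left of a diagram from `H⁻ₘ`: `σ_i ⊗ 1 ↦ σ_i`, `1 ⊗ σ_j ↦ σ_{n+j}`. -/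
def LOTincl {n m N : ℕ} (h : n + m = N) : DGHom ((LOT k n).tensor (LOT k m)) (LOT k N) :=
  DGHom.ofTensor (LOTshiftHom k (N := N) 0 (by omega)) (LOTshiftHom k (N := N) n (by omega))
    fun ha hb => LOTshift_anti k h ha hb

variable {k}

/-- The induction functor on objects: `Ind(P, Q) = H⁻_N ⊗_{H⁻ₙ ⊗ H⁻ₘ} (P ⊠ Q)`, `N = n + m`. -/
def Ind {n m N : ℕ} (h : n + m = N) (P : DGMod (LOT k n)) (Q : DGMod (LOT k m)) :
    DGMod (LOT k N) :=
  DGMod.extend (LOTincl k h) (P.outer Q)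

/-- The restriction functor on objects, from `H⁻_N`-modules to `H⁻ₙ ⊗ H⁻ₘ`-modules,
`N = n + m`. -/
def Res {n m N : ℕ} (h : n + m = N) (P : DGMod (LOT k N)) :
    DGMod ((LOT k n).tensor (LOT k m)) :=
  DGMod.restrict (LOTincl k h) P

end Inclusion

end DG

/-! ### The integral form of the positive half of quantum `gl(1|1)` -/

section Target

open Polynomial

/-- The algebra `ℤ[q, q⁻¹, E₁] / (E₁²)`. -/
abbrev UZ : Type := AdjoinRoot ((X : Zq[X]) ^ 2)

/-- The generator `E₁`. -/
def E₁ : UZ := AdjoinRoot.root _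

theorem E₁_sq : E₁ * E₁ = 0 := by
  have h := AdjoinRoot.eval₂_root ((X : Zq[X]) ^ 2)
  rw [eval₂_pow, eval₂_X] at h
  exact (pow_two E₁).symm.trans h

/-- The universal property of `ℤ[q, q⁻¹, E₁] / (E₁²)`. -/
def UZlift {B : Type*} [Ring B] [Algebra Zq B] (x : B) (hx : x * x = 0) : UZ →ₐ[Zq] B :=
  show (Zq[X] ⧸ Ideal.span {(X : Zq[X]) ^ 2}) →ₐ[Zq] B from
  Ideal.Quotient.liftₐ _ (aeval x) (by
    intro p hp
    obtain ⟨r, rfl⟩ := Ideal.mem_span_singleton'.1 hp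
    rw [map_mul, map_pow, aeval_X, pow_two, hx, mul_zero])

theorem UZlift_E₁ {B : Type*} [Ring B] [Algebra Zq B] (x : B) (hx : x * x = 0) :
    UZlift x hx E₁ = x :=
  aeval_X x

/-- The super grading: `1` is even and `E₁` is odd. -/
def UZgr (i : ZMod 2) : Submodule Zq UZ :=
  if i = 0 then Submodule.span Zq {1} else Submodule.span Zq {E₁}

theorem one_mem_UZgr : (1 : UZ) ∈ UZgr 0 := by
  rw [UZgr, if_pos rfl]; exact Submodule.mem_span_singleton_self _

theorem E₁_mem : E₁ ∈ UZgr 1 := by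
  rw [UZgr, if_neg (by decide)]; exact Submodule.mem_span_singleton_self _

theorem UZgr_cases {i : ZMod 2} {x : UZ} (hx : x ∈ UZgr i) :
    (i = 0 ∧ ∃ a : Zq, a • (1 : UZ) = x) ∨ (i = 1 ∧ ∃ a : Zq, a • E₁ = x) := by
  rw [UZgr] at hx
  split_ifs at hx with h
  · exact Or.inl ⟨h, Submodule.mem_span_singleton.1 hx⟩
  · have h01 : ∀ i : ZMod 2, i ≠ 0 → i = 1 := by decide
    exact Or.inr ⟨h01 i h, Submodule.mem_span_singleton.1 hx⟩

theorem UZ_span (x : UZ) : ∃ a b : Zq, x = a • (1 : UZ) + b • E₁ := by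
  obtain ⟨p, rfl⟩ := AdjoinRoot.mk_surjective x
  induction p using Polynomial.induction_on' with
  | add p r hp hr =>
    obtain ⟨a, b, h⟩ := hp
    obtain ⟨a', b', h'⟩ := hr
    exact ⟨a + a', b + b', by rw [map_add, h, h']; module⟩
  | monomial n a =>
    have e : AdjoinRoot.mk ((X : Zq[X]) ^ 2) (monomial n a) = a • E₁ ^ n := by
      rw [← C_mul_X_pow_eq_monomial, map_mul, map_pow, AdjoinRoot.mk_C, AdjoinRoot.mk_X,
        Algebra.smul_def, AdjoinRoot.algebraMap_eq]
      rfl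
    rw [e]
    match n with
    | 0 => exact ⟨a, 0, by rw [pow_zero, zero_smul, add_zero]⟩
    | 1 => exact ⟨0, a, by rw [pow_one, zero_smul, zero_add]⟩
    | n + 2 =>
      exact ⟨0, 0, by
        rw [pow_add, pow_two E₁, E₁_sq, mul_zero, smul_zero, zero_smul, zero_smul, add_zero]⟩

theorem UZgr_internal : DirectSum.IsInternal UZgr := by
  refine isInternal_of_coaction _ (fun x => ?_)
    { toFun := fun x => (UZlift (B := AddMonoidAlgebra UZ (ZMod 2)) (AddMonoidAlgebra.single 1 E₁)
        (by rw [AddMonoidAlgebra.single_mul_single, E₁_sq, AddMonoidAlgebra.single_zero]) x).coeff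
      map_add' := fun x y => by simp
      map_smul' := fun c x => by simp } (fun i x hx => ?_)
  · obtain ⟨a, b, rfl⟩ := UZ_span x
    exact Submodule.add_mem _ (Submodule.smul_mem _ _ ((le_iSup UZgr 0) one_mem_UZgr))
      (Submodule.smul_mem _ _ ((le_iSup UZgr 1) E₁_mem))
  · rcases UZgr_cases hx with ⟨rfl, a, rfl⟩ | ⟨rfl, a, rfl⟩ <;>
      rw [map_smul, ← Finsupp.smul_single] <;> congr 1
    · simp [AddMonoidAlgebra.one_def]
    · simp [UZlift_E₁]

instance : SetLike.GradedMonoid UZgr where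
  one_mem := one_mem_UZgr
  mul_mem := by
    intro i j x y hx hy
    rcases UZgr_cases hx with ⟨rfl, a, rfl⟩ | ⟨rfl, a, rfl⟩ <;>
    rcases UZgr_cases hy with ⟨rfl, b, rfl⟩ | ⟨rfl, b, rfl⟩ <;>
    rw [smul_mul_smul_comm] <;> refine Submodule.smul_mem _ _ ?_
    · rw [one_mul, add_zero]; exact one_mem_UZgr
    · rw [one_mul, zero_add]; exact E₁_mem
    · rw [mul_one, add_zero]; exact E₁_mem
    · rw [E₁_sq]; exact Submodule.zero_mem _

instance : GradedAlgebra UZgr where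
  toGradedMonoid := inferInstance
  toDecomposition := UZgr_internal.chooseDecomposition

/-- The comultiplication `E₁ ↦ E₁ ⊗ 1 + 1 ⊗ E₁`, an algebra homomorphism into the super tensor
square. -/
def UZcomul : UZ →ₐ[Zq] GradedTensorProduct Zq UZgr UZgr :=
  UZlift (GradedTensorProduct.tmul Zq E₁ 1 + GradedTensorProduct.tmul Zq 1 E₁) (by
    have h1 := GradedTensorProduct.tmul_coe_mul_coe_tmul (R := Zq) UZgr UZgr (1 : UZ)
      ⟨E₁, E₁_mem⟩ ⟨E₁, E₁_mem⟩ (1 : UZ)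
    have h2 := GradedTensorProduct.tmul_one_mul_one_tmul (R := Zq) UZgr UZgr E₁ E₁
    have h3 := GradedTensorProduct.tmul_one_mul_coe_tmul (R := Zq) UZgr UZgr E₁ ⟨E₁, E₁_mem⟩ 1
    have h4 := GradedTensorProduct.tmul_coe_mul_one_tmul (R := Zq) UZgr UZgr 1 ⟨E₁, E₁_mem⟩ E₁
    simp only [one_mul, mul_one, E₁_sq] at h1 h2 h3 h4
    have h5 : GradedTensorProduct.tmul (𝒜 := UZgr) (ℬ := UZgr) Zq (0 : UZ) (1 : UZ) = 0 :=
      TensorProduct.zero_tmul UZ (1 : UZ)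
    have h6 : GradedTensorProduct.tmul (𝒜 := UZgr) (ℬ := UZgr) Zq (1 : UZ) (0 : UZ) = 0 :=
      TensorProduct.tmul_zero UZ (1 : UZ)
    rw [add_mul, mul_add, mul_add, h1, h2, h3, h4, h5, h6]
    simp)

/-- The comultiplication of `ℤ[q, q⁻¹, E₁] / (E₁²)` as a map to the tensor square. -/
def UZΔ : UZ →ₗ[Zq] UZ ⊗[Zq] UZ :=
  (GradedTensorProduct.of Zq UZgr UZgr).symm.toLinearMap.comp UZcomul.toLinearMap

/-- The field `ℚ(q)`, as the fraction field of `ℤ[q, q⁻¹]`. -/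
abbrev Qq : Type := FractionRing Zq

/-- The positive half of quantum `gl(1|1)`: the `ℚ(q)`-algebra with one generator `E₁` and the
relation `E₁² = 0`. -/
abbrev UQ : Type := AdjoinRoot ((X : Qq[X]) ^ 2)

/-- Its integral form: the `ℤ[q, q⁻¹]`-subalgebra generated by `E₁`. -/
def UQint : Subalgebra Zq UQ := Algebra.adjoin Zq {AdjoinRoot.root ((X : Qq[X]) ^ 2)}

end Target

end LOTCat

end

open LOTCat

noncomputable section

namespace LOTCat

variable {k : Type u} [Field k]

/-! The proof rests on a dichotomy. For n ≥ 2 the relation d(σ₁) = 1 makes the unit of H⁻ₙ a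
boundary, so a cycle m of any dg module equals d(σ₁ m) and every module is acyclic. Testing a
projective module against itself shows that its identity is null-homotopic
(`DGAlg.IsAcyc.isContractible`). Contractible modules P fit in a triangle P → P → P, hence [P] = [P]
+ [P], and the Grothendieck group vanishes. For n ≤ 1 there are no generators and the algebra is the
base field 𝕜.

Over 𝕜 a graded complex splits, up to homotopy, into a complex with zero differential and a
homogeneous basis (`exists_htpyEquiv_freeMod`), and compactness forces that basis to be finite
(`finite_of_isCompact`). The long exact sequence of a cone (`hdim_cone`) makes the graded Euler
characteristic of homology additive on triangles. Splitting off one basis vector at a time gives [P]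
= χ(P)[𝕜] (`cls_freeMod`). Together these identify the Grothendieck group with ℤ[q, q⁻¹] through χ
(`exists_K0_equiv`).

No general descent argument is then needed for induction, restriction and the outer tensor product.
Either the relevant group or class is zero, or all algebras involved are 𝕜; in the latter case χ is
multiplicative on outer tensor products and unchanged by induction and restriction along 𝕜 = 𝕜. The
mixed case is n = m = 1, where H⁻₁ ⊗ H⁻₁ is 𝕜 but H⁻₂ has a null-homologous unit. Induced modules
are still projective (`IsProjective.extend`), hence contractible; this is what E₁² = 0 expresses. In
the other direction, restrictions of contractible modules are contractible.

Finally ℤ[q, q⁻¹, E₁]/(E₁²) has basis 1, E₁, as mapping to dual numbers shows, and a class x in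
degree n is sent to χ(x) E₁ⁿ (`exists_K0_equiv_UZ`). Compatibility with the product and the
coproduct is checked in degrees 0 and 1 through χ, and is trivial above. -/

theorem sg_neg_one_mul (i : ℤ) : sg k (-1 * i) = sg k i := by
  simp [sg]

theorem sg_pred (n : ℤ) : sg k (n - 1) = -sg k n := by
  have h := sg_succ k (n - 1)
  rw [sub_add_cancel] at h
  rw [h, neg_neg]

theorem DGAlg.d_one (A : DGAlg k) : A.d 1 = 0 := by
  have h := A.leibniz A.one_mem 1
  rw [sg_zero, one_smul, mul_one, one_mul, mul_one] at h
  exact left_eq_add.1 h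

theorem eq_zero_of_mem_of_mem {ι M : Type*} [DecidableEq ι] [AddCommGroup M] [Module k M]
    {gr : ι → Submodule k M} (h : DirectSum.IsInternal gr) {i j : ι} (hij : i ≠ j) {x : M}
    (hi : x ∈ gr i) (hj : x ∈ gr j) : x = 0 := by
  have h1 := coact_of_mem h hi
  rw [coact_of_mem h hj] at h1
  have h2 := DFunLike.congr_fun h1 j
  rwa [Finsupp.single_eq_same, Finsupp.single_eq_of_ne hij.symm] at h2

/-! ### Homomorphisms, homotopies and contractible modules. -/

namespace DGMod

variable {A : DGAlg k} {L M N N' : DGMod A}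

theorem mem_homZ_zero {f : M.carrier →ₗ[k] N.carrier} (hgr : ∀ x, ∀ m ∈ M.gr x, f m ∈ N.gr x)
    (hact : ∀ a m, f (M.act a m) = N.act a (f m)) (hd : ∀ m, N.d (f m) = f (M.d m)) :
    f ∈ homZ 0 M N := by
  refine ⟨⟨fun p q m hm => ?_, fun i a _ m => ?_⟩, ?_⟩
  · rw [add_zero]; exact hgr _ m hm
  · rw [zero_mul, sg_zero, one_smul, hact]
  · refine LinearMap.mem_ker.2 (LinearMap.ext fun m => ?_)
    rw [homD_apply, sg_zero, one_smul, hd, sub_self, LinearMap.zero_apply]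

theorem homZ_gr {f : M.carrier →ₗ[k] N.carrier} (hf : f ∈ homZ 0 M N) {x : ℤ × ℤ}
    {m : M.carrier} (hm : m ∈ M.gr x) : f m ∈ N.gr x := by
  have := hf.1.1 x.1 x.2 m hm
  rwa [add_zero] at this

theorem mem_homDeg_neg_one {s : M.carrier →ₗ[k] N.carrier}
    (hgr : ∀ p q, ∀ m ∈ M.gr (p, q), s m ∈ N.gr (p - 1, q))
    (hact : ∀ i, ∀ a ∈ A.gr i, ∀ m, s (M.act a m) = sg k i • N.act a (s m)) :
    s ∈ homDeg (-1) M N :=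
  ⟨hgr, fun i a ha m => by rw [sg_neg_one_mul, hact i a ha m]⟩

theorem mem_homB_zero {f : M.carrier →ₗ[k] N.carrier} :
    f ∈ homB 0 M N ↔ ∃ s ∈ homDeg (-1) M N, ∀ m, f m = N.d (s m) + s (M.d m) := by
  constructor
  · rintro ⟨s, hs, rfl⟩
    refine ⟨s, hs, fun m => ?_⟩
    rw [homD_apply, sg_pred, sg_zero, neg_one_smul, sub_neg_eq_add]
  · rintro ⟨s, hs, h⟩
    refine ⟨s, hs, LinearMap.ext fun m => ?_⟩
    rw [homD_apply, sg_pred, sg_zero, neg_one_smul, sub_neg_eq_add, h]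

theorem id_mem_homZ (M : DGMod A) : LinearMap.id ∈ homZ 0 M M :=
  mem_homZ_zero (fun _ _ h => h) (fun _ _ => rfl) fun _ => rfl

theorem comp_mem_homZ {f : M.carrier →ₗ[k] N.carrier} {g : N.carrier →ₗ[k] N'.carrier}
    (hg : g ∈ homZ 0 N N') (hf : f ∈ homZ 0 M N) : g.comp f ∈ homZ 0 M N' :=
  mem_homZ_zero (fun _ _ h => homZ_gr hg (homZ_gr hf h))
    (fun a m => by simp only [LinearMap.comp_apply, homZ_act hf, homZ_act hg])
    (fun m => by simp only [LinearMap.comp_apply, homZ_comm hf, homZ_comm hg])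

theorem comp_mem_homB {n : ℤ} {f : M.carrier →ₗ[k] N.carrier} {g : N.carrier →ₗ[k] N'.carrier}
    (hg : g ∈ homZ 0 N N') (hf : f ∈ homB n M N) : g.comp f ∈ homB n M N' := by
  obtain ⟨s, hs, rfl⟩ := hf
  exact ⟨g.comp s, comp_mem_homDeg hs hg, homD_comp s hg⟩

theorem precomp_mem_homB {n : ℤ} {f : M.carrier →ₗ[k] N.carrier} {g : L.carrier →ₗ[k] M.carrier}
    (hg : g ∈ homZ 0 L M) (hf : f ∈ homB n M N) : f.comp g ∈ homB n L N := by
  obtain ⟨s, hs, rfl⟩ := hf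
  refine ⟨s.comp g, ⟨fun p q m hm => hs.1 p q _ (homZ_gr hg hm), fun i a ha m => ?_⟩, ?_⟩
  · rw [LinearMap.comp_apply, homZ_act hg, hs.2 i a ha, LinearMap.comp_apply]
  · ext m
    simp [homD_apply, homZ_comm hg]

/-- A dg module whose identity is homotopic to zero. -/
def IsContractible (M : DGMod A) : Prop := LinearMap.id ∈ homB 0 M M

/-- If id = d s + s d and f is a cocycle of degree n, then f is the coboundary of (-1)ⁿ f ∘ s. The
target need not be acyclic, so this yields projectivity and compactness at once. -/
theorem IsContractible.homZ_le (h : M.IsContractible) (N : DGMod A) (n : ℤ) :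
    homZ n M N ≤ homB n M N := by
  obtain ⟨s, hs, hsd⟩ := mem_homB_zero.1 h
  intro f hf
  have hfd : ∀ m, N.d (f m) = sg k n • f (M.d m) := fun m => by
    have := LinearMap.congr_fun (LinearMap.mem_ker.1 hf.2) m
    rwa [homD_apply, LinearMap.zero_apply, sub_eq_zero] at this
  refine ⟨sg k n • f.comp s, Submodule.smul_mem _ _ ⟨fun p q m hm => ?_, fun i a ha m => ?_⟩, ?_⟩
  · have := hf.1.1 _ _ _ (hs.1 p q m hm)
    rwa [add_assoc, neg_add_eq_sub] at this
  · rw [LinearMap.comp_apply, hs.2 i a ha, map_smul, hf.1.2 i a ha, smul_smul, LinearMap.comp_apply,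
      ← sg_add, ← add_mul, neg_add_eq_sub]
  · ext m
    have e : f m = f (M.d (s m)) + f (s (M.d m)) := by rw [← map_add, ← hsd]; rfl
    rw [homD_apply, LinearMap.smul_apply, LinearMap.smul_apply, LinearMap.comp_apply,
      LinearMap.comp_apply, map_smul, hfd, smul_smul, sg_mul_self, one_smul, smul_smul, sg_pred,
      neg_mul, sg_mul_self, neg_one_smul, sub_neg_eq_add, e]

theorem IsContractible.isProjective (h : M.IsContractible) : M.IsProjective :=
  fun N _ n => h.homZ_le N n

theorem HtpyEquiv.refl (M : DGMod A) : HtpyEquiv M M :=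
  ⟨_, id_mem_homZ M, _, id_mem_homZ M, by simp, by simp⟩

theorem HtpyEquiv.symm (h : HtpyEquiv M N) : HtpyEquiv N M := by
  obtain ⟨f, hf, g, hg, h1, h2⟩ := h
  exact ⟨g, hg, f, hf, h2, h1⟩

theorem HtpyEquiv.trans (h : HtpyEquiv L M) (h' : HtpyEquiv M N) : HtpyEquiv L N := by
  obtain ⟨f, hf, g, hg, h1, h2⟩ := h
  obtain ⟨f', hf', g', hg', h1', h2'⟩ := h'
  refine ⟨f'.comp f, comp_mem_homZ hf' hf, g.comp g', comp_mem_homZ hg hg', ?_, ?_⟩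
  · have := Submodule.add_mem _ (comp_mem_homB hg (precomp_mem_homB hf h1')) h1
    convert this using 1
    ext m; simp
  · have := Submodule.add_mem _ (comp_mem_homB hf' (precomp_mem_homB hg' h2)) h2'
    convert this using 1
    ext m; simp

theorem HtpyEquiv.of_linearEquiv (e : M.carrier ≃ₗ[k] N.carrier)
    (h : e.toLinearMap ∈ homZ 0 M N) (h' : e.symm.toLinearMap ∈ homZ 0 N M) : HtpyEquiv M N :=
  ⟨_, h, _, h', by simp, by simp⟩

theorem HtpyEquiv.of_isContractible (hM : M.IsContractible) (hN : N.IsContractible) :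
    HtpyEquiv M N :=
  ⟨0, Submodule.zero_mem _, 0, Submodule.zero_mem _,
    by simpa using Submodule.neg_mem _ hM, by simpa using Submodule.neg_mem _ hN⟩

theorem isContractible_of_subsingleton (M : DGMod A) [Subsingleton M.carrier] :
    M.IsContractible := by
  have : (LinearMap.id : M.carrier →ₗ[k] M.carrier) = 0 :=
    LinearMap.ext fun _ => Subsingleton.elim _ _
  rw [IsContractible, this]
  exact Submodule.zero_mem _

/-! ### Compactness -/

section Compact

variable {I : Type u} (F : I → DGMod A)

/-- The projection of a direct sum of dg modules onto a summand. -/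
theorem component_mem_homZ (i : I) :
    DirectSum.component k I (fun a => (F a).carrier) i ∈ homZ 0 (sum F) (F i) :=
  mem_homZ_zero (fun _ _ hm => (Submodule.mem_iInf _).1 hm i) (fun _ _ => rfl) fun _ => rfl

/-- The projections to the summands recover the coordinates. Hence the canonical map is injective
for every module, and compactness is only a matter of surjectivity; the formula also detects which
coordinates of a preimage vanish. -/
theorem component_sumHomK (M : DGMod A) (i : I) :
    (postcomp M ⟨_, component_mem_homZ F i⟩) ∘ₗ sumHomK M F =
      DirectSum.component k I (fun i => HomK M (F i)) i := by
  classical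
  refine DirectSum.linearMap_ext _ fun j => LinearMap.ext fun g => ?_
  obtain ⟨g, rfl⟩ := Submodule.Quotient.mk_surjective _ g
  rw [LinearMap.comp_apply, LinearMap.comp_apply, LinearMap.comp_apply, sumHomK,
    DirectSum.toModule_lof]
  change (Submodule.Quotient.mk (⟨(DirectSum.component k I (fun a => (F a).carrier) i).comp
    ((DirectSum.lof k I (fun a => (F a).carrier) j).comp g.1), _⟩ : homZ 0 M (F i)) :
    HomK M (F i)) = _
  by_cases hij : j = i
  · subst hij
    rw [DirectSum.component.lof_self]
    congr 1
    ext m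
    simp [DirectSum.component.lof_self]
  · rw [DirectSum.component.of, dif_neg hij, Submodule.Quotient.mk_eq_zero]
    convert Submodule.zero_mem _
    ext m
    simp [DirectSum.component.of, dif_neg hij]

theorem sumHomK_injective (M : DGMod A) : Function.Injective (sumHomK M F) := by
  intro x y hxy
  refine DFinsupp.ext fun i => ?_
  have h1 := LinearMap.congr_fun (component_sumHomK F M i) x
  have h2 := LinearMap.congr_fun (component_sumHomK F M i) y
  rw [LinearMap.comp_apply, hxy, ← LinearMap.comp_apply, h2] at h1
  exact h1.symm

/-- A map that lands in finitely many summands is the finite sum of its components, so its class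
lies in the image of the canonical map. -/
theorem isCompact_of_finite_range (M : DGMod A)
    (h : ∀ (I : Type u) (F : I → DGMod A), ∀ f ∈ homZ 0 M (sum F), ∃ f' ∈ homZ 0 M (sum F),
      f - f' ∈ homB 0 M (sum F) ∧ ∃ S : Finset I, ∀ m, ∀ i ∉ S, f' m i = 0) : M.IsCompact := by
  -- The preimage is the sum over `S` of the classes of the components of `f'`.
  classical
  refine fun I F _ => ⟨sumHomK_injective F M, fun y => ?_⟩
  obtain ⟨⟨f, hf⟩, rfl⟩ := Submodule.Quotient.mk_surjective _ y
  obtain ⟨f', hf', hff, S, hS⟩ := h I F f hf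
  refine ⟨∑ i ∈ S, DirectSum.lof k I (fun i => HomK M (F i)) i
    (postcomp M ⟨_, component_mem_homZ F i⟩ (Submodule.Quotient.mk ⟨f', hf'⟩)), ?_⟩
  have h1 : (Submodule.Quotient.mk ⟨f, hf⟩ : HomK M (sum F)) =
      Submodule.Quotient.mk ⟨f', hf'⟩ := (Submodule.Quotient.eq _).2 hff
  rw [h1, map_sum]
  have h2 : ∀ i ∈ S, sumHomK M F (DirectSum.lof k I (fun i => HomK M (F i)) i
      (postcomp M ⟨_, component_mem_homZ F i⟩ (Submodule.Quotient.mk ⟨f', hf'⟩))) =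
      (Submodule.Quotient.mk ⟨(sumIncl F i).1.comp
        ((DirectSum.component k I (fun a => (F a).carrier) i).comp f'),
        comp_mem_homZ (sumIncl F i).2 (comp_mem_homZ (component_mem_homZ F i) hf')⟩ :
          HomK M (sum F)) := by
    intro i _
    rw [sumHomK, DirectSum.toModule_lof]
    rfl
  rw [Finset.sum_congr rfl h2, ← Submodule.mkQ_apply]
  simp only [← Submodule.mkQ_apply]
  rw [← map_sum]
  congr 1
  ext m : 2
  rw [AddSubmonoidClass.coe_finsetSum, LinearMap.sum_apply]
  refine DFinsupp.ext fun j => ?_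
  change (∑ i ∈ S, (DirectSum.lof k I (fun a => (F a).carrier) i (f' m i))) j = f' m j
  rw [DFinsupp.finsetSum_apply]
  by_cases hj : j ∈ S
  · rw [Finset.sum_eq_single j]
    · exact DFinsupp.single_eq_same
    · intro b _ hb
      exact DFinsupp.single_eq_of_ne hb.symm
    · exact fun h => absurd hj h
  · rw [hS m j hj]
    refine Finset.sum_eq_zero fun b hb => ?_
    exact DFinsupp.single_eq_of_ne fun h => hj (h ▸ hb)

theorem IsContractible.isPerf (h : M.IsContractible) : M.IsPerf := by
  refine ⟨h.isProjective, isCompact_of_finite_range M fun I F f hf => ⟨0, Submodule.zero_mem _, ?_,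
    ∅, fun _ _ _ => rfl⟩⟩
  rw [sub_zero]
  exact h.homZ_le _ 0 hf

/-- Up to homotopy a map out of `M` factors through the finite-dimensional `N`. A finite spanning
set meets finitely many summands, and so does the whole image. -/
theorem isCompact_of_htpyEquiv (h : HtpyEquiv M N) [Module.Finite k N.carrier] : M.IsCompact := by
  classical
  obtain ⟨f, hf, g, hg, h1, h2⟩ := h
  refine isCompact_of_finite_range M fun I F t ht =>
    -- The map t is homotopic to t g f because g f is homotopic to the identity.
    ⟨(t.comp g).comp f, comp_mem_homZ (comp_mem_homZ ht hg) hf, ?_, ?_⟩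
  · have := Submodule.neg_mem _ (comp_mem_homB ht h1)
    convert this using 1
    ext1 m; simp
  · obtain ⟨T, hT⟩ := Module.Finite.fg_top (R := k) (M := N.carrier)
    refine ⟨T.biUnion fun v => DFinsupp.support (t (g v)), fun m i hi => ?_⟩
    have hle : (⊤ : Submodule k N.carrier) ≤ LinearMap.ker
        ((DirectSum.component k I (fun a => (F a).carrier) i).comp (t.comp g)) := by
      rw [← hT, Submodule.span_le]
      intro v hv
      by_contra hne
      exact hi (Finset.mem_biUnion.2 ⟨v, hv, DFinsupp.mem_support_iff.2 hne⟩)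
    exact hle (Submodule.mem_top (x := f m))

end Compact

/-! ### Classes of contractible modules -/

theorem cone_isContractible_of_subsingleton [Subsingleton M.carrier] [Subsingleton N.carrier]
    (f : homZ 0 M N) : (cone f).IsContractible :=
  isContractible_of_subsingleton _

/-- All three modules are isomorphic, in the homotopy category, to the terms of the triangle of the
zero map 0 → 0. -/
theorem IsContractible.isTriangle {P₁ P₂ P₃ : DGMod A} (h₁ : P₁.IsContractible)
    (h₂ : P₂.IsContractible) (h₃ : P₃.IsContractible) : IsTriangle P₁ P₂ P₃ := by
  -- The zero module, obtained as an empty direct sum.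
  let Z : DGMod A := sum (fun i : PEmpty.{u + 1} => i.elim)
  have : Subsingleton Z.carrier := ⟨fun x y => DFinsupp.ext fun i => i.elim⟩
  have hZ := isContractible_of_subsingleton Z
  exact ⟨Z, Z, 0, .of_isContractible h₁ hZ, .of_isContractible h₂ hZ,
    .of_isContractible h₃ (cone_isContractible_of_subsingleton _)⟩

theorem qshift_zero (M : DGMod A) : M.qshift 0 = M := by
  cases M
  simp [qshift]

end DGMod

/-! ### Calculus of classes in the Grothendieck group. -/

namespace K0

variable {A : DGAlg k} {P P₁ P₂ P₃ : DGMod A}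

theorem smul_cls (c : Zq) (hP : P.IsPerf) :
    c • cls P hP = Submodule.Quotient.mk (Finsupp.single (⟨P, hP⟩ : Perf A) c) :=
  congrArg (Submodule.Quotient.mk (p := Submodule.span Zq {x | K0Rel A x}))
    (Finsupp.smul_single_one (⟨P, hP⟩ : Perf A) c)

theorem cls_triangle (h₁ : P₁.IsPerf) (h₂ : P₂.IsPerf) (h₃ : P₃.IsPerf)
    (h : DGMod.IsTriangle P₁ P₂ P₃) : cls P₂ h₂ = cls P₁ h₁ + cls P₃ h₃ := by
  rw [← sub_eq_zero]
  exact (Submodule.Quotient.mk_eq_zero _).2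
    (Submodule.subset_span (K0Rel.triangle ⟨P₁, h₁⟩ ⟨P₂, h₂⟩ ⟨P₃, h₃⟩ h))

theorem cls_shift (h₁ : P₁.IsPerf) (h₂ : P₂.IsPerf) (h : P₂.HtpyEquiv P₁.shift) :
    cls P₂ h₂ = -cls P₁ h₁ := by
  rw [eq_neg_iff_add_eq_zero]
  exact (Submodule.Quotient.mk_eq_zero _).2
    (Submodule.subset_span (K0Rel.shift ⟨P₁, h₁⟩ ⟨P₂, h₂⟩ h))

theorem cls_qshift (n : ℤ) (h₁ : P₁.IsPerf) (h₂ : P₂.IsPerf) (h : P₂.HtpyEquiv (P₁.qshift n)) :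
    cls P₂ h₂ = (LaurentPolynomial.T n : Zq) • cls P₁ h₁ := by
  rw [← sub_eq_zero, smul_cls]
  exact (Submodule.Quotient.mk_eq_zero _).2
    (Submodule.subset_span (K0Rel.qshift n ⟨P₁, h₁⟩ ⟨P₂, h₂⟩ h))

/-- Homotopy invariance is not a separate relation: it is the q-shift relation for the shift by
zero. -/
theorem cls_congr (h₁ : P₁.IsPerf) (h₂ : P₂.IsPerf) (h : P₁.HtpyEquiv P₂) :
    cls P₁ h₁ = cls P₂ h₂ := by
  rw [cls_qshift 0 h₂ h₁ (by rwa [DGMod.qshift_zero]), LaurentPolynomial.T_zero, one_smul]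

/-- The triangle P → P → P of contractible modules gives [P] = [P] + [P]. -/
theorem cls_eq_zero (h : P.IsContractible) (hP : P.IsPerf) : cls P hP = 0 :=
  left_eq_add.1 (cls_triangle hP hP hP (h.isTriangle h h))

theorem induction {p : K0 A → Prop} (h0 : p 0) (hadd : ∀ x y, p x → p y → p (x + y))
    (hsmul : ∀ (c : Zq) x, p x → p (c • x)) (hcls : ∀ P hP, p (cls P hP)) (x : K0 A) : p x := by
  obtain ⟨x, rfl⟩ := Submodule.Quotient.mk_surjective _ x
  induction x using Finsupp.induction_linear with
  | zero => exact h0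
  | add x y hx hy => exact hadd _ _ hx hy
  | single P c =>
    have := hsmul c _ (hcls P.1 P.2)
    rwa [smul_cls] at this

end K0

/-! ### Acyclic dg algebras -/

/-- A dg algebra whose unit is a boundary. -/
def DGAlg.IsAcyc (A : DGAlg k) : Prop := ∃ s ∈ A.gr (-1), A.d s = 1

namespace DGAlg.IsAcyc

variable {A : DGAlg k}

/-- With d s = 1, the Leibniz rule gives d(s m) = m for every cycle m. -/
theorem isAcyclic (hA : A.IsAcyc) (M : DGMod A) : M.IsAcyclic := by
  obtain ⟨s, hs, hd⟩ := hA
  intro m hm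
  refine ⟨M.act s m, ?_⟩
  rw [M.leibniz hs, hd, hm, map_zero, smul_zero, add_zero, map_one, Module.End.one_apply]

/-- The module is itself acyclic, so projectivity applies to it as a target and the identity cocycle
bounds. -/
theorem isContractible (hA : A.IsAcyc) {P : DGMod A} (hP : P.IsProjective) : P.IsContractible :=
  hP P (hA.isAcyclic P) 0 (DGMod.id_mem_homZ P)

theorem isPerf (hA : A.IsAcyc) {P : DGMod A} (hP : P.IsProjective) : P.IsPerf :=
  (hA.isContractible hP).isPerf

theorem subsingleton_K0 (hA : A.IsAcyc) : Subsingleton (K0 A) := by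
  refine subsingleton_of_forall_eq 0 fun x => ?_
  refine K0.induction (p := fun x => x = 0) rfl (fun x y hx hy => by rw [hx, hy, add_zero])
    (fun c x hx => by rw [hx, smul_zero])
    (fun P hP => K0.cls_eq_zero (hA.isContractible hP.1) hP) x

/-- Left multiplication by s is not linear for the left action, so the homotopy multiplies on the
right: a ↦ (-1)^(deg a) a s. The sign makes it linear in the graded sense of degree -1. -/
theorem regular_isContractible (hA : A.IsAcyc) : (DGMod.regular A).IsContractible := by
  obtain ⟨s, hs, hd⟩ := hA
  refine DGMod.mem_homB_zero.2 ⟨(LinearMap.mulRight k s).comp A.eps.toLinearMap,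
    DGMod.mem_homDeg_neg_one (fun p q m hm => ?_) (fun i a ha m => ?_), fun m => ?_⟩
  · by_cases hq : q = 0
    · simp only [hq, if_true] at hm ⊢
      rw [LinearMap.comp_apply, AlgHom.toLinearMap_apply, A.eps_of_mem hm, map_smul]
      exact Submodule.smul_mem _ _ (A.mul_mem hm hs)
    · simp only [hq, if_false, Submodule.mem_bot] at hm ⊢
      simp [hm]
  · change A.eps (a * m) * s = sg k i • (a * (A.eps m * s))
    rw [map_mul, A.eps_of_mem ha, smul_mul_assoc, smul_mul_assoc, mul_assoc]
  · change m = A.d (A.eps m * s) + A.eps (A.d m) * s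
    refine hom_induction A.internal (p := fun m => m = A.d (A.eps m * s) + A.eps (A.d m) * s)
      (by simp) (fun x y hx hy => ?_) (fun i a ha => ?_) m
    · simp only [map_add, add_mul]
      conv_lhs => rw [hx, hy]
      abel
    · rw [A.eps_of_mem ha, A.eps_of_mem (A.d_mem ha), smul_mul_assoc, map_smul, A.leibniz ha, hd,
        smul_add, smul_smul, sg_mul_self, one_smul, mul_one, sg_succ, neg_smul, neg_mul,
        smul_mul_assoc]
      abel

end DGAlg.IsAcyc

namespace DGMod

variable {A B : DGAlg k}

/-! ### Homogeneous components -/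

/-- The projection of a dg module onto its part of bidegree `x`. -/
def proj (M : DGMod A) (x : ℤ × ℤ) : M.carrier →ₗ[k] M.carrier :=
  (Finsupp.lapply x).comp (coact M.internal)

theorem proj_of_mem (M : DGMod A) {x : ℤ × ℤ} {m : M.carrier} (hm : m ∈ M.gr x) :
    M.proj x m = m := by
  simp [proj, coact_of_mem M.internal hm]

theorem proj_of_mem_ne (M : DGMod A) {x y : ℤ × ℤ} (hxy : x ≠ y) {m : M.carrier}
    (hm : m ∈ M.gr x) : M.proj y m = 0 := by
  simp [proj, coact_of_mem M.internal hm, hxy]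

theorem proj_mem (M : DGMod A) (x : ℤ × ℤ) (m : M.carrier) : M.proj x m ∈ M.gr x := by
  refine hom_induction M.internal (p := fun m => M.proj x m ∈ M.gr x) (by simp)
    (fun a b ha hb => by rw [map_add]; exact Submodule.add_mem _ ha hb) (fun y m hm => ?_) m
  by_cases h : y = x
  · subst h; rwa [M.proj_of_mem hm]
  · rw [M.proj_of_mem_ne h hm]; exact Submodule.zero_mem _

theorem d_proj (M : DGMod A) (p q : ℤ) (m : M.carrier) :
    M.d (M.proj (p, q) m) = M.proj (p + 1, q) (M.d m) := by
  refine hom_induction M.internal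
    (p := fun m => M.d (M.proj (p, q) m) = M.proj (p + 1, q) (M.d m)) (by simp)
    (fun a b ha hb => by simp only [map_add, ha, hb]) (fun y m hm => ?_) m
  obtain ⟨p', q'⟩ := y
  by_cases h : (p', q') = (p, q)
  · obtain ⟨rfl, rfl⟩ := Prod.mk.inj h
    rw [M.proj_of_mem hm, M.proj_of_mem (M.d_mem hm)]
  · rw [M.proj_of_mem_ne h hm, M.proj_of_mem_ne _ (M.d_mem hm), map_zero]
    simpa using h

/-- Acyclicity and boundaries are formulated without degrees. Since d is homogeneous, a primitive of
a homogeneous element can be replaced by its component in the right degree. -/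
theorem exists_homogeneous_preimage (M : DGMod A) {p q : ℤ} {m m' : M.carrier}
    (hm : m ∈ M.gr (p + 1, q)) (h : M.d m' = m) : ∃ m'' ∈ M.gr (p, q), M.d m'' = m :=
  ⟨M.proj (p, q) m', M.proj_mem _ _, by rw [d_proj, h, M.proj_of_mem hm]⟩

/-! ### Homology -/

/-- The cycles of bidegree `x`. -/
def cyc (M : DGMod A) (x : ℤ × ℤ) : Submodule k M.carrier := M.gr x ⊓ LinearMap.ker M.d

/-- The homology in bidegree `x`. -/
abbrev Hlgy (M : DGMod A) (x : ℤ × ℤ) : Type u :=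
  cyc M x ⧸ (LinearMap.range M.d).submoduleOf (cyc M x)

/-- The dimension of the homology in bidegree `x`. -/
def hdim (M : DGMod A) (x : ℤ × ℤ) : ℕ := Module.finrank k (Hlgy M x)

/-- The homology class of a cycle. -/
def hcls (M : DGMod A) {x : ℤ × ℤ} (m : cyc M x) : Hlgy M x := Submodule.Quotient.mk m

theorem hcls_surjective (M : DGMod A) {x : ℤ × ℤ} (z : Hlgy M x) : ∃ m, M.hcls m = z :=
  Submodule.Quotient.mk_surjective _ z

theorem hcls_eq_zero (M : DGMod A) {x : ℤ × ℤ} (m : cyc M x) :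
    M.hcls m = 0 ↔ ∃ m', M.d m' = m.1 :=
  Submodule.Quotient.mk_eq_zero _

theorem hcls_eq (M : DGMod A) {x : ℤ × ℤ} (m n : cyc M x) :
    M.hcls m = M.hcls n ↔ ∃ m', M.d m' = m.1 - n.1 :=
  Submodule.Quotient.eq _

/-- The map induced on homology by a linear map which maps cycles to cycles and boundaries to
boundaries. -/
def hmap {M : DGMod A} {N : DGMod B} (f : M.carrier →ₗ[k] N.carrier) (x y : ℤ × ℤ)
    (hgr : ∀ m ∈ M.gr x, f m ∈ N.gr y) (hd : ∀ m, M.d m = 0 → N.d (f m) = 0)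
    (hb : ∀ m, ∃ n, N.d n = f (M.d m)) : Hlgy M x →ₗ[k] Hlgy N y :=
  Submodule.mapQ _ _ (f.restrict (p := cyc M x) (q := cyc N y)
    fun m hm => ⟨hgr m hm.1, hd m hm.2⟩) (by
      rintro ⟨_, hm⟩ ⟨m', rfl⟩
      exact hb m')

/-- The maps need only send cycles to cycles and boundaries to boundaries, without commuting with d.
This admits the identity between M and M[1], whose differentials differ by a sign. The two modules
may live over different algebras. -/
theorem hlgy_equiv {M : DGMod A} {N : DGMod B} {x y : ℤ × ℤ} (f : M.carrier →ₗ[k] N.carrier)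
    (g : N.carrier →ₗ[k] M.carrier)
    (hgr : ∀ m ∈ M.gr x, f m ∈ N.gr y) (hd : ∀ m, M.d m = 0 → N.d (f m) = 0)
    (hb : ∀ m, ∃ n, N.d n = f (M.d m))
    (hgr' : ∀ m ∈ N.gr y, g m ∈ M.gr x) (hd' : ∀ m, N.d m = 0 → M.d (g m) = 0)
    (hb' : ∀ m, ∃ n, M.d n = g (N.d m))
    (hgf : ∀ m, M.d m = 0 → ∃ m', M.d m' = g (f m) - m)
    (hfg : ∀ m, N.d m = 0 → ∃ m', N.d m' = f (g m) - m) :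
    Nonempty (Hlgy M x ≃ₗ[k] Hlgy N y) := by
  refine ⟨LinearEquiv.ofLinearMap (hmap f x y hgr hd hb) (hmap g y x hgr' hd' hb') ?_ ?_⟩
  · refine LinearMap.ext fun z => ?_
    obtain ⟨m, rfl⟩ := N.hcls_surjective z
    exact (N.hcls_eq _ _).2 (hfg m.1 m.2.2)
  · refine LinearMap.ext fun z => ?_
    obtain ⟨m, rfl⟩ := M.hcls_surjective z
    exact (M.hcls_eq _ _).2 (hgf m.1 m.2.2)

theorem HtpyEquiv.hlgy {M N : DGMod A} (h : HtpyEquiv M N) (x : ℤ × ℤ) :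
    Nonempty (Hlgy M x ≃ₗ[k] Hlgy N x) := by
  obtain ⟨f, hf, g, hg, h1, h2⟩ := h
  obtain ⟨s, -, hs⟩ := mem_homB_zero.1 h1
  obtain ⟨t, -, ht⟩ := mem_homB_zero.1 h2
  refine hlgy_equiv f g (fun m hm => homZ_gr hf hm) (fun m hm => by rw [homZ_comm hf, hm, map_zero])
    (fun m => ⟨f m, homZ_comm hf m⟩) (fun m hm => homZ_gr hg hm)
    (fun m hm => by rw [homZ_comm hg, hm, map_zero]) (fun m => ⟨g m, homZ_comm hg m⟩)
    (fun m hm => ⟨s m, ?_⟩) (fun m hm => ⟨t m, ?_⟩)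
  · have := hs m
    rw [hm, map_zero, add_zero] at this
    exact this.symm
  · have := ht m
    rw [hm, map_zero, add_zero] at this
    exact this.symm

theorem hlgy_shift (M : DGMod A) (p q : ℤ) :
    Nonempty (Hlgy M.shift (p, q) ≃ₗ[k] Hlgy M (p + 1, q)) :=
  hlgy_equiv (M := M.shift) (N := M) LinearMap.id LinearMap.id (fun _ h => h)
    (fun _ h => neg_eq_zero.1 h) (fun m => ⟨-m, map_neg M.d m⟩) (fun _ h => h)
    (fun _ h => neg_eq_zero.2 h) (fun m => ⟨-m, by simp⟩) (fun _ _ => ⟨0, by simp⟩)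
    (fun _ _ => ⟨0, by simp⟩)

/-- This is the long exact sequence of the cone, in numerical form: r is the rank of the map induced
by f on homology. The homology of the cone is an extension of the kernel in degree p + 1 by the
cokernel in degree p. -/
theorem hdim_cone {M N : DGMod A} (f : homZ 0 M N) [∀ x, Module.Finite k (Hlgy M x)]
    [∀ x, Module.Finite k (Hlgy N x)] [∀ x, Module.Finite k (Hlgy (cone f) x)] :
    ∃ r : ℤ × ℤ → ℕ, (∀ x, r x ≤ hdim N x) ∧ ∀ p q : ℤ,
      hdim (cone f) (p, q) + (r (p, q) + r (p + 1, q)) = hdim N (p, q) + hdim M (p + 1, q) := by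
  let F : ∀ x, Hlgy M x →ₗ[k] Hlgy N x := fun x =>
    hmap f.1 x x (fun m hm => homZ_gr f.2 hm) (fun m hm => by rw [homZ_comm f.2, hm, map_zero])
      (fun m => ⟨f.1 m, homZ_comm f.2 m⟩)
  refine ⟨fun x => Module.finrank k (LinearMap.range (F x)),
    fun x => Submodule.finrank_le _, fun p q => ?_⟩
  let α : Hlgy N (p, q) →ₗ[k] Hlgy (cone f) (p, q) :=
    hmap (M := N) (N := cone f) (LinearMap.inl k N.carrier M.carrier) (p, q) (p, q)
      (fun m hm => ⟨hm, Submodule.zero_mem _⟩) (fun m hm => by simp [hm])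
      (fun m => ⟨(m, 0), by simp⟩)
  let β : Hlgy (cone f) (p, q) →ₗ[k] Hlgy M (p + 1, q) :=
    hmap (M := cone f) (N := M) (LinearMap.snd k N.carrier M.carrier) (p, q) (p + 1, q)
      (fun m hm => hm.2) (fun m hm => neg_eq_zero.1 (Prod.mk.inj hm).2)
      (fun m => ⟨-m.2, by simp⟩)
  -- Exactness at H(N): a primitive (y, m) in the cone of the cycle (n, 0) says that f(m) is
  -- homologous to n.
  have h1 : LinearMap.ker α = LinearMap.range (F (p, q)) := by
    ext z
    obtain ⟨⟨n, hn1, hn2⟩, rfl⟩ := N.hcls_surjective z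
    rw [LinearMap.mem_ker, LinearMap.mem_range]
    constructor
    · intro h
      obtain ⟨m', hm'⟩ := (hcls_eq_zero _ _).1 h
      obtain ⟨⟨y, m⟩, hym, hd⟩ := (cone f).exists_homogeneous_preimage (p := p - 1) (q := q)
        (by rw [sub_add_cancel]; exact ⟨hn1, Submodule.zero_mem _⟩) hm'
      obtain ⟨hd1, hd2⟩ := Prod.mk.inj hd
      have hm : m ∈ M.gr (p, q) := by have := hym.2; simpa using this
      refine ⟨M.hcls ⟨m, hm, neg_eq_zero.1 hd2⟩, ?_⟩
      refine (N.hcls_eq _ _).2 ⟨-y, ?_⟩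
      change N.d y + f.1 m = n at hd1
      change N.d (-y) = f.1 m - n
      rw [← hd1, map_neg]
      abel
    · rintro ⟨w, hw⟩
      obtain ⟨⟨m, hm1, hm2⟩, rfl⟩ := M.hcls_surjective w
      obtain ⟨y, hy⟩ := (N.hcls_eq _ _).1 hw
      refine (hcls_eq_zero _ _).2 ⟨(-y, m), ?_⟩
      refine Prod.ext ?_ (neg_eq_zero.2 hm2)
      change N.d (-y) + f.1 m = n
      rw [map_neg, hy]
      change -(f.1 m - n) + f.1 m = n
      abel
  -- Exactness at H(cone): if m = d m'', subtracting the boundary of (0, m'') up to sign moves (n,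
  -- m) to the cycle (n + f m'', 0).
  have h2 : LinearMap.ker β = LinearMap.range α := by
    ext z
    obtain ⟨⟨⟨n, m⟩, hn1, hn2⟩, rfl⟩ := (cone f).hcls_surjective z
    obtain ⟨hd1, hd2⟩ := Prod.mk.inj hn2
    change N.d n + f.1 m = 0 at hd1
    rw [LinearMap.mem_ker, LinearMap.mem_range]
    constructor
    · intro h
      obtain ⟨m', hm'⟩ := (hcls_eq_zero _ _).1 h
      obtain ⟨m'', hm'', hd⟩ := M.exists_homogeneous_preimage (p := p) (q := q) hn1.2 hm'
      change M.d m'' = m at hd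
      refine ⟨N.hcls ⟨n + f.1 m'', Submodule.add_mem _ hn1.1 (homZ_gr f.2 hm''), ?_⟩, ?_⟩
      · change N.d (n + f.1 m'') = 0
        rw [map_add, homZ_comm f.2, hd, hd1]
      · refine (hcls_eq _ _ _).2 ⟨(0, m''), ?_⟩
        refine Prod.ext ?_ ?_
        · change N.d 0 + f.1 m'' = n + f.1 m'' - n
          rw [map_zero]; abel
        · change -M.d m'' = 0 - m
          rw [hd, zero_sub]
    · rintro ⟨w, hw⟩
      obtain ⟨⟨y, hy1, hy2⟩, rfl⟩ := N.hcls_surjective w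
      obtain ⟨⟨y', m'⟩, hy⟩ := ((cone f).hcls_eq _ _).1 hw
      obtain ⟨-, hd⟩ := Prod.mk.inj hy
      refine (hcls_eq_zero _ _).2 ⟨m', ?_⟩
      change -M.d m' = 0 - m at hd
      change M.d m' = m
      rw [zero_sub] at hd
      exact neg_injective hd
  -- Exactness at H(M): a primitive n of f(m) completes m to the cycle (-n, m) of the cone.
  have h3 : LinearMap.range β = LinearMap.ker (F (p + 1, q)) := by
    ext z
    obtain ⟨⟨m, hm1, hm2⟩, rfl⟩ := M.hcls_surjective z
    rw [LinearMap.mem_ker, LinearMap.mem_range]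
    constructor
    · rintro ⟨w, hw⟩
      obtain ⟨⟨⟨n, m'⟩, hn1, hn2⟩, rfl⟩ := (cone f).hcls_surjective w
      obtain ⟨hd1, hd2⟩ := Prod.mk.inj hn2
      change N.d n + f.1 m' = 0 at hd1
      obtain ⟨v, hv⟩ := (M.hcls_eq _ _).1 hw
      change M.d v = m' - m at hv
      refine (hcls_eq_zero _ _).2 ⟨-n - f.1 v, ?_⟩
      change N.d (-n - f.1 v) = f.1 m
      rw [map_sub, map_neg, homZ_comm f.2, hv, map_sub, ← eq_neg_of_add_eq_zero_right hd1]
      abel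
    · intro h
      obtain ⟨n', hn'⟩ := (hcls_eq_zero _ _).1 h
      obtain ⟨n, hn, hd⟩ := N.exists_homogeneous_preimage (p := p) (q := q)
        (homZ_gr f.2 hm1) hn'
      change N.d n = f.1 m at hd
      refine ⟨(cone f).hcls ⟨(-n, m), ⟨Submodule.neg_mem _ hn, hm1⟩, ?_⟩, rfl⟩
      refine Prod.ext ?_ (neg_eq_zero.2 hm2)
      change N.d (-n) + f.1 m = 0
      rw [map_neg, hd, neg_add_cancel]
  -- Rank-nullity for the three maps, linked by exactness, gives the count.
  have e1 := LinearMap.finrank_range_add_finrank_ker α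
  have e2 := LinearMap.finrank_range_add_finrank_ker β
  have e3 := LinearMap.finrank_range_add_finrank_ker (F (p + 1, q))
  rw [h1] at e1
  rw [h2, h3] at e2
  simp only [hdim]
  omega

/-! ### The Euler characteristic -/

/-- The monomial `(-1) ^ p q ^ r` attached to a bidegree `(p, r)`. -/
def mono (x : ℤ × ℤ) : Zq := ((x.1.negOnePow : ℤ) : Zq) * LaurentPolynomial.T x.2

theorem mono_add (x y : ℤ × ℤ) : mono (x + y) = mono x * mono y := by
  simp only [mono, Prod.fst_add, Prod.snd_add, Int.negOnePow_add, LaurentPolynomial.T_add,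
    Units.val_mul, Int.cast_mul]
  ring

theorem mono_succ (p q : ℤ) : mono (p + 1, q) = -mono (p, q) := by
  simp [mono, Int.negOnePow_succ]

theorem mono_zero : mono 0 = 1 := by simp [mono]

/-- The generating function `∑ x, g x (-1) ^ x.1 q ^ x.2`. -/
def genSum (g : ℤ × ℤ → ℕ) : Zq := ∑ᶠ x, (g x : Zq) * mono x

theorem finite_support_mul_mono {g : ℤ × ℤ → ℕ} (h : g.support.Finite) :
    (Function.support fun x => (g x : Zq) * mono x).Finite :=
  h.subset fun x hx hg => hx (by simp [hg])

theorem genSum_add {g g' : ℤ × ℤ → ℕ} (h : g.support.Finite) (h' : g'.support.Finite) :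
    genSum (fun x => g x + g' x) = genSum g + genSum g' := by
  rw [genSum, genSum, genSum,
    ← finsum_add_distrib (finite_support_mul_mono h) (finite_support_mul_mono h')]
  simp only [Nat.cast_add, add_mul]

theorem finite_support_shift {g : ℤ × ℤ → ℕ} (h : g.support.Finite) :
    (Function.support fun x : ℤ × ℤ => g (x.1 + 1, x.2)).Finite :=
  h.preimage (f := fun x : ℤ × ℤ => (x.1 + 1, x.2)) fun x _ y _ hxy => by
    simpa [Prod.ext_iff] using hxy

/-- This is a reindexing of the sum under which each sign (-1)^p flips, so no finiteness of the
support is required. -/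
theorem genSum_shift (g : ℤ × ℤ → ℕ) : genSum (fun x => g (x.1 + 1, x.2)) = -genSum g := by
  rw [genSum, genSum, ← finsum_neg_distrib,
    ← finsum_comp_equiv ((Equiv.addRight (1 : ℤ)).prodCongr (Equiv.refl ℤ))
      (f := fun x => -((g x : Zq) * mono x))]
  refine finsum_congr fun x => ?_
  change _ = -((g (x.1 + 1, x.2) : Zq) * mono (x.1 + 1, x.2))
  rw [mono_succ]
  ring

theorem genSum_qshift (n : ℤ) (g : ℤ × ℤ → ℕ) :
    genSum (fun x => g (x.1, x.2 - n)) = LaurentPolynomial.T n * genSum g := by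
  rw [genSum, genSum, ← finsum_comp_equiv ((Equiv.refl ℤ).prodCongr (Equiv.subRight n))
    (f := fun x => (g x : Zq) * mono x), ← smul_eq_mul, smul_finsum]
  refine finsum_congr fun x => ?_
  change _ = LaurentPolynomial.T n * ((g (x.1, x.2 - n) : Zq) * mono (x.1, x.2 - n))
  have : mono x = LaurentPolynomial.T n * mono (x.1, x.2 - n) := by
    simp only [mono]
    rw [mul_left_comm, ← LaurentPolynomial.T_add, add_sub_cancel]
  rw [this]
  ring

/-- The graded Euler characteristic of the homology of a dg module. -/
def euler (M : DGMod A) : Zq := genSum (hdim M)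

/-- Finiteness of the total homology. -/
structure HasFiniteHlgy (M : DGMod A) : Prop where
  finite : ∀ x, Module.Finite k (Hlgy M x)
  support : (hdim M).support.Finite

theorem hdim_congr {M : DGMod A} {N : DGMod B}
    (h : ∀ x, Nonempty (Hlgy M x ≃ₗ[k] Hlgy N x)) : hdim M = hdim N :=
  funext fun x => (h x).elim LinearEquiv.finrank_eq

theorem HasFiniteHlgy.congr {M : DGMod A} {N : DGMod B} (hM : M.HasFiniteHlgy)
    (h : ∀ x, Nonempty (Hlgy M x ≃ₗ[k] Hlgy N x)) : N.HasFiniteHlgy where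
  finite x := by
    obtain ⟨e⟩ := h x
    have := hM.finite x
    exact Module.Finite.equiv e
  support := by rw [← hdim_congr h]; exact hM.support

theorem HtpyEquiv.euler_eq {M N : DGMod A} (h : HtpyEquiv M N) : euler M = euler N := by
  rw [euler, euler, hdim_congr h.hlgy]

theorem euler_shift (M : DGMod A) : euler M.shift = -euler M := by
  rw [euler, euler, ← genSum_shift]
  congr 1
  exact funext fun x => (hlgy_shift M x.1 x.2).elim LinearEquiv.finrank_eq

theorem euler_qshift (n : ℤ) (M : DGMod A) :
    euler (M.qshift n) = LaurentPolynomial.T n * euler M :=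
  genSum_qshift n (hdim M)

/-- The ranks r(p) and r(p + 1) enter with opposite signs and cancel in the alternating sum. -/
theorem euler_cone {M N : DGMod A} (f : homZ 0 M N) (hM : M.HasFiniteHlgy)
    (hN : N.HasFiniteHlgy) (hf : (cone f).HasFiniteHlgy) :
    euler N = euler M + euler (cone f) := by
  have := hM.finite
  have := hN.finite
  have := hf.finite
  obtain ⟨r, hr, h⟩ := hdim_cone f
  -- The ranks are bounded by the dimensions of H(N), so they have finite support and the sums may
  -- be split.
  have hrs : r.support.Finite := hN.support.subset fun x hx h0 =>
    hx (Nat.le_zero.1 ((hr x).trans_eq h0))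
  have e : (fun x => hdim (cone f) x + (r x + r (x.1 + 1, x.2))) =
      fun x => hdim N x + hdim M (x.1 + 1, x.2) := funext fun x => h x.1 x.2
  have e' := congrArg genSum e
  rw [genSum_add hf.support, genSum_add hrs (finite_support_shift hrs), genSum_shift,
    genSum_add hN.support (finite_support_shift hM.support), genSum_shift] at e'
  · simp only [euler]
    linear_combination -e'
  · exact (hrs.union (finite_support_shift hrs)).subset (Function.support_add _ _)

theorem IsTriangle.euler_eq {P₁ P₂ P₃ : DGMod A} (h : IsTriangle P₁ P₂ P₃)
    (h₁ : P₁.HasFiniteHlgy) (h₂ : P₂.HasFiniteHlgy) (h₃ : P₃.HasFiniteHlgy) :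
    euler P₂ = euler P₁ + euler P₃ := by
  obtain ⟨X, Y, f, e₁, e₂, e₃⟩ := h
  rw [e₁.euler_eq, e₂.euler_eq, e₃.euler_eq]
  exact euler_cone f (h₁.congr e₁.hlgy) (h₂.congr e₂.hlgy) (h₃.congr e₃.hlgy)

end DGMod

/-! ### Splitting complexes of vector spaces -/

namespace DGMod

variable {A : DGAlg k}

/-- Over a field the differential has a linear generalized inverse h, with d h d = d. It can be made
homogeneous by projecting onto the right degree, and then corrected to satisfy h² = 0. -/
theorem exists_splitting_homotopy (M : DGMod A) : ∃ h : M.carrier →ₗ[k] M.carrier,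
    (∀ p q, ∀ m ∈ M.gr (p, q), h m ∈ M.gr (p - 1, q)) ∧ (∀ m, M.d (h (M.d m)) = M.d m) ∧
    ∀ m, h (h m) = 0 := by
  -- A linear section of d over its image, extended to the whole space with no control of degrees.
  obtain ⟨g₀, hg₀⟩ := M.d.rangeRestrict.exists_rightInverse_of_surjective M.d.range_rangeRestrict
  obtain ⟨g, hg⟩ := LinearMap.exists_extend g₀
  have hgd : ∀ m, M.d (g (M.d m)) = M.d m := fun m => by
    have h1 := LinearMap.congr_fun hg (M.d.rangeRestrict m)
    have h2 := congrArg Subtype.val (LinearMap.congr_fun hg₀ (M.d.rangeRestrict m))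
    change g (M.d m) = g₀ (M.d.rangeRestrict m) at h1
    rw [h1]
    exact h2
  -- On vectors of degree (p, q), keep only the component of g in degree (p - 1, q).
  let h : M.carrier →ₗ[k] M.carrier :=
    (Finsupp.lsum k fun x : ℤ × ℤ => (M.proj (x.1 - 1, x.2)).comp g).comp (coact M.internal)
  have hh : ∀ p q, ∀ m ∈ M.gr (p, q), h m = M.proj (p - 1, q) (g m) := fun p q m hm => by
    simp [h, coact_of_mem M.internal hm]
  have hgr : ∀ p q, ∀ m ∈ M.gr (p, q), h m ∈ M.gr (p - 1, q) := fun p q m hm => by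
    rw [hh p q m hm]; exact M.proj_mem _ _
  have hdhd : ∀ m, M.d (h (M.d m)) = M.d m := fun m => by
    refine hom_induction M.internal (p := fun m => M.d (h (M.d m)) = M.d m) (by simp)
      (fun a b ha hb => by simp only [map_add, ha, hb]) (fun x m hm => ?_) m
    obtain ⟨p, q⟩ := x
    rw [hh _ _ _ (M.d_mem hm), d_proj, hgd, sub_add_cancel, M.proj_of_mem (M.d_mem hm)]
  -- The corrected operator is h d h (1 - h d). Its square vanishes since (1 - h d) h d h = h d h -
  -- h d h d h = 0, and d h d = d persists.
  refine ⟨h ∘ₗ M.d ∘ₗ h ∘ₗ (LinearMap.id - h ∘ₗ M.d), fun p q m hm => ?_, fun m => ?_, fun m => ?_⟩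
  · have h1 : m - h (M.d m) ∈ M.gr (p, q) := by
      have := hgr _ _ _ (M.d_mem hm)
      rw [add_sub_cancel_right] at this
      exact Submodule.sub_mem _ hm this
    have h2 := M.d_mem (hgr _ _ _ h1)
    rw [sub_add_cancel] at h2
    exact hgr _ _ _ h2
  · simp [M.d_d, hdhd]
  · simp [hdhd]

/-- The projection onto a complement of the boundaries in the cycles defined by a splitting
homotopy. -/
def harm (M : DGMod A) (h : M.carrier →ₗ[k] M.carrier) : M.carrier →ₗ[k] M.carrier :=
  LinearMap.id - M.d ∘ₗ h - h ∘ₗ M.d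

theorem harm_apply (M : DGMod A) (h : M.carrier →ₗ[k] M.carrier) (m : M.carrier) :
    M.harm h m = m - M.d (h m) - h (M.d m) := rfl

section Harm

variable {M : DGMod A} {h : M.carrier →ₗ[k] M.carrier}

theorem d_harm (hd : ∀ m, M.d (h (M.d m)) = M.d m) (m : M.carrier) : M.d (M.harm h m) = 0 := by
  simp [harm_apply, M.d_d, hd]

theorem harm_d (hd : ∀ m, M.d (h (M.d m)) = M.d m) (m : M.carrier) : M.harm h (M.d m) = 0 := by
  simp [harm_apply, M.d_d, hd]

/-- The differential vanishes on the image of 1 - d h - h d, and so does d h, by h² = 0 and d h d =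
d. Hence this operator acts there as the identity. -/
theorem harm_harm (hd : ∀ m, M.d (h (M.d m)) = M.d m) (hh : ∀ m, h (h m) = 0) (m : M.carrier) :
    M.harm h (M.harm h m) = M.harm h m := by
  rw [harm_apply M h (M.harm h m), d_harm hd, map_zero, sub_zero]
  simp [harm_apply, hd, hh]

theorem harm_mem (hgr : ∀ p q, ∀ m ∈ M.gr (p, q), h m ∈ M.gr (p - 1, q)) {x : ℤ × ℤ}
    {m : M.carrier} (hm : m ∈ M.gr x) : M.harm h m ∈ M.gr x := by
  obtain ⟨p, q⟩ := x
  have h1 := M.d_mem (hgr _ _ _ hm)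
  have h2 := hgr _ _ _ (M.d_mem hm)
  rw [sub_add_cancel] at h1
  rw [add_sub_cancel_right] at h2
  exact Submodule.sub_mem _ (Submodule.sub_mem _ hm h1) h2

end Harm

/-- Between complexes with zero differential a null-homotopic map is zero, so equality in the
homotopy category can be tested on vectors. -/
theorem eq_zero_of_mem_homB_zero {M N : DGMod A} (hM : M.d = 0) (hN : N.d = 0)
    {f : M.carrier →ₗ[k] N.carrier} (hf : f ∈ homB 0 M N) : f = 0 := by
  obtain ⟨s, -, hs⟩ := mem_homB_zero.1 hf
  ext m
  rw [hs, hM, hN]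
  simp

end DGMod

/-! ### Dg algebras equal to the base field -/

/-- The dg algebra is the base field. -/
def DGAlg.IsBase (A : DGAlg k) : Prop := Function.Bijective (algebraMap k A.carrier)

namespace DGAlg.IsBase

open DGMod

variable {A : DGAlg k}

/-- The isomorphism of the base field with the algebra. -/
def equiv (hA : A.IsBase) : k ≃ₐ[k] A.carrier := AlgEquiv.ofBijective (Algebra.ofId k A.carrier) hA

theorem exists_smul_one (hA : A.IsBase) (a : A.carrier) : ∃ c : k, a = c • (1 : A.carrier) := by
  obtain ⟨c, rfl⟩ := hA.2 a
  exact ⟨c, Algebra.algebraMap_eq_smul_one c⟩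

theorem mem_zero (hA : A.IsBase) (a : A.carrier) : a ∈ A.gr 0 := by
  obtain ⟨c, rfl⟩ := hA.exists_smul_one a
  exact Submodule.smul_mem _ _ A.one_mem

theorem eq_zero_of_mem (hA : A.IsBase) {i : ℤ} (hi : i ≠ 0) {a : A.carrier}
    (ha : a ∈ A.gr i) : a = 0 :=
  eq_zero_of_mem_of_mem A.internal hi ha (hA.mem_zero a)

theorem d_eq_zero (hA : A.IsBase) (a : A.carrier) : A.d a = 0 :=
  hA.eq_zero_of_mem (by norm_num) (A.d_mem (hA.mem_zero a))

/-- The algebra consists of scalars in degree 0, so linearity over it is automatic and only the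
grading must be checked. -/
theorem mem_homDeg (hA : A.IsBase) {n : ℤ} {M N : DGMod A} {f : M.carrier →ₗ[k] N.carrier}
    (hgr : ∀ p q, ∀ m ∈ M.gr (p, q), f m ∈ N.gr (p + n, q)) : f ∈ homDeg n M N := by
  refine ⟨hgr, fun i a ha m => ?_⟩
  by_cases hi : i = 0
  · obtain ⟨c, rfl⟩ := hA.exists_smul_one a
    simp [hi, sg_zero]
  · rw [hA.eq_zero_of_mem hi ha]
    simp

theorem mem_homZ_zero (hA : A.IsBase) {M N : DGMod A} {f : M.carrier →ₗ[k] N.carrier}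
    (hgr : ∀ x, ∀ m ∈ M.gr x, f m ∈ N.gr x) (hd : ∀ m, N.d (f m) = f (M.d m)) :
    f ∈ homZ 0 M N := by
  refine DGMod.mem_homZ_zero hgr (fun a m => ?_) hd
  obtain ⟨c, rfl⟩ := hA.exists_smul_one a
  simp

theorem htpyEquiv_of_linearEquiv (hA : A.IsBase) {M N : DGMod A} (e : M.carrier ≃ₗ[k] N.carrier)
    (hgr : ∀ x, ∀ m ∈ M.gr x, e m ∈ N.gr x) (hgr' : ∀ x, ∀ n ∈ N.gr x, e.symm n ∈ M.gr x)
    (hd : ∀ m, N.d (e m) = e (M.d m)) : HtpyEquiv M N :=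
  .of_linearEquiv e (hA.mem_homZ_zero hgr hd)
    (hA.mem_homZ_zero hgr' fun n => e.injective (by simp [← hd]))

/-- An acyclic complex of vector spaces is contractible: the harmonic projection of any vector is a
cycle, hence a boundary, hence killed by the idempotent projection itself. Composing a cocycle with
the contraction h gives its primitive. -/
theorem isProjective (hA : A.IsBase) (P : DGMod A) : P.IsProjective := by
  intro M hM n f hf
  obtain ⟨h, hgr, hd, hh⟩ := M.exists_splitting_homotopy
  have key : ∀ m, m = M.d (h m) + h (M.d m) := fun m => by
    obtain ⟨m', hm'⟩ := hM _ (d_harm hd m)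
    have h0 : M.harm h m = 0 := by rw [← harm_harm hd hh, ← hm', harm_d hd]
    rw [harm_apply] at h0
    rw [← sub_eq_zero, ← h0]
    abel
  have hfd : ∀ m, M.d (f m) = sg k n • f (P.d m) := fun m => by
    have := LinearMap.congr_fun (LinearMap.mem_ker.1 hf.2) m
    rwa [homD_apply, LinearMap.zero_apply, sub_eq_zero] at this
  refine ⟨h.comp f, hA.mem_homDeg fun p q m hm => ?_, ?_⟩
  · have := hgr _ _ _ (hf.1.1 p q m hm)
    rwa [add_sub_assoc] at this
  · ext m
    rw [homD_apply, LinearMap.comp_apply, LinearMap.comp_apply, sg_pred, neg_smul, sub_neg_eq_add,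
      ← map_smul, ← hfd, ← key]

theorem supported_isInternal {I : Type*} (deg : I → ℤ × ℤ) :
    DirectSum.IsInternal fun x => Finsupp.supported k k {i | deg i = x} := by
  refine isInternal_of_coaction _ (fun v => ?_)
    (Finsupp.lsum k fun i => (Finsupp.lsingle (deg i)).comp (Finsupp.lsingle i)) (fun x v hv => ?_)
  · induction v using Finsupp.induction_linear with
    | zero => exact Submodule.zero_mem _
    | add v w hv hw => exact Submodule.add_mem _ hv hw
    | single i c =>
      exact (le_iSup (fun x => Finsupp.supported k k {i | deg i = x}) (deg i))
        (Finsupp.single_mem_supported k c rfl)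
  · rw [Finsupp.supported_eq_span_single] at hv
    induction hv using Submodule.span_induction with
    | mem v hv =>
      obtain ⟨i, rfl, rfl⟩ := hv
      simp
    | zero => simp
    | add v w _ _ hv hw => rw [map_add, hv, hw, Finsupp.single_add]
    | smul c v _ hv => rw [map_smul, hv, Finsupp.smul_single]

/-- The dg module with zero differential and a basis indexed by `I`, with the basis vector `i` in
bidegree `deg i`. -/
abbrev freeMod (hA : A.IsBase) (I : Type u) (deg : I → ℤ × ℤ) : DGMod A where
  carrier := I →₀ k
  gr x := Finsupp.supported k k {i | deg i = x}
  internal := supported_isInternal deg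
  act := (Algebra.ofId k (Module.End k (I →₀ k))).comp hA.equiv.symm.toAlgHom
  act_mem := by
    intro i p q a m ha hm
    by_cases hi : i = 0
    · subst hi
      rw [zero_add]
      exact Submodule.smul_mem _ (hA.equiv.symm a) hm
    · rw [hA.eq_zero_of_mem hi ha, map_zero]
      exact Submodule.zero_mem _
  d := 0
  d_mem := fun _ => Submodule.zero_mem _
  d_d _ := rfl
  leibniz := fun ha m => by simp [hA.d_eq_zero]

variable {I J : Type u} {deg : I → ℤ × ℤ}

theorem mem_freeMod_gr (hA : A.IsBase) {x : ℤ × ℤ} {v : I →₀ k} :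
    v ∈ (hA.freeMod I deg).gr x ↔ ∀ i, v i ≠ 0 → deg i = x := by
  rw [Finsupp.mem_supported]
  exact ⟨fun h i hi => h (Finsupp.mem_support_iff.2 hi),
    fun h i hi => h i (Finsupp.mem_support_iff.1 hi)⟩

theorem freeMod_gr_le (hA : A.IsBase) {x : ℤ × ℤ} {S : Submodule k (I →₀ k)}
    (h : ∀ i, deg i = x → Finsupp.single i 1 ∈ S) : (hA.freeMod I deg).gr x ≤ S := by
  change Finsupp.supported k k {i | deg i = x} ≤ S
  rw [Finsupp.supported_eq_span_single, Submodule.span_le]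
  rintro _ ⟨i, hi, rfl⟩
  exact h i hi

/-- The complex retracts onto the image V of 1 - d h - h d, on which d vanishes, and -h is the
homotopy. A homogeneous basis of V provides the index type and the degrees. -/
theorem exists_htpyEquiv_freeMod (hA : A.IsBase) (M : DGMod A) :
    ∃ (I : Type u) (deg : I → ℤ × ℤ), HtpyEquiv M (hA.freeMod I deg) := by
  obtain ⟨h, hgr, hd, hh⟩ := M.exists_splitting_homotopy
  let V := LinearMap.range (M.harm h)
  let pV : M.carrier →ₗ[k] V := (M.harm h).rangeRestrict
  have hpV : ∀ v : V, pV v.1 = v := by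
    rintro ⟨_, m, rfl⟩
    exact Subtype.ext (harm_harm hd hh m)
  let grV : ℤ × ℤ → Submodule k V := fun x => (M.gr x).comap V.subtype
  have hpgr : ∀ x, ∀ m ∈ M.gr x, pV m ∈ grV x := fun x m hm => harm_mem hgr hm
  -- V inherits the grading because the projection onto it preserves degrees.
  have hV : DirectSum.IsInternal grV := by
    refine isInternal_of_coaction _ (fun v => ?_)
      ((Finsupp.mapRange.linearMap pV).comp ((coact M.internal).comp V.subtype)) (fun x v hv => ?_)
    · rw [← hpV v]
      refine hom_induction M.internal (p := fun m => pV m ∈ ⨆ x, grV x) (by simp)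
        (fun a b ha hb => by rw [map_add]; exact Submodule.add_mem _ ha hb)
        (fun x m hm => (le_iSup grV x) (hpgr x m hm)) v.1
    · rw [LinearMap.comp_apply, LinearMap.comp_apply,
        coact_of_mem M.internal (show V.subtype v ∈ M.gr x from hv)]
      simp [hpV]
  -- A basis of V formed from bases of its homogeneous pieces; the index records the bidegree.
  let b := hV.collectedBasis fun x => Module.Basis.ofVectorSpace k (grV x)
  refine ⟨_, fun i => i.1, b.repr.toLinearMap.comp pV, hA.mem_homZ_zero (fun x m hm => ?_)
    (fun m => ?_), V.subtype.comp b.repr.symm.toLinearMap, hA.mem_homZ_zero (fun x v hv => ?_)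
    (fun v => ?_), mem_homB_zero.2 ⟨-h, hA.mem_homDeg fun p q m hm =>
      Submodule.neg_mem _ (hgr p q m hm), fun m => ?_⟩, ?_⟩
  · rw [mem_freeMod_gr]
    rintro ⟨y, a⟩ hi
    by_contra hxy
    exact hi (hV.collectedBasis_repr_of_mem_ne _ (Ne.symm hxy) (hpgr x m hm))
  · have : pV (M.d m) = 0 := Subtype.ext (harm_d hd m)
    simp [this]
  · refine hA.freeMod_gr_le (S := (M.gr x).comap (V.subtype.comp b.repr.symm.toLinearMap))
      (fun i hi => ?_) hv
    subst hi
    rw [Submodule.mem_comap, LinearMap.comp_apply, LinearEquiv.coe_coe, b.repr_symm_single_one]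
    exact hV.collectedBasis_mem _ i
  · change M.d ((b.repr.symm v : V) : M.carrier) = _
    obtain ⟨m, hm⟩ := (b.repr.symm v).2
    rw [← hm, d_harm hd]
    simp
  · simp only [LinearMap.sub_apply, LinearMap.comp_apply, LinearEquiv.coe_coe,
      LinearEquiv.symm_apply_apply, LinearMap.id_apply, LinearMap.neg_apply, map_neg]
    change M.harm h m - m = _
    rw [harm_apply]
    abel
  · convert Submodule.zero_mem _
    refine LinearMap.ext fun v => ?_
    change b.repr (pV (b.repr.symm v : V).1) - v = 0
    rw [hpV, LinearEquiv.apply_symm_apply, sub_self]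

/-- The tautological map from a free module to the direct sum of its lines. -/
def toSumLines (hA : A.IsBase) (deg : I → ℤ × ℤ) :
    (hA.freeMod I deg).carrier →ₗ[k]
      (sum fun i => hA.freeMod PUnit.{u + 1} fun _ => deg i).carrier := by
  classical
  exact Finsupp.lsum k fun i => (DirectSum.lof k I
    (fun i => (hA.freeMod PUnit.{u + 1} fun _ => deg i).carrier) i).comp
      (Finsupp.lsingle PUnit.unit)

theorem toSumLines_single (hA : A.IsBase) (deg : I → ℤ × ℤ) (i : I) :
    toSumLines hA deg (Finsupp.single i 1) =
      (sumIncl (fun i => hA.freeMod PUnit.{u + 1} fun _ => deg i) i).1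
        (Finsupp.single PUnit.unit 1) := by
  simp [toSumLines, sumIncl]

theorem toSumLines_mem (hA : A.IsBase) (deg : I → ℤ × ℤ) : toSumLines hA deg ∈
    homZ 0 (hA.freeMod I deg) (sum fun i => hA.freeMod PUnit.{u + 1} fun _ => deg i) := by
  classical
  refine hA.mem_homZ_zero (fun x v hv => ?_) fun v => ?_
  · refine hA.freeMod_gr_le (S := Submodule.comap (toSumLines hA deg) ((sum fun i =>
      hA.freeMod PUnit.{u + 1} fun _ => deg i).gr x)) (fun i hi => ?_) hv
    subst hi
    rw [Submodule.mem_comap, toSumLines_single]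
    exact homZ_gr (sumIncl _ i).2 (Finsupp.single_mem_supported k 1 rfl)
  · rw [LinearMap.zero_apply, map_zero]
    exact DFinsupp.ext fun i => rfl

/-- The tautological map from the free module to the sum of its lines has every coordinate nonzero.
Compactness lifts its class to an element of the direct sum of Hom spaces, which has finite support;
every index must lie in that support. -/
theorem finite_of_isCompact (hA : A.IsBase) {P : DGMod A} (hP : P.IsCompact)
    (h : HtpyEquiv P (hA.freeMod I deg)) : Finite I := by
  classical
  obtain ⟨f, hf, g, hg, -, hfg⟩ := h
  obtain ⟨y, hy⟩ := (hP I (fun i => hA.freeMod PUnit.{u + 1} fun _ => deg i)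
    fun i => hA.isProjective _).2
      (Submodule.Quotient.mk ⟨_, comp_mem_homZ (toSumLines_mem hA deg) hf⟩)
  refine Set.finite_univ_iff.1 ((DFinsupp.support y).finite_toSet.subset fun j _ => ?_)
  by_contra hj
  have hj' : y j = 0 := by simpa using hj
  -- If j is outside the support of y, the j-th coordinate of the tautological map, composed with f,
  -- is null-homotopic.
  have h1 := LinearMap.congr_fun
    (component_sumHomK (fun i => hA.freeMod PUnit.{u + 1} fun _ => deg i) P j) y
  rw [LinearMap.comp_apply, hy] at h1
  have h2 := (Submodule.Quotient.mk_eq_zero _).1 (h1.trans hj')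
  set π := DirectSum.component k I
    (fun i => (hA.freeMod PUnit.{u + 1} fun _ => deg i).carrier) j with hπ
  have hπZ := component_mem_homZ (fun i => hA.freeMod PUnit.{u + 1} fun _ => deg i) j
  have h3 : π.comp ((toSumLines hA deg).comp f) ∈
    homB 0 P (hA.freeMod PUnit.{u + 1} fun _ => deg j) := h2
  -- Precompose with g and remove the error term f g - id: the j-th coordinate itself is
  -- null-homotopic, hence zero, although it maps the j-th basis vector to a generator.
  have h4 := Submodule.sub_mem _ (precomp_mem_homB hg h3)
    (comp_mem_homB hπZ (comp_mem_homB (toSumLines_mem hA deg) hfg))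
  have h5 := LinearMap.congr_fun (eq_zero_of_mem_homB_zero rfl rfl h4) (Finsupp.single j 1)
  have h6 : π (toSumLines hA deg (Finsupp.single j 1)) = 0 := by
    refine Eq.trans ?_ h5
    simp [hπ]
  rw [toSumLines_single] at h6
  have h7 : Finsupp.single PUnit.unit (1 : k) = 0 :=
    (DirectSum.component.lof_self k j _).symm.trans h6
  simp at h7

theorem isPerf_of_htpyEquiv (hA : A.IsBase) [Finite I] {P : DGMod A}
    (h : HtpyEquiv P (hA.freeMod I deg)) : P.IsPerf :=
  ⟨hA.isProjective P, isCompact_of_htpyEquiv h⟩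

theorem exists_htpyEquiv_of_isPerf (hA : A.IsBase) {P : DGMod A} (hP : P.IsPerf) :
    ∃ (I : Type u) (_ : Fintype I) (deg : I → ℤ × ℤ), HtpyEquiv P (hA.freeMod I deg) := by
  obtain ⟨I, deg, h⟩ := hA.exists_htpyEquiv_freeMod P
  have := hA.finite_of_isCompact hP.2 h
  exact ⟨I, Fintype.ofFinite I, deg, h⟩

theorem freeMod_isPerf (hA : A.IsBase) [Finite I] (deg : I → ℤ × ℤ) :
    (hA.freeMod I deg).IsPerf :=
  hA.isPerf_of_htpyEquiv (.refl _)

/-! ### Euler characteristics over the base field -/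

theorem hdim_freeMod (hA : A.IsBase) (deg : I → ℤ × ℤ) (x : ℤ × ℤ) :
    hdim (hA.freeMod I deg) x = Nat.card {i // deg i = x} := by
  have h1 : (LinearMap.range (hA.freeMod I deg).d).submoduleOf (cyc (hA.freeMod I deg) x) = ⊥ := by
    rw [LinearMap.range_zero, Submodule.submoduleOf, Submodule.comap_bot, Submodule.ker_subtype]
  have h2 : cyc (hA.freeMod I deg) x = Finsupp.supported k k {i | deg i = x} := by
    rw [cyc, LinearMap.ker_zero, inf_top_eq]
  rw [hdim, (Submodule.quotEquivOfEqBot _ h1).finrank_eq, (LinearEquiv.ofEq _ _ h2).finrank_eq,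
    (Finsupp.supportedEquivFinsupp (R := k) (M := k) {i | deg i = x}).finrank_eq,
    Module.finrank_eq_nat_card_basis Finsupp.basisSingleOne]
  rfl

theorem freeMod_hasFiniteHlgy (hA : A.IsBase) [Finite I] (deg : I → ℤ × ℤ) :
    (hA.freeMod I deg).HasFiniteHlgy where
  finite x := inferInstance
  support := (Set.finite_range deg).subset fun x hx => by
    by_contra h
    refine hx ?_
    rw [hdim_freeMod]
    have : IsEmpty {i // deg i = x} := ⟨fun i => h ⟨i.1, i.2⟩⟩
    exact Nat.card_of_isEmpty

theorem euler_freeMod (hA : A.IsBase) [Fintype I] (deg : I → ℤ × ℤ) :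
    euler (hA.freeMod I deg) = ∑ i, mono (deg i) := by
  classical
  -- Basis vectors are grouped by degree: the dimension in degree x is the size of the fibre of
  -- `deg` over x.
  rw [euler, genSum, finsum_eq_sum_of_support_subset (s := Finset.univ.image deg),
    Finset.sum_comp mono deg]
  · refine Finset.sum_congr rfl fun x _ => ?_
    rw [hdim_freeMod, nsmul_eq_mul, Nat.card_eq_fintype_card, Fintype.card_subtype]
  · refine fun x hx => ?_
    by_contra h
    refine hx ?_
    have : IsEmpty {i // deg i = x} := ⟨fun i => h (by simpa using ⟨i.1, i.2⟩)⟩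
    simp [hdim_freeMod]

theorem hasFiniteHlgy (hA : A.IsBase) {P : DGMod A} (hP : P.IsPerf) : P.HasFiniteHlgy := by
  obtain ⟨I, _, deg, h⟩ := hA.exists_htpyEquiv_of_isPerf hP
  exact (hA.freeMod_hasFiniteHlgy deg).congr h.symm.hlgy

/-! ### The Grothendieck group over the base field -/

theorem regular_htpyEquiv (hA : A.IsBase) :
    HtpyEquiv (regular A) (hA.freeMod PUnit.{u + 1} fun _ => 0) := by
  refine hA.htpyEquiv_of_linearEquiv
    (hA.equiv.symm.toLinearEquiv ≪≫ₗ (Finsupp.uniqueLinearEquiv k k PUnit.unit.{u + 1}).symm)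
    (fun x a ha => ?_) (fun x v hv => ?_) (fun a => ?_)
  · by_cases hx : x = 0
    · subst hx
      exact hA.mem_freeMod_gr.2 fun _ _ => rfl
    · have : a = 0 := by
        obtain ⟨p, q⟩ := x
        by_cases hq : q = 0
        · subst hq
          simp only [if_true] at ha
          exact hA.eq_zero_of_mem (fun hp => hx (by rw [hp]; rfl)) ha
        · simpa only [hq, if_false, Submodule.mem_bot] using ha
      rw [this, map_zero]
      exact Submodule.zero_mem _
  · by_cases hx : x = 0
    · subst hx
      exact hA.mem_zero _
    · have : v = 0 := Finsupp.ext fun i => by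
        by_contra h
        exact hx (hA.mem_freeMod_gr.1 hv i h).symm
      rw [this, map_zero]
      exact Submodule.zero_mem _
  · change 0 = _
    rw [show (regular A).d a = 0 from hA.d_eq_zero a, map_zero]

theorem regular_isPerf (hA : A.IsBase) : (regular A).IsPerf :=
  hA.isPerf_of_htpyEquiv hA.regular_htpyEquiv

theorem euler_regular (hA : A.IsBase) : euler (regular A) = 1 := by
  rw [hA.regular_htpyEquiv.euler_eq, euler_freeMod]
  simp [mono_zero]

theorem freeMod_htpyEquiv_shift (hA : A.IsBase) (deg : I → ℤ × ℤ) :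
    HtpyEquiv (hA.freeMod I deg) (hA.freeMod I fun i => ((deg i).1 + 1, (deg i).2)).shift :=
  hA.htpyEquiv_of_linearEquiv (LinearEquiv.refl k _)
    (fun x v hv => hA.mem_freeMod_gr.2 fun i hi => by
      rw [hA.mem_freeMod_gr.1 hv i hi])
    (fun x v hv => hA.mem_freeMod_gr.2 fun i hi => by
      have := (hA.mem_freeMod_gr (deg := fun i => ((deg i).1 + 1, (deg i).2))).1 hv i hi
      simpa [Prod.ext_iff] using this)
    (fun v => by simp)

theorem freeMod_htpyEquiv_qshift (hA : A.IsBase) (n : ℤ) (deg : I → ℤ × ℤ) :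
    HtpyEquiv (hA.freeMod I fun i => ((deg i).1, (deg i).2 + n)) ((hA.freeMod I deg).qshift n) :=
  hA.htpyEquiv_of_linearEquiv (LinearEquiv.refl k _)
    (fun x v hv => hA.mem_freeMod_gr.2 fun i hi => by
      rw [← hA.mem_freeMod_gr.1 hv i hi]; simp)
    (fun x v hv => hA.mem_freeMod_gr.2 fun i hi => by
      have := (hA.mem_freeMod_gr (deg := deg)).1 hv i hi
      rw [this]; simp)
    (fun v => by simp)

theorem freeMod_htpyEquiv_equiv (hA : A.IsBase) (e : I ≃ J) (deg : J → ℤ × ℤ) :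
    HtpyEquiv (hA.freeMod J deg) (hA.freeMod I (deg ∘ e)) :=
  hA.htpyEquiv_of_linearEquiv (Finsupp.domLCongr e.symm)
    (fun x v hv => hA.mem_freeMod_gr.2 fun i hi => hA.mem_freeMod_gr.1 hv (e i) (by simpa using hi))
    (fun x v hv => hA.mem_freeMod_gr.2 fun i hi => by
      have := hA.mem_freeMod_gr.1 hv (e.symm i) (by simpa using hi)
      simpa using this)
    (fun v => by simp)

/-- The cone of the zero map is a direct sum N ⊕ M[1]. Since M[1] lowers degrees by one, the line
split off must be placed one degree higher in M. -/
theorem freeMod_option_htpyEquiv (hA : A.IsBase) (deg : Option I → ℤ × ℤ) :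
    HtpyEquiv (hA.freeMod (Option I) deg)
      (cone (0 : homZ 0 (hA.freeMod PUnit.{u + 1} fun _ => ((deg none).1 + 1, (deg none).2))
        (hA.freeMod I (deg ∘ some)))) := by
  refine hA.htpyEquiv_of_linearEquiv ((Finsupp.domLCongr (Equiv.optionEquivSumPUnit I)) ≪≫ₗ
    Finsupp.sumFinsuppLEquivProdFinsupp k)
    (fun x v hv => ⟨hA.mem_freeMod_gr.2 fun i hi => ?_, hA.mem_freeMod_gr.2 fun i hi => ?_⟩)
    (fun x v hv => hA.mem_freeMod_gr.2 fun i hi => ?_) (fun v => ?_)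
  · exact hA.mem_freeMod_gr.1 hv (some i) (by simpa using hi)
  · rw [hA.mem_freeMod_gr.1 hv none (by simpa using hi)]
  · obtain ⟨h1, h2⟩ := hv
    cases i with
    | none =>
      have := (hA.mem_freeMod_gr (deg := fun _ => ((deg none).1 + 1, (deg none).2))).1 h2
        PUnit.unit (by simpa using hi)
      simpa [Prod.ext_iff] using this
    | some i => exact hA.mem_freeMod_gr.1 h1 i (by simpa using hi)
  · simp

/-- Every line is obtained from the regular module by shifts, each cohomological shift contributing
-1 and each q-shift a power of q. -/
theorem cls_line (hA : A.IsBase) (x : ℤ × ℤ) :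
    K0.cls (hA.freeMod PUnit.{u + 1} fun _ => x) (hA.freeMod_isPerf _) =
      mono x • K0.cls (regular A) hA.regular_isPerf := by
  obtain ⟨p, q⟩ := x
  have hq := K0.cls_qshift q (hA.freeMod_isPerf fun _ : PUnit.{u + 1} => (p, 0))
    (hA.freeMod_isPerf _) (hA.freeMod_htpyEquiv_qshift q fun _ => (p, 0))
  simp only [zero_add] at hq
  have hs : ∀ p : ℤ, K0.cls _ (hA.freeMod_isPerf fun _ : PUnit.{u + 1} => (p, 0)) =
      -K0.cls _ (hA.freeMod_isPerf fun _ : PUnit.{u + 1} => (p + 1, 0)) := fun p =>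
    K0.cls_shift _ _ (hA.freeMod_htpyEquiv_shift fun _ : PUnit.{u + 1} => (p, 0))
  have hp : K0.cls _ (hA.freeMod_isPerf fun _ : PUnit.{u + 1} => (p, 0)) =
      mono (p, 0) • K0.cls (regular A) hA.regular_isPerf := by
    clear hq
    -- The shift relation between the lines in degrees p and p + 1 is used in both directions.
    induction p using Int.induction_on with
    | zero =>
      change _ = mono 0 • _
      rw [mono_zero, one_smul]
      exact K0.cls_congr _ _ hA.regular_htpyEquiv.symm
    | succ i ih =>
      rw [mono_succ, neg_smul, ← ih, hs i, neg_neg]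
    | pred i ih =>
      have e := mono_succ (-(i : ℤ) - 1) 0
      rw [sub_add_cancel] at e
      rw [hs, sub_add_cancel, ih, e, neg_smul, neg_neg]
  rw [hq, hp, smul_smul]
  congr 1
  rw [mono, mono, LaurentPolynomial.T_zero, mul_one, mul_comm]

theorem cls_freeMod (hA : A.IsBase) [Fintype I] (deg : I → ℤ × ℤ) :
    K0.cls (hA.freeMod I deg) (hA.freeMod_isPerf deg) =
      (∑ i, mono (deg i)) • K0.cls (regular A) hA.regular_isPerf := by
  revert deg
  refine Fintype.induction_empty_option (P := fun I _ => ∀ deg : I → ℤ × ℤ,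
    K0.cls (hA.freeMod I deg) (hA.freeMod_isPerf deg) =
      (∑ i, mono (deg i)) • K0.cls (regular A) hA.regular_isPerf)
    (fun I J _ e ih deg => ?_) (fun deg => ?_) (fun I _ ih deg => ?_) I
  · have := Finite.of_equiv J e.symm
    rw [K0.cls_congr _ (hA.freeMod_isPerf (deg ∘ e)) (hA.freeMod_htpyEquiv_equiv e deg)]
    refine (ih (deg ∘ e)).trans (congrArg (· • _) ?_)
    let := Fintype.ofEquiv J e.symm
    exact e.sum_comp fun i => mono (deg i)
  · rw [K0.cls_eq_zero (isContractible_of_subsingleton _)]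
    simp
  -- The triangle reads [rest] = [line one degree higher] + [whole]; the raised degree contributes
  -- the sign that moves the line to the other side.
  · have h := K0.cls_triangle (hA.freeMod_isPerf _) (hA.freeMod_isPerf _) (hA.freeMod_isPerf deg)
      ⟨_, _, _, .refl _, .refl _, hA.freeMod_option_htpyEquiv deg⟩
    rw [ih, cls_line, mono_succ] at h
    rw [Fintype.sum_option, add_smul]
    simp only [Function.comp_apply] at h
    rw [h]
    simp

/-- The Grothendieck group is free of rank one, via the Euler characteristic. -/
theorem exists_K0_equiv (hA : A.IsBase) :
    ∃ e : K0 A ≃ₗ[Zq] Zq, ∀ P hP, e (K0.cls P hP) = euler P := by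
  let F : (Perf A →₀ Zq) →ₗ[Zq] Zq := Finsupp.linearCombination Zq fun P : Perf A => euler P.1
  have hF : ∀ (P : Perf A) (c : Zq), F (Finsupp.single P c) = c * euler P.1 := fun P c =>
    Finsupp.linearCombination_single Zq c P
  -- The Euler characteristic respects the defining relations; finiteness of homology is needed only
  -- for triangles.
  have hle : Submodule.span Zq {x | K0Rel A x} ≤ LinearMap.ker F := by
    rw [Submodule.span_le]
    rintro _ (⟨P, P', h⟩ | ⟨P₁, P₂, P₃, h⟩ | ⟨n, P, P', h⟩)
    · change F _ = 0
      rw [map_add, hF, hF, h.euler_eq, euler_shift]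
      ring
    · change F _ = 0
      rw [map_sub, map_add, hF, hF, hF, h.euler_eq (hA.hasFiniteHlgy P₁.2)
        (hA.hasFiniteHlgy P₂.2) (hA.hasFiniteHlgy P₃.2)]
      ring
    · change F _ = 0
      rw [map_sub, hF, hF, h.euler_eq, euler_qshift]
      ring
  let E : K0 A →ₗ[Zq] Zq := Submodule.liftQ _ F hle
  have hE : ∀ P hP, E (K0.cls P hP) = euler P := fun P hP =>
    (hF ⟨P, hP⟩ 1).trans (one_mul _)
  -- The inverse sends 1 to [A]. One composite is the identity because χ(A) = 1, the other because
  -- [P] = χ(P)[A].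
  refine ⟨LinearEquiv.ofLinearMap E (LinearMap.toSpanSingleton Zq _
    (K0.cls (regular A) hA.regular_isPerf)) ?_ ?_, hE⟩
  · refine LinearMap.ext_ring ?_
    rw [LinearMap.comp_apply, LinearMap.toSpanSingleton_apply, one_smul, hE, hA.euler_regular]
    rfl
  · refine LinearMap.ext fun x => ?_
    refine K0.induction (p := fun x => (LinearMap.toSpanSingleton Zq _
      (K0.cls (regular A) hA.regular_isPerf) ∘ₗ E) x = LinearMap.id x) (by simp)
      (fun x y hx hy => by rw [map_add, map_add, hx, hy])
      (fun c x hx => by rw [map_smul, map_smul, hx]) (fun P hP => ?_) x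
    obtain ⟨I, _, deg, h⟩ := hA.exists_htpyEquiv_of_isPerf hP
    rw [LinearMap.comp_apply, hE, LinearMap.toSpanSingleton_apply, LinearMap.id_apply,
      K0.cls_congr hP (hA.freeMod_isPerf deg) h, cls_freeMod, h.euler_eq, euler_freeMod]

end DGAlg.IsBase

namespace DGMod

/-! ### Homotopies and outer tensor products -/

section Outer

variable {A B : DGAlg k} {P P' : DGMod A} {Q Q' : DGMod B}

theorem outer_map_mem {f : P.carrier →ₗ[k] P'.carrier} {g : Q.carrier →ₗ[k] Q'.carrier} {c : ℤ}
    (hf : ∀ x y, ∀ p ∈ P.gr x, ∀ q ∈ Q.gr y,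
      f p ⊗ₜ[k] g q ∈ (P'.outer Q').gr (x.1 + y.1 + c, x.2 + y.2))
    (p q : ℤ) (m : P.carrier ⊗[k] Q.carrier) (hm : m ∈ (P.outer Q).gr (p, q)) :
    TensorProduct.map f g m ∈ (P'.outer Q').gr (p + c, q) := by
  refine (Submodule.span_le (p := ((P'.outer Q').gr (p + c, q)).comap
    (TensorProduct.map f g))).2 ?_ hm
  rintro _ ⟨x, y, u, hu, v, hv, hxy, rfl⟩
  have := hf x y u hu v hv
  change x + y = (p, q) at hxy
  rw [← Prod.fst_add, ← Prod.snd_add, hxy] at this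
  exact this

/-- Both sides are additive in the algebra and module elements, so the graded linearity of a map
need only be checked on homogeneous pure tensors. -/
theorem outer_act_ext {n : ℤ} {F : P.carrier ⊗[k] Q.carrier →ₗ[k] P'.carrier ⊗[k] Q'.carrier}
    (h : ∀ i j x y, ∀ a ∈ A.gr i, ∀ b ∈ B.gr j, ∀ p ∈ P.gr x, ∀ q ∈ Q.gr y,
      F (outerAct P Q (DGAlg.tm A B a b) (p ⊗ₜ q)) =
        sg k (n * (i + j)) • outerAct P' Q' (DGAlg.tm A B a b) (F (p ⊗ₜ q)))
    (t : ℤ) (z : (A.tensor B).carrier) (hz : z ∈ (A.tensor B).gr t) (m : (P.outer Q).carrier) :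
    F ((P.outer Q).act z m) = sg k (n * t) • (P'.outer Q').act z (F m) := by
  refine DGAlg.tensorGrading_induction (p := fun z => F (outerAct P Q z m) =
      sg k (n * t) • outerAct P' Q' z (F m)) (by simp)
    (fun x y hx hy => by simp only [map_add, LinearMap.add_apply, hx, hy, smul_add])
    (fun c x hx => by simp only [map_smul, LinearMap.smul_apply, hx, smul_comm c])
    (fun i j hij a ha b hb => ?_) hz
  refine tensor_hom_induction P.internal Q.internal (p := fun m =>
      F (outerAct P Q (DGAlg.tm A B a b) m) =
        sg k (n * t) • outerAct P' Q' (DGAlg.tm A B a b) (F m)) (by simp)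
    (fun x y hx hy => by simp only [map_add, hx, hy, smul_add]) (fun x y p hp q hq => ?_) m
  rw [h i j x y a ha b hb p hp q hq, hij]

theorem outer_map_mem_homZ {f : P.carrier →ₗ[k] P'.carrier} {g : Q.carrier →ₗ[k] Q'.carrier}
    (hf : f ∈ homZ 0 P P') (hg : g ∈ homZ 0 Q Q') :
    TensorProduct.map f g ∈ homZ 0 (P.outer Q) (P'.outer Q') := by
  refine ⟨⟨outer_map_mem fun x y p hp q hq => tmul_mem_tensorGr (homZ_gr hf hp) (homZ_gr hg hq)
    (by rw [add_zero]; rfl), outer_act_ext fun i j x y a ha b hb p hp q hq => ?_⟩, ?_⟩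
  · rw [outerAct_tmul P Q a hb hp, map_smul, TensorProduct.map_tmul, TensorProduct.map_tmul,
      outerAct_tmul P' Q' a hb (homZ_gr hf hp), homZ_act hf, homZ_act hg, zero_mul, sg_zero,
      one_smul]
  · refine LinearMap.mem_ker.2 (outer_ext fun x y p hp q hq => ?_)
    rw [homD_apply, TensorProduct.map_tmul, tensorD_tmul _ _ _ _ (homZ_gr hf hp),
      tensorD_tmul _ _ _ _ hp, map_add, map_smul, TensorProduct.map_tmul, TensorProduct.map_tmul,
      homZ_comm hf, homZ_comm hg, sg_zero, one_smul, sub_self, LinearMap.zero_apply]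

/-- If s is a homotopy for f, then s ⊗ g is one for f ⊗ g. No extra sign occurs, because s acts on
the first factor: the two terms containing the differential of the second factor cancel. -/
theorem outer_map_mem_homB_left {f : P.carrier →ₗ[k] P'.carrier} {g : Q.carrier →ₗ[k] Q'.carrier}
    (hf : f ∈ homB 0 P P') (hg : g ∈ homZ 0 Q Q') :
    TensorProduct.map f g ∈ homB 0 (P.outer Q) (P'.outer Q') := by
  obtain ⟨s, hs, hsd⟩ := mem_homB_zero.1 hf
  refine mem_homB_zero.2 ⟨TensorProduct.map s g, ⟨outer_map_mem fun x y p hp q hq =>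
    tmul_mem_tensorGr (hs.1 x.1 x.2 p hp) (homZ_gr hg hq)
      (by ext <;> simp; ring), outer_act_ext fun i j x y a ha b hb p hp q hq => ?_⟩, fun m => ?_⟩
  · rw [outerAct_tmul P Q a hb hp, map_smul, TensorProduct.map_tmul, TensorProduct.map_tmul,
      outerAct_tmul P' Q' a hb (hs.1 x.1 x.2 p hp), hs.2 i a ha, homZ_act hg,
      ← TensorProduct.smul_tmul', smul_smul, smul_smul]
    congr 1
    simp only [sg_neg_one_mul, sg_add, mul_add, mul_neg, mul_one]
    have h1 : sg k (-j) = sg k j := by rw [← neg_one_mul, sg_neg_one_mul]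
    rw [h1]
    linear_combination (-(sg k i * sg k (j * x.1))) * sg_mul_self k j
  · refine LinearMap.congr_fun (f := TensorProduct.map f g)
      (g := (P'.outer Q').d ∘ₗ TensorProduct.map s g + TensorProduct.map s g ∘ₗ (P.outer Q).d)
      (outer_ext fun x y p hp q hq => ?_) m
    rw [LinearMap.add_apply, LinearMap.comp_apply, LinearMap.comp_apply, TensorProduct.map_tmul,
      TensorProduct.map_tmul, tensorD_tmul _ _ _ _ (hs.1 x.1 x.2 p hp), tensorD_tmul _ _ _ _ hp,
      map_add, map_smul, TensorProduct.map_tmul, TensorProduct.map_tmul, homZ_comm hg, hsd,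
      TensorProduct.add_tmul]
    change _ = _ + sg k (x.1 - 1) • _ + _
    rw [sg_pred]
    module

/-- Here the homotopy s has to pass the first tensor factor, so it acts by p ⊗ q ↦ (-1)^(deg p) f(p)
⊗ s(q). -/
theorem outer_map_mem_homB_right {f : P.carrier →ₗ[k] P'.carrier}
    {g : Q.carrier →ₗ[k] Q'.carrier} (hf : f ∈ homZ 0 P P') (hg : g ∈ homB 0 Q Q') :
    TensorProduct.map f g ∈ homB 0 (P.outer Q) (P'.outer Q') := by
  obtain ⟨s, hs, hsd⟩ := mem_homB_zero.1 hg
  -- The Koszul sign of moving s past p.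
  let e := gscale P.internal fun x => sg k x.1
  have he : ∀ x, ∀ p ∈ P.gr x, f (e p) = sg k x.1 • f p := fun x p hp => by
    rw [gscale_of_mem P.internal _ hp, map_smul]
  refine mem_homB_zero.2 ⟨TensorProduct.map (f.comp e) s, ⟨outer_map_mem fun x y p hp q hq => ?_,
    outer_act_ext fun i j x y a ha b hb p hp q hq => ?_⟩, fun m => ?_⟩
  · rw [LinearMap.comp_apply, he x p hp, ← TensorProduct.smul_tmul']
    exact Submodule.smul_mem _ _ (tmul_mem_tensorGr (homZ_gr hf hp) (hs.1 y.1 y.2 q hq)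
      (by ext <;> simp; ring))
  · obtain ⟨x1, x2⟩ := x
    rw [outerAct_tmul P Q a hb hp, map_smul, TensorProduct.map_tmul, TensorProduct.map_tmul,
      LinearMap.comp_apply, LinearMap.comp_apply, he _ _ (P.act_mem ha hp), he _ _ hp,
      ← TensorProduct.smul_tmul', ← TensorProduct.smul_tmul', map_smul,
      outerAct_tmul P' Q' a hb (homZ_gr hf hp), hs.2 j b hb, homZ_act hf,
      TensorProduct.tmul_smul, smul_smul, smul_smul, smul_smul, smul_smul]
    congr 1
    simp only [sg_neg_one_mul, sg_add]
    ring
  · refine LinearMap.congr_fun (f := TensorProduct.map f g)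
      (g := (P'.outer Q').d ∘ₗ TensorProduct.map (f.comp e) s +
        TensorProduct.map (f.comp e) s ∘ₗ (P.outer Q).d)
      (outer_ext fun x y p hp q hq => ?_) m
    obtain ⟨x1, x2⟩ := x
    rw [LinearMap.add_apply, LinearMap.comp_apply, LinearMap.comp_apply, TensorProduct.map_tmul,
      TensorProduct.map_tmul, tensorD_tmul _ _ _ _ hp, LinearMap.comp_apply, he _ _ hp,
      ← TensorProduct.smul_tmul', map_smul, tensorD_tmul _ _ _ _ (homZ_gr hf hp),
      map_add, map_smul, TensorProduct.map_tmul, TensorProduct.map_tmul, LinearMap.comp_apply,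
      LinearMap.comp_apply, he _ _ (P.d_mem hp), he _ _ hp, homZ_comm hf, hsd,
      TensorProduct.tmul_add, ← TensorProduct.smul_tmul', ← TensorProduct.smul_tmul', smul_add,
      smul_smul, smul_smul, sg_mul_self, one_smul, one_smul, sg_succ]
    module

/-- One factor is changed at a time: f'f ⊗ g'g - 1 is the sum of (f'f - 1) ⊗ g'g and 1 ⊗ (g'g - 1).
-/
theorem HtpyEquiv.outer (hP : HtpyEquiv P P') (hQ : HtpyEquiv Q Q') :
    HtpyEquiv (P.outer Q) (P'.outer Q') := by
  obtain ⟨f, hf, f', hf', h1, h2⟩ := hP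
  obtain ⟨g, hg, g', hg', h3, h4⟩ := hQ
  refine ⟨_, outer_map_mem_homZ hf hg, _, outer_map_mem_homZ hf' hg', ?_, ?_⟩
  · have := Submodule.add_mem _ (outer_map_mem_homB_left h1 (comp_mem_homZ hg' hg))
      (outer_map_mem_homB_right (id_mem_homZ P) h3)
    convert this using 1
    refine TensorProduct.ext' fun p q => ?_
    simp [TensorProduct.sub_tmul, TensorProduct.tmul_sub]
  · have := Submodule.add_mem _ (outer_map_mem_homB_left h2 (comp_mem_homZ hg hg'))
      (outer_map_mem_homB_right (id_mem_homZ P') h4)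
    convert this using 1
    refine TensorProduct.ext' fun p q => ?_
    simp [TensorProduct.sub_tmul, TensorProduct.tmul_sub]

theorem IsContractible.outer_left (h : P.IsContractible) (Q : DGMod B) :
    (P.outer Q).IsContractible := by
  have := outer_map_mem_homB_left h (id_mem_homZ Q)
  rwa [TensorProduct.map_id] at this

theorem IsContractible.outer_right (P : DGMod A) (h : Q.IsContractible) :
    (P.outer Q).IsContractible := by
  have := outer_map_mem_homB_right (id_mem_homZ P) h
  rwa [TensorProduct.map_id] at this

end Outer

/-! ### Restriction and extension of scalars -/

section Restrict

variable {A C : DGAlg k} (φ : DGHom A C) {M N : DGMod C}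

theorem restrict_mem_homZ {f : M.carrier →ₗ[k] N.carrier} (hf : f ∈ homZ 0 M N) :
    f ∈ homZ 0 (restrict φ M) (restrict φ N) :=
  mem_homZ_zero (fun _ _ hm => homZ_gr hf hm) (fun _ m => homZ_act hf _ m)
    fun m => homZ_comm (M := M) (N := N) hf m

theorem restrict_mem_homB {f : M.carrier →ₗ[k] N.carrier} (hf : f ∈ homB 0 M N) :
    f ∈ homB 0 (restrict φ M) (restrict φ N) := by
  obtain ⟨s, hs, hsd⟩ := mem_homB_zero.1 hf
  exact mem_homB_zero.2 ⟨s, ⟨hs.1, fun i a ha m => hs.2 i _ (φ.map_mem ha) m⟩, hsd⟩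

theorem HtpyEquiv.restrict (h : HtpyEquiv M N) : HtpyEquiv (restrict φ M) (restrict φ N) := by
  obtain ⟨f, hf, g, hg, h1, h2⟩ := h
  exact ⟨f, restrict_mem_homZ φ hf, g, restrict_mem_homZ φ hg, restrict_mem_homB φ h1,
    restrict_mem_homB φ h2⟩

theorem IsContractible.restrict (h : M.IsContractible) : (restrict φ M).IsContractible :=
  restrict_mem_homB φ h

end Restrict

section Extend

variable {A C : DGAlg k} (φ : DGHom A C) (M : DGMod A)

/-- The canonical map `M → C ⊗_A M`. -/
def toExtend : M.carrier →ₗ[k] (extend φ M).carrier :=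
  (extRel φ M).mkQ.comp (TensorProduct.mk k C.carrier M.carrier 1)

theorem extend_mk (c : C.carrier) (m : M.carrier) :
    (extRel φ M).mkQ (c ⊗ₜ m) = (extend φ M).act c (toExtend φ M m) := by
  change _ = (extRel φ M).mkQ ((c * 1) ⊗ₜ m)
  rw [mul_one]

theorem toExtend_act (a : A.carrier) (m : M.carrier) :
    toExtend φ M (M.act a m) = (extend φ M).act (φ.toAlgHom a) (toExtend φ M m) := by
  rw [← extend_mk]
  have h := rel_mem_extRel φ M 1 a m
  rw [one_mul] at h
  exact ((Submodule.Quotient.eq _).2 h).symm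

theorem toExtend_mem {x : ℤ × ℤ} {m : M.carrier} (hm : m ∈ M.gr x) :
    toExtend φ M m ∈ (extend φ M).gr x :=
  Submodule.mem_map_of_mem (tmul_mem_tensorGr C.one_mem hm (by simp))

theorem d_toExtend (m : M.carrier) : (extend φ M).d (toExtend φ M m) = toExtend φ M (M.d m) := by
  change (extRel φ M).mkQ (tensorD C.internal (sg k) C.d M.d (1 ⊗ₜ m)) = _
  rw [tensorD_tmul _ _ _ _ C.one_mem, C.d_one, TensorProduct.zero_tmul, zero_add, sg_zero, one_smul]
  rfl

variable {φ M} {N : DGMod C}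

/-- The map `c ⊗ m ↦ (-1) ^ (n * deg c) c s(m)` induced by a homogeneous map `s` of degree `n`. -/
def extendHom {n : ℤ} {s : M.carrier →ₗ[k] N.carrier} (hs : s ∈ homDeg n M (restrict φ N)) :
    (extend φ M).carrier →ₗ[k] N.carrier :=
  (extRel φ M).liftQ (TensorProduct.lift
      ((LinearMap.lcomp k N.carrier s).comp (N.act.comp (C.epsPow n)).toLinearMap)) (by
    refine extRel_le φ M fun i j x c hc a ha m hm => ?_
    rw [LinearMap.mem_ker, map_sub, sub_eq_zero, TensorProduct.lift.tmul, TensorProduct.lift.tmul]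
    change N.act (C.epsPow n (c * φ.toAlgHom a)) (s m) = N.act (C.epsPow n c) (s (M.act a m))
    rw [hs.2 j a ha m, map_mul, C.epsPow_of_mem n (φ.map_mem ha), map_mul, map_smul, map_smul,
      mul_comm j n, mul_smul_comm]
    rfl)

theorem extendHom_mk {n : ℤ} {s : M.carrier →ₗ[k] N.carrier}
    (hs : s ∈ homDeg n M (restrict φ N)) {i : ℤ} {c : C.carrier} (hc : c ∈ C.gr i)
    (m : M.carrier) :
    extendHom hs ((extRel φ M).mkQ (c ⊗ₜ m)) = sg k (i * n) • N.act c (s m) := by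
  change N.act (C.epsPow n c) (s m) = _
  rw [C.epsPow_of_mem n hc, map_smul, LinearMap.smul_apply]

theorem extend_hom_ext {V : Type*} [AddCommGroup V] [Module k V]
    {f g : (extend φ M).carrier →ₗ[k] V}
    (h : ∀ i x, ∀ c ∈ C.gr i, ∀ m ∈ M.gr x,
      f ((extRel φ M).mkQ (c ⊗ₜ m)) = g ((extRel φ M).mkQ (c ⊗ₜ m))) : f = g := by
  refine Submodule.linearMap_qext _ (TensorProduct.ext ?_)
  exact LOTCat.hom_ext C.internal fun i c hc => LOTCat.hom_ext M.internal fun x m hm =>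
    h i x c hc m hm

theorem extendHom_mem {n : ℤ} {s : M.carrier →ₗ[k] N.carrier}
    (hs : s ∈ homDeg n M (restrict φ N)) : extendHom hs ∈ homDeg n (extend φ M) N := by
  refine ⟨fun p q z hz => ?_, fun i c hc z => ?_⟩
  · obtain ⟨z, hz, rfl⟩ := hz
    refine (Submodule.span_le (p := (N.gr (p + n, q)).comap
      ((extendHom hs).comp (extRel φ M).mkQ))).2 ?_ hz
    rintro _ ⟨i, ⟨x1, x2⟩, c, hc, m, hm, hx, rfl⟩
    obtain ⟨rfl, rfl⟩ := Prod.mk.inj hx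
    rw [SetLike.mem_coe, Submodule.mem_comap, LinearMap.comp_apply, extendHom_mk hs hc]
    have := N.act_mem hc (hs.1 _ _ m hm)
    rw [← add_assoc] at this
    exact Submodule.smul_mem _ _ this
  · refine LinearMap.congr_fun (f := (extendHom hs).comp ((extend φ M).act c))
      (g := sg k (n * i) • (N.act c).comp (extendHom hs))
      (extend_hom_ext fun j x c' hc' m hm => ?_) z
    rw [LinearMap.comp_apply, LinearMap.smul_apply, LinearMap.comp_apply, extendHom_mk hs hc']
    change extendHom hs ((extRel φ M).mkQ ((c * c') ⊗ₜ m)) = _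
    rw [extendHom_mk hs (C.mul_mem hc hc'), map_mul, Module.End.mul_apply, map_smul, smul_smul,
      add_mul, sg_add, mul_comm n i]

/-- This is the adjunction between extension and restriction at the level of Hom complexes. A
cocycle on C ⊗ P is determined by its restriction to P, and restricting the target does not affect
acyclicity, so a primitive exists on P and extends C-linearly up to sign. -/
theorem IsProjective.extend {P : DGMod A} (hP : P.IsProjective) (φ : DGHom A C) :
    (extend φ P).IsProjective := by
  intro N hN n f hf
  have hfd : ∀ m, N.d (f m) = sg k n • f ((DGMod.extend φ P).d m) := fun m => by
    have := LinearMap.congr_fun (LinearMap.mem_ker.1 hf.2) m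
    rwa [homD_apply, LinearMap.zero_apply, sub_eq_zero] at this
  have h1 : f.comp (toExtend φ P) ∈ homZ n P (restrict φ N) := by
    refine ⟨⟨fun p q m hm => hf.1.1 p q _ (toExtend_mem φ P hm), fun i a ha m => ?_⟩, ?_⟩
    · rw [LinearMap.comp_apply, toExtend_act, hf.1.2 i _ (φ.map_mem ha)]
      rfl
    · refine LinearMap.mem_ker.2 (LinearMap.ext fun m => ?_)
      rw [homD_apply, LinearMap.comp_apply, LinearMap.comp_apply, LinearMap.zero_apply, sub_eq_zero,
        ← d_toExtend]
      exact hfd _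
  -- A primitive s of the cocycle restricted to P. Its extension c ⊗ m ↦ ± c s(m) is compared with f
  -- on generators via the Leibniz rule; what remains is the bookkeeping of signs.
  obtain ⟨s, hs, hsd⟩ := hP (restrict φ N) hN n h1
  refine ⟨extendHom hs, extendHom_mem hs, extend_hom_ext fun i x c hc m hm => ?_⟩
  have e := LinearMap.congr_fun hsd m
  rw [homD_apply, LinearMap.comp_apply] at e
  rw [homD_apply, extendHom_mk hs hc]
  have h2 : (DGMod.extend φ P).d ((extRel φ P).mkQ (c ⊗ₜ m)) =
      (extRel φ P).mkQ (C.d c ⊗ₜ m) + sg k i • (extRel φ P).mkQ (c ⊗ₜ P.d m) := by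
    change (extRel φ P).mkQ (tensorD C.internal (sg k) C.d P.d (c ⊗ₜ m)) = _
    rw [tensorD_tmul _ _ _ _ hc, map_add, map_smul]
  rw [h2, map_add, map_smul, map_smul, extendHom_mk hs (C.d_mem hc), extendHom_mk hs hc,
    N.leibniz hc, extend_mk, hf.1.2 i c hc, ← e, map_sub, map_smul]
  change _ = sg k (n * i) • (N.act c (N.d (s m)) - _)
  have h3 : sg k (i * (n - 1)) = sg k (n * i) * sg k i := by
    have := sg_mul_succ (k := k) (n - 1) i
    rw [sub_add_cancel] at this
    rw [mul_comm n i, this, mul_assoc, sg_mul_self, mul_one]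
  have h4 : sg k ((i + 1) * (n - 1)) = sg k (n * i) * sg k i * sg k (n - 1) := by
    rw [add_mul, one_mul, sg_add, h3]
  rw [h4, h3]
  have hi := sg_mul_self k i
  have hn := sg_mul_self k (n - 1)
  match_scalars
  · linear_combination (-(sg k (n * i) * sg k i)) * hn
  · linear_combination (sg k (n * i)) * hi
  · linear_combination (-(sg k (n * i) * sg k (n - 1))) * hi

end Extend

end DGMod

/-! ### Tensor products, restriction and extension in the two cases of the dichotomy. -/

namespace DGAlg

open DGMod

variable {A B C : DGAlg k}

/-- If d s = 1 then d(s ⊗ 1) = 1 ⊗ 1. -/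
theorem IsAcyc.tensor_left (hA : A.IsAcyc) (B : DGAlg k) : (A.tensor B).IsAcyc := by
  obtain ⟨s, hs, hd⟩ := hA
  refine ⟨tm A B s 1, tm_mem hs B.one_mem (by norm_num), ?_⟩
  rw [tensorDiff_tm hs, hd, B.d_one, tm_zero_right, smul_zero, add_zero]
  rfl

theorem IsAcyc.tensor_right (A : DGAlg k) (hB : B.IsAcyc) : (A.tensor B).IsAcyc := by
  obtain ⟨s, hs, hd⟩ := hB
  refine ⟨tm A B 1 s, tm_mem A.one_mem hs (by norm_num), ?_⟩
  rw [tensorDiff_tm A.one_mem, hd, A.d_one, tm_zero_left, sg_zero, one_smul, zero_add]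
  rfl

namespace IsBase

theorem tensor (hA : A.IsBase) (hB : B.IsBase) : (A.tensor B).IsBase := by
  refine ⟨?_, fun z => ?_⟩
  -- A linear functional with value 1 on the unit shows that scalars embed.
  · let F : GradedTensorProduct k A.gr B.gr →ₗ[k] k :=
      (TensorProduct.lid k k).toLinearMap ∘ₗ
        TensorProduct.map hA.equiv.symm.toLinearMap hB.equiv.symm.toLinearMap ∘ₗ
          (GradedTensorProduct.of k A.gr B.gr).symm.toLinearMap
    have hF : F 1 = 1 := by
      change hA.equiv.symm 1 • hB.equiv.symm 1 = 1
      rw [map_one, map_one, smul_eq_mul, mul_one]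
    intro c c' h
    have := congrArg F h
    rw [Algebra.algebraMap_eq_smul_one, Algebra.algebraMap_eq_smul_one, map_smul, map_smul,
      hF] at this
    simpa using this
  · refine tm_induction (p := fun z => ∃ c, algebraMap k (GradedTensorProduct k A.gr B.gr) c = z)
      ⟨0, map_zero _⟩ ?_ (fun i j a _ b _ => ?_) z
    · rintro _ _ ⟨c, rfl⟩ ⟨c', rfl⟩
      exact ⟨c + c', map_add _ _ _⟩
    · obtain ⟨c, rfl⟩ := hA.exists_smul_one a
      obtain ⟨c', rfl⟩ := hB.exists_smul_one b
      refine ⟨c * c', ?_⟩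
      rw [tm_smul_left, tm_smul_right, smul_smul, Algebra.algebraMap_eq_smul_one]
      rfl

theorem isPerf_congr (hA : A.IsBase) {P P' : DGMod A} (h : HtpyEquiv P P')
    (hP : P'.IsPerf) : P.IsPerf := by
  obtain ⟨I, _, deg, h'⟩ := hA.exists_htpyEquiv_of_isPerf hP
  exact hA.isPerf_of_htpyEquiv (h.trans h')

theorem freeMod_outer (hA : A.IsBase) (hB : B.IsBase) {I J : Type u} (deg : I → ℤ × ℤ)
    (deg' : J → ℤ × ℤ) : HtpyEquiv ((hA.freeMod I deg).outer (hB.freeMod J deg'))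
      ((hA.tensor hB).freeMod (I × J) fun x => deg x.1 + deg' x.2) := by
  refine (hA.tensor hB).htpyEquiv_of_linearEquiv (finsuppTensorFinsupp' k I J)
    (fun x z hz => ?_) (fun x v hv => ?_) (fun z => ?_)
  · refine (Submodule.span_le (p := Submodule.comap (finsuppTensorFinsupp' k I J).toLinearMap
      (((hA.tensor hB).freeMod (I × J) fun x => deg x.1 + deg' x.2).gr x))).2 ?_ hz
    rintro _ ⟨y, y', v, hv, w, hw, rfl, rfl⟩
    refine ((hA.tensor hB).mem_freeMod_gr (deg := fun x : I × J => deg x.1 + deg' x.2)).2 ?_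
    rintro ⟨i, j⟩ hij
    rw [LinearEquiv.coe_coe, finsuppTensorFinsupp'_apply_apply] at hij
    rw [hA.mem_freeMod_gr.1 hv i (left_ne_zero_of_mul hij),
      hB.mem_freeMod_gr.1 hw j (right_ne_zero_of_mul hij)]
  · refine (hA.tensor hB).freeMod_gr_le (S := Submodule.comap
      (finsuppTensorFinsupp' k I J).symm.toLinearMap
      (((hA.freeMod I deg).outer (hB.freeMod J deg')).gr x)) ?_ hv
    rintro ⟨i, j⟩ rfl
    rw [Submodule.mem_comap, LinearEquiv.coe_coe,
      finsuppTensorFinsupp'_symm_single_eq_single_one_tmul]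
    exact tmul_mem_tensorGr (Finsupp.single_mem_supported k 1 rfl)
      (Finsupp.single_mem_supported k 1 rfl) rfl
  · have : ((hA.freeMod I deg).outer (hB.freeMod J deg')).d = 0 :=
      outer_ext fun x y p hp q hq => by rw [tensorD_tmul _ _ _ _ hp]; simp
    rw [this]
    simp

theorem outer_isPerf (hA : A.IsBase) (hB : B.IsBase) {P : DGMod A} {Q : DGMod B}
    (hP : P.IsPerf) (hQ : Q.IsPerf) : (P.outer Q).IsPerf := by
  obtain ⟨I, _, deg, h⟩ := hA.exists_htpyEquiv_of_isPerf hP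
  obtain ⟨J, _, deg', h'⟩ := hB.exists_htpyEquiv_of_isPerf hQ
  exact (hA.tensor hB).isPerf_of_htpyEquiv ((h.outer h').trans (hA.freeMod_outer hB deg deg'))

theorem euler_outer (hA : A.IsBase) (hB : B.IsBase) {P : DGMod A} {Q : DGMod B}
    (hP : P.IsPerf) (hQ : Q.IsPerf) : euler (P.outer Q) = euler P * euler Q := by
  obtain ⟨I, _, deg, h⟩ := hA.exists_htpyEquiv_of_isPerf hP
  obtain ⟨J, _, deg', h'⟩ := hB.exists_htpyEquiv_of_isPerf hQ
  rw [((h.outer h').trans (hA.freeMod_outer hB deg deg')).euler_eq, h.euler_eq, h'.euler_eq,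
    euler_freeMod, euler_freeMod, euler_freeMod, Fintype.sum_prod_type, Finset.sum_mul_sum]
  simp only [mono_add]

theorem restrict_isPerf (hA : A.IsBase) (hC : C.IsBase) (φ : DGHom A C) {P : DGMod C}
    (hP : P.IsPerf) : (restrict φ P).IsPerf := by
  obtain ⟨I, _, deg, h⟩ := hC.exists_htpyEquiv_of_isPerf hP
  exact hA.isPerf_of_htpyEquiv ((h.restrict φ).trans (hA.htpyEquiv_of_linearEquiv
    (N := hA.freeMod I deg) (LinearEquiv.refl k _) (fun _ _ h => h) (fun _ _ h => h) fun _ => rfl))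

/-- The homomorphism between two dg algebras which are equal to the base field. -/
def toBase (hC : C.IsBase) (hA : A.IsBase) : DGHom C A where
  toAlgHom := (Algebra.ofId k A.carrier).comp hC.equiv.symm.toAlgHom
  map_mem := by
    intro i c hc
    by_cases hi : i = 0
    · subst hi; exact hA.mem_zero _
    · rw [hC.eq_zero_of_mem hi hc, map_zero]; exact Submodule.zero_mem _
  map_d c := by rw [hC.d_eq_zero, hA.d_eq_zero, map_zero]

/-- When both algebras are the base field, m ↦ 1 ⊗ m is an isomorphism of complexes. The C-action on
M is obtained through the unique identification of C with A. -/
theorem extend_htpyEquiv (hA : A.IsBase) (hC : C.IsBase) (φ : DGHom A C) (M : DGMod A) :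
    HtpyEquiv (extend φ M) (restrict (hC.toBase hA) M) := by
  let F : (extend φ M).carrier →ₗ[k] M.carrier := (extRel φ M).liftQ
    (TensorProduct.lift ((LinearMap.lsmul k M.carrier).comp hC.equiv.symm.toLinearMap)) (by
      refine Submodule.span_le.2 ?_
      rintro _ ⟨c, a, m, rfl⟩
      obtain ⟨r, rfl⟩ := hA.exists_smul_one a
      change _ = _
      simp [smul_smul])
  have hF : ∀ c m, F ((extRel φ M).mkQ (c ⊗ₜ m)) = hC.equiv.symm c • m := fun c m => rfl
  have hF1 : ∀ m, F (toExtend φ M m) = m := fun m => by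
    refine (hF 1 m).trans ?_
    rw [map_one, one_smul]
  have hF2 : ∀ z, toExtend φ M (F z) = z := fun z => by
    refine LinearMap.congr_fun (f := (toExtend φ M).comp F) (g := LinearMap.id)
      (extMk_ext φ M fun c m => ?_) z
    obtain ⟨r, rfl⟩ := hC.exists_smul_one c
    rw [LinearMap.comp_apply, hF, map_smul, map_smul, map_one, smul_eq_mul, mul_one,
      ← TensorProduct.smul_tmul', map_smul]
    rfl
  refine (hC.htpyEquiv_of_linearEquiv (M := restrict (hC.toBase hA) M) (N := extend φ M)
    (LinearEquiv.ofLinearMap (toExtend φ M) F (LinearMap.ext hF2) (LinearMap.ext hF1))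
    (fun x m hm => toExtend_mem φ M hm) (fun x z hz => ?_) (fun m => d_toExtend φ M m)).symm
  obtain ⟨z, hz, rfl⟩ := hz
  refine (Submodule.span_le (p := (M.gr x).comap (F.comp (extRel φ M).mkQ))).2 ?_ hz
  rintro _ ⟨i, y, c, hc, m, hm, hx, rfl⟩
  rw [SetLike.mem_coe, Submodule.mem_comap, LinearMap.comp_apply, hF]
  by_cases hi : i = 0
  · subst hi
    have hyx : y = x := by rw [← hx]; simp
    exact Submodule.smul_mem _ _ (hyx ▸ hm)
  · rw [hC.eq_zero_of_mem hi hc, map_zero, zero_smul]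
    exact Submodule.zero_mem _

theorem extend_isPerf (hA : A.IsBase) (hC : C.IsBase) (φ : DGHom A C) {P : DGMod A}
    (hP : P.IsPerf) : (extend φ P).IsPerf :=
  hC.isPerf_congr (hA.extend_htpyEquiv hC φ P) (hC.restrict_isPerf hA _ hP)

theorem euler_extend (hA : A.IsBase) (hC : C.IsBase) (φ : DGHom A C) (P : DGMod A) :
    euler (extend φ P) = euler P :=
  (hA.extend_htpyEquiv hC φ P).euler_eq

end IsBase

end DGAlg

theorem K0.hom_ext {A : DGAlg k} {V : Type*} [AddCommGroup V] [Module Zq V] {f g : K0 A →ₗ[Zq] V}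
    (h : ∀ P hP, f (K0.cls P hP) = g (K0.cls P hP)) : f = g :=
  LinearMap.ext <| K0.induction (by simp) (fun x y hx hy => by rw [map_add, map_add, hx, hy])
    (fun c x hx => by rw [map_smul, map_smul, hx]) h

/-! ### The algebras `H⁻ₙ` -/

/-- There are no generators: the empty word spans, and the algebra map to 𝕜 given by the universal
property separates scalars. -/
theorem LOT_isBase {n : ℕ} (hn : n ≤ 1) : (LOT k n).IsBase := by
  have hE : IsEmpty (LIdx n) := ⟨fun i => by have := i.2; omega⟩
  refine ⟨?_, fun x => ?_⟩
  · let F : LOTAlg k n →ₐ[k] k := LOTlift k (fun i => hE.elim i) (fun i => hE.elim i)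
      (fun i => hE.elim i) (fun i => hE.elim i)
    intro c c' h
    have := congrArg F h
    exact (F.commutes c).symm.trans (this.trans (F.commutes c'))
  · have h : Submodule.span k (Set.range (word k (n := n))) ≤
        LinearMap.range (Algebra.linearMap k (LOTAlg k n)) := by
      rw [Submodule.span_le]
      rintro _ ⟨l, rfl⟩
      cases l with
      | nil => exact ⟨1, map_one (algebraMap k (LOTAlg k n))⟩
      | cons i l => exact hE.elim i
    exact h (LOT_span k x)

theorem LOT_isAcyc {n : ℕ} (hn : 2 ≤ n) : (LOT k n).IsAcyc := by
  have h := word_mem k [(⟨0, by omega⟩ : LIdx n)]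
  rw [word_cons, word_nil, mul_one] at h
  exact ⟨_, h, LOTd_sig k _⟩

theorem regular_LOT_isPerf (n : ℕ) : (DGMod.regular (LOT k n)).IsPerf := by
  rcases Nat.lt_or_ge 1 n with hn | hn
  · exact (LOT_isAcyc hn).regular_isContractible.isPerf
  · exact (LOT_isBase hn).regular_isPerf

/-! ### Induction, restriction and outer tensor products on Grothendieck groups. -/

section

variable {n m N : ℕ}

theorem outer_isPerf {P : DGMod (LOT k n)} {Q : DGMod (LOT k m)} (hP : P.IsPerf) (hQ : Q.IsPerf) :
    (P.outer Q).IsPerf := by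
  rcases Nat.lt_or_ge 1 n with hn | hn
  · exact (((LOT_isAcyc hn).isContractible hP.1).outer_left Q).isPerf
  rcases Nat.lt_or_ge 1 m with hm | hm
  · exact (((LOT_isAcyc hm).isContractible hQ.1).outer_right P).isPerf
  exact (LOT_isBase hn).outer_isPerf (LOT_isBase hm) hP hQ

/-- The split is on N rather than on n and m, since for n = m = 1 the source is the base field while
H⁻₂ is not. For N ≥ 2 projectivity alone suffices, because it implies contractibility. -/
theorem Ind_isPerf (h : n + m = N) {P : DGMod (LOT k n)} {Q : DGMod (LOT k m)} (hP : P.IsPerf)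
    (hQ : Q.IsPerf) : (Ind h P Q).IsPerf := by
  rcases Nat.lt_or_ge 1 N with hN | hN
  · exact (LOT_isAcyc hN).isPerf ((outer_isPerf hP hQ).1.extend _)
  · exact ((LOT_isBase (by omega)).tensor (LOT_isBase (by omega))).extend_isPerf (LOT_isBase hN) _
      (outer_isPerf hP hQ)

theorem Res_isPerf (h : n + m = N) {P : DGMod (LOT k N)} (hP : P.IsPerf) :
    (Res (n := n) (m := m) h P).IsPerf := by
  rcases Nat.lt_or_ge 1 N with hN | hN
  · exact (((LOT_isAcyc hN).isContractible hP.1).restrict _).isPerf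
  · exact ((LOT_isBase (by omega)).tensor (LOT_isBase (by omega))).restrict_isPerf (LOT_isBase hN) _
      hP

theorem euler_Ind (h : n + m = N) (hN : N ≤ 1) {P : DGMod (LOT k n)} {Q : DGMod (LOT k m)}
    (hP : P.IsPerf) (hQ : Q.IsPerf) : (Ind h P Q).euler = P.euler * Q.euler := by
  have hn : (LOT k n).IsBase := LOT_isBase (by omega)
  have hm : (LOT k m).IsBase := LOT_isBase (by omega)
  rw [← hn.euler_outer hm hP hQ]
  exact (hn.tensor hm).euler_extend (LOT_isBase hN) _ _

theorem subsingleton_K0_tensor (h : 2 ≤ n ∨ 2 ≤ m) :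
    Subsingleton (K0 ((LOT k n).tensor (LOT k m))) := by
  rcases h with h | h
  · exact ((LOT_isAcyc h).tensor_left _).subsingleton_K0
  · exact (DGAlg.IsAcyc.tensor_right _ (LOT_isAcyc h)).subsingleton_K0

variable (k n) in
theorem exists_eulerMap : ∃ E : K0 (LOT k n) →ₗ[Zq] Zq, n ≤ 1 →
    Function.Bijective E ∧ ∀ P hP, E (K0.cls P hP) = P.euler := by
  rcases Nat.lt_or_ge 1 n with hn | hn
  · exact ⟨0, fun h => by omega⟩
  · obtain ⟨e, he⟩ := (LOT_isBase (k := k) hn).exists_K0_equiv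
    exact ⟨e.toLinearMap, fun _ => ⟨e.bijective, he⟩⟩

/-- For N ≤ 1 the map is multiplication in ℤ[q, q⁻¹] transported through Euler characteristics, so
well-definedness on classes needs no separate check that triangles are preserved. For N ≥ 2 the
target is zero. -/
theorem exists_indMap (h : n + m = N) :
    ∃ F : K0 (LOT k n) →ₗ[Zq] K0 (LOT k m) →ₗ[Zq] K0 (LOT k N), ∀ P Q hP hQ,
      F (K0.cls P hP) (K0.cls Q hQ) = K0.cls (Ind h P Q) (Ind_isPerf h hP hQ) := by
  rcases Nat.lt_or_ge 1 N with hN | hN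
  · have := (LOT_isAcyc (k := k) hN).subsingleton_K0
    exact ⟨0, fun _ _ _ _ => Subsingleton.elim _ _⟩
  · obtain ⟨e₁, he₁⟩ := (LOT_isBase (k := k) (n := n) (by omega)).exists_K0_equiv
    obtain ⟨e₂, he₂⟩ := (LOT_isBase (k := k) (n := m) (by omega)).exists_K0_equiv
    obtain ⟨e, he⟩ := (LOT_isBase (k := k) hN).exists_K0_equiv
    refine ⟨((LinearMap.mul Zq Zq).compl₁₂ e₁.toLinearMap e₂.toLinearMap).compr₂
      e.symm.toLinearMap, fun P Q hP hQ => e.injective ?_⟩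
    rw [he, euler_Ind h hN hP hQ]
    simp [he₁, he₂]

variable (k n m) in
-- Either one factor has a null-homologous unit and both sides vanish, or both sides are ℤ[q, q⁻¹]
-- and the isomorphism multiplies Euler characteristics.
theorem exists_outerEquiv :
    ∃ X : (K0 (LOT k n) ⊗[Zq] K0 (LOT k m)) ≃ₗ[Zq] K0 ((LOT k n).tensor (LOT k m)),
      ∀ P Q hP hQ, X (K0.cls P hP ⊗ₜ[Zq] K0.cls Q hQ) =
        K0.cls (P.outer Q) (outer_isPerf hP hQ) := by
  by_cases h : 2 ≤ n ∨ 2 ≤ m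
  · have := subsingleton_K0_tensor (k := k) h
    have : Subsingleton (K0 (LOT k n) ⊗[Zq] K0 (LOT k m)) := by
      refine subsingleton_of_forall_eq 0 fun z => ?_
      induction z using TensorProduct.induction_on with
      | zero => rfl
      | add x y hx hy => rw [hx, hy, add_zero]
      | tmul x y =>
        rcases h with h | h
        · have := (LOT_isAcyc (k := k) h).subsingleton_K0
          rw [Subsingleton.elim x 0, TensorProduct.zero_tmul]
        · have := (LOT_isAcyc (k := k) h).subsingleton_K0
          rw [Subsingleton.elim y 0, TensorProduct.tmul_zero]
    exact ⟨0, fun _ _ _ _ => Subsingleton.elim _ _⟩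
  · have hn : (LOT k n).IsBase := LOT_isBase (by omega)
    have hm : (LOT k m).IsBase := LOT_isBase (by omega)
    obtain ⟨e₁, he₁⟩ := hn.exists_K0_equiv
    obtain ⟨e₂, he₂⟩ := hm.exists_K0_equiv
    obtain ⟨e, he⟩ := (hn.tensor hm).exists_K0_equiv
    refine ⟨TensorProduct.congr e₁ e₂ ≪≫ₗ TensorProduct.lid Zq Zq ≪≫ₗ e.symm,
      fun P Q hP hQ => e.injective ?_⟩
    rw [he, hn.euler_outer hm hP hQ]
    simp [he₁, he₂]

variable (n m) in
-- For N ≥ 2 the target may be nonzero, as for H⁻₁ ⊗ H⁻₁, but the restricted modules are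
-- contractible, so the zero map is correct. For N ≤ 1 restriction keeps the underlying complex and
-- hence its Euler characteristic.
theorem exists_resMap (h : n + m = N) :
    ∃ D : K0 (LOT k N) →ₗ[Zq] K0 ((LOT k n).tensor (LOT k m)), ∀ P hP,
      D (K0.cls P hP) = K0.cls (Res h P) (Res_isPerf h hP) := by
  rcases Nat.lt_or_ge 1 N with hN | hN
  · exact ⟨0, fun P hP => (K0.cls_eq_zero
      (((LOT_isAcyc hN).isContractible hP.1).restrict _) _).symm⟩
  · obtain ⟨e₁, he₁⟩ := (LOT_isBase (k := k) hN).exists_K0_equiv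
    obtain ⟨e, he⟩ := ((LOT_isBase (k := k) (n := n) (by omega)).tensor
      (LOT_isBase (k := k) (n := m) (by omega))).exists_K0_equiv
    refine ⟨e.symm.toLinearMap.comp e₁.toLinearMap, fun P hP => e.injective ?_⟩
    rw [he, LinearMap.comp_apply, LinearEquiv.coe_coe, LinearEquiv.coe_coe,
      LinearEquiv.apply_symm_apply, he₁]
    rfl

end

/-! ### The algebra `ℤ[q, q⁻¹, E₁] / (E₁²)` -/

/-- The two coefficients are read off after mapping E₁ to ε in the dual numbers. -/
theorem UZ_linearIndependent {a b : Zq} (h : a • (1 : UZ) + b • E₁ = 0) : a = 0 ∧ b = 0 := by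
  have h1 := congrArg (UZlift (B := DualNumber Zq) DualNumber.eps DualNumber.eps_mul_eps) h
  rw [map_add, map_smul, map_smul, map_one, UZlift_E₁, map_zero] at h1
  exact ⟨by simpa using congrArg TrivSqZeroExt.fst h1, by simpa using congrArg TrivSqZeroExt.snd h1⟩

theorem UZΔ_one : UZΔ 1 = 1 ⊗ₜ[Zq] 1 := by
  rw [UZΔ, LinearMap.comp_apply, AlgHom.toLinearMap_apply, map_one]
  rfl

theorem UZΔ_E₁ : UZΔ E₁ = E₁ ⊗ₜ[Zq] 1 + 1 ⊗ₜ[Zq] E₁ := by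
  rw [UZΔ, LinearMap.comp_apply, AlgHom.toLinearMap_apply, UZcomul, UZlift_E₁]
  rfl

theorem E₁_pow_eq_zero {n : ℕ} (hn : 2 ≤ n) : E₁ ^ n = 0 := by
  obtain ⟨m, rfl⟩ := Nat.exists_eq_add_of_le hn
  have h2 : E₁ ^ 2 = 0 := (pow_two E₁).trans E₁_sq
  rw [pow_add, h2, zero_mul]

/-! ### The integral form inside ℚ(q)[E₁]/(E₁²). -/

section Target

open Polynomial

theorem UQ_root_sq : AdjoinRoot.root ((X : Qq[X]) ^ 2) * AdjoinRoot.root ((X : Qq[X]) ^ 2) = 0 := by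
  have h := AdjoinRoot.eval₂_root ((X : Qq[X]) ^ 2)
  rw [eval₂_pow, eval₂_X] at h
  exact (pow_two _).symm.trans h

/-- The map from `ℚ(q)[E₁] / (E₁²)` to the dual numbers over `ℚ(q)`. -/
def UQtoDual : UQ →+* DualNumber Qq :=
  AdjoinRoot.lift (algebraMap Qq (DualNumber Qq)) DualNumber.eps
    (by rw [eval₂_pow, eval₂_X, pow_two, DualNumber.eps_mul_eps])

theorem UQtoDual_algebraMap (c : Zq) : UQtoDual (algebraMap Zq UQ c) =
    algebraMap Qq (DualNumber Qq) (algebraMap Zq Qq c) := by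
  rw [IsScalarTower.algebraMap_apply Zq Qq UQ, AdjoinRoot.algebraMap_eq]
  exact AdjoinRoot.lift_of _

theorem UQtoDual_root : UQtoDual (AdjoinRoot.root _) = DualNumber.eps :=
  AdjoinRoot.lift_root _

/-- Dual numbers over ℚ(q) separate the coefficients, and ℤ[q, q⁻¹] embeds in its fraction field.
This gives injectivity of the comparison map `UZtoUQ`. -/
theorem UQ_linearIndependent {a b : Zq}
    (h : algebraMap Zq UQ a + algebraMap Zq UQ b * AdjoinRoot.root _ = 0) : a = 0 ∧ b = 0 := by
  have h1 := congrArg UQtoDual h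
  rw [map_add, map_mul, UQtoDual_algebraMap, UQtoDual_algebraMap, UQtoDual_root, map_zero] at h1
  have ha : algebraMap Zq Qq a = 0 := by
    simpa [TrivSqZeroExt.algebraMap_eq_inl] using congrArg TrivSqZeroExt.fst h1
  have hb : algebraMap Zq Qq b = 0 := by
    simpa [TrivSqZeroExt.algebraMap_eq_inl] using congrArg TrivSqZeroExt.snd h1
  exact ⟨IsFractionRing.to_map_eq_zero_iff.1 ha, IsFractionRing.to_map_eq_zero_iff.1 hb⟩

/-- The inclusion of `ℤ[q, q⁻¹, E₁] / (E₁²)` into `ℚ(q)[E₁] / (E₁²)`. -/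
def UZtoUQ : UZ →ₐ[Zq] UQ := UZlift _ UQ_root_sq

theorem UZtoUQ_E₁ : UZtoUQ E₁ = AdjoinRoot.root _ := UZlift_E₁ _ UQ_root_sq

theorem UZtoUQ_apply (a b : Zq) : UZtoUQ (a • (1 : UZ) + b • E₁) =
    algebraMap Zq UQ a + algebraMap Zq UQ b * AdjoinRoot.root _ := by
  rw [Algebra.smul_def, Algebra.smul_def, mul_one, map_add, map_mul, AlgHom.commutes,
    AlgHom.commutes, UZtoUQ_E₁]

theorem UZtoUQ_injective : Function.Injective UZtoUQ := by
  rw [injective_iff_map_eq_zero]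
  intro x hx
  obtain ⟨a, b, rfl⟩ := UZ_span x
  rw [UZtoUQ_apply] at hx
  obtain ⟨rfl, rfl⟩ := UQ_linearIndependent hx
  rw [zero_smul, zero_smul, add_zero]

theorem UZtoUQ_range : UZtoUQ.range = UQint := by
  refine le_antisymm ?_ (Algebra.adjoin_le ?_)
  · rintro _ ⟨x, rfl⟩
    obtain ⟨a, b, rfl⟩ := UZ_span x
    change UZtoUQ (a • 1 + b • E₁) ∈ UQint
    rw [UZtoUQ_apply]
    exact Subalgebra.add_mem _ (Subalgebra.algebraMap_mem _ a)
      (Subalgebra.mul_mem _ (Subalgebra.algebraMap_mem _ b) (Algebra.subset_adjoin rfl))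
  · rintro _ rfl
    exact ⟨E₁, UZtoUQ_E₁⟩

theorem exists_integralForm_equiv : ∃ ψ : UZ ≃ₐ[Zq] UQint, (ψ E₁ : UQ) = AdjoinRoot.root _ :=
  ⟨(AlgEquiv.ofInjective UZtoUQ UZtoUQ_injective).trans
    (Subalgebra.equivOfEq _ _ UZtoUQ_range), UZtoUQ_E₁⟩

end Target

/-! ### The isomorphism of `K₀(H⁻)` with `ℤ[q, q⁻¹, E₁] / (E₁²)` -/

/-- The map multiplies the Euler characteristic of a class in degree n by E₁ⁿ. Only degrees 0 and 1
contribute, and they match the basis 1, E₁. -/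
theorem exists_K0_equiv_UZ (E : ∀ n, K0 (LOT k n) →ₗ[Zq] Zq)
    (hE : ∀ n ≤ 1, Function.Bijective (E n)) :
    ∃ φ : (⨁ n : ℕ, K0 (LOT k n)) ≃ₗ[Zq] UZ, ∀ n x,
      φ (DirectSum.lof Zq ℕ (fun n => K0 (LOT k n)) n x) = E n x • E₁ ^ n := by
  let F : (⨁ n : ℕ, K0 (LOT k n)) →ₗ[Zq] UZ := DirectSum.toModule Zq ℕ UZ fun n =>
    (LinearMap.toSpanSingleton Zq UZ (E₁ ^ n)).comp (E n)
  have hF : ∀ n x, F (DirectSum.lof Zq ℕ (fun n => K0 (LOT k n)) n x) = E n x • E₁ ^ n :=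
    fun n x => by
      rw [DirectSum.toModule_lof, LinearMap.comp_apply, LinearMap.toSpanSingleton_apply]
  refine ⟨LinearEquiv.ofBijective F ⟨?_, fun y => ?_⟩, hF⟩
  -- An element of the direct sum is determined by its coordinates 0 and 1, since the groups from
  -- degree 2 on vanish.
  · have e : ∀ x : ⨁ n : ℕ, K0 (LOT k n), x = DirectSum.lof Zq ℕ (fun n => K0 (LOT k n)) 0 (x 0) +
        DirectSum.lof Zq ℕ (fun n => K0 (LOT k n)) 1 (x 1) := fun x => by
      refine DFinsupp.ext fun n => ?_
      rw [DirectSum.add_apply]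
      match n with
      | 0 =>
        rw [DirectSum.lof_apply, DirectSum.lof_eq_of, DirectSum.of_eq_of_ne _ _ _ (by decide),
          add_zero]
      | 1 =>
        rw [DirectSum.lof_apply, DirectSum.lof_eq_of, DirectSum.of_eq_of_ne _ _ _ (by decide),
          zero_add]
      | n + 2 =>
        have := (LOT_isAcyc (k := k) (n := n + 2) (by omega)).subsingleton_K0
        exact Subsingleton.elim _ _
    intro x y hxy
    rw [e x, e y, map_add, map_add, hF, hF, hF, hF, pow_zero, pow_one, ← sub_eq_zero,
      add_sub_add_comm, ← sub_smul, ← sub_smul] at hxy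
    obtain ⟨h0, h1⟩ := UZ_linearIndependent hxy
    rw [e x, e y, (hE 0 (by omega)).1 (sub_eq_zero.1 h0), (hE 1 le_rfl).1 (sub_eq_zero.1 h1)]
  · obtain ⟨a, b, rfl⟩ := UZ_span y
    obtain ⟨x, rfl⟩ := (hE 0 (by omega)).2 a
    obtain ⟨y, rfl⟩ := (hE 1 le_rfl).2 b
    refine ⟨DirectSum.lof Zq ℕ (fun n => K0 (LOT k n)) 0 x +
      DirectSum.lof Zq ℕ (fun n => K0 (LOT k n)) 1 y, ?_⟩
    rw [map_add, hF, hF, pow_zero, pow_one]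

/-! ### Product and coproduct in terms of Euler characteristics. -/

section Comultiplication

variable {n m N : ℕ} {E : ∀ n, K0 (LOT k n) →ₗ[Zq] Zq}

theorem eulerMap_ind (h : n + m = N) (hN : N ≤ 1)
    (hE : ∀ n ≤ 1, ∀ P hP, E n (K0.cls P hP) = P.euler)
    {F : K0 (LOT k n) →ₗ[Zq] K0 (LOT k m) →ₗ[Zq] K0 (LOT k N)}
    (hF : ∀ P Q hP hQ, F (K0.cls P hP) (K0.cls Q hQ) = K0.cls (Ind h P Q) (Ind_isPerf h hP hQ))
    (x : K0 (LOT k n)) (y : K0 (LOT k m)) : E N (F x y) = E n x * E m y := by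
  have key : F.compr₂ (E N) = (LinearMap.mul Zq Zq).compl₁₂ (E n) (E m) :=
    K0.hom_ext fun P hP => K0.hom_ext fun Q hQ => by
      rw [LinearMap.compr₂_apply, hF, hE N hN, euler_Ind h hN hP hQ, LinearMap.compl₁₂_apply,
        hE n (by omega), hE m (by omega), LinearMap.mul_apply']
  exact LinearMap.congr_fun (LinearMap.congr_fun key x) y

/-- The group of the tensor product is free of rank one on the class of the outer product of the
regular modules, whose Euler characteristic is 1. Restriction does not change Euler characteristics,
so that of x is the coefficient. -/
theorem resMap_eq (h : n + m = N) (hN : N ≤ 1)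
    (hE : ∀ n ≤ 1, ∀ P hP, E n (K0.cls P hP) = P.euler)
    {X : (K0 (LOT k n) ⊗[Zq] K0 (LOT k m)) ≃ₗ[Zq] K0 ((LOT k n).tensor (LOT k m))}
    (hX : ∀ P Q hP hQ,
      X (K0.cls P hP ⊗ₜ[Zq] K0.cls Q hQ) = K0.cls (P.outer Q) (outer_isPerf hP hQ))
    {D : K0 (LOT k N) →ₗ[Zq] K0 ((LOT k n).tensor (LOT k m))}
    (hD : ∀ P hP, D (K0.cls P hP) = K0.cls (Res h P) (Res_isPerf h hP)) (x : K0 (LOT k N)) :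
    X.symm (D x) = E N x • (K0.cls _ (regular_LOT_isPerf n) ⊗ₜ[Zq]
      K0.cls _ (regular_LOT_isPerf m)) := by
  have hn : (LOT k n).IsBase := LOT_isBase (by omega)
  have hm : (LOT k m).IsBase := LOT_isBase (by omega)
  obtain ⟨e, he⟩ := (hn.tensor hm).exists_K0_equiv
  have key : e.toLinearMap.comp D = E N := K0.hom_ext fun P hP => by
    rw [LinearMap.comp_apply, hD, LinearEquiv.coe_coe, he, hE N hN]
    rfl
  rw [LinearEquiv.symm_apply_eq, map_smul, hX]
  refine e.injective ?_
  rw [map_smul, he, hn.euler_outer hm (regular_LOT_isPerf n) (regular_LOT_isPerf m),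
    hn.euler_regular, hm.euler_regular, mul_one, smul_eq_mul, mul_one]
  exact LinearMap.congr_fun key x

/-- The bound is essential: for N = 2 the left side is 0, while the right side contains E₁ ⊗ E₁. -/
theorem UZΔ_pow (hN : N ≤ 1) :
    UZΔ (E₁ ^ N) = ∑ p ∈ Finset.HasAntidiagonal.antidiagonal N, (E₁ ^ p.1) ⊗ₜ[Zq] (E₁ ^ p.2) := by
  interval_cases N
  · rw [pow_zero, UZΔ_one]
    simp
  · rw [pow_one, UZΔ_E₁]
    simp [Finset.Nat.antidiagonal_succ, add_comm]

end Comultiplication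

end LOTCat

end

/-! ### Assembly of the categorification statement. -/

theorem mainTheorem2 (k : Type u) [Field k] :
    -- free modules, inductions, outer tensor products and restrictions are compact projective
    ∃ (hfree : ∀ n : ℕ, (DGMod.regular (LOT k n)).IsPerf)
      (hInd : ∀ {n m N : ℕ} (h : n + m = N) (P : DGMod (LOT k n)) (Q : DGMod (LOT k m)),
        P.IsPerf → Q.IsPerf → (Ind h P Q).IsPerf)
      (hOuter : ∀ {n m : ℕ} (P : DGMod (LOT k n)) (Q : DGMod (LOT k m)),
        P.IsPerf → Q.IsPerf → (P.outer Q).IsPerf)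
      (hRes : ∀ {n m N : ℕ} (h : n + m = N) (P : DGMod (LOT k N)), P.IsPerf →
        (Res (n := n) (m := m) h P).IsPerf),
    -- the groups K₀(H⁻ₙ)
    (∃ e : Zq ≃ₗ[Zq] K0 (LOT k 0), e 1 = K0.cls (DGMod.regular (LOT k 0)) (hfree 0)) ∧
    (∃ e : Zq ≃ₗ[Zq] K0 (LOT k 1), e 1 = K0.cls (DGMod.regular (LOT k 1)) (hfree 1)) ∧
    (∀ n : ℕ, 2 ≤ n → Subsingleton (K0 (LOT k n))) ∧
    -- induction and restriction descend to K₀, and K₀(H⁻ₙ ⊗ H⁻ₘ) = K₀(H⁻ₙ) ⊗ K₀(H⁻ₘ)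
    ∃ (M : ∀ {n m N : ℕ}, n + m = N → (K0 (LOT k n) →ₗ[Zq] K0 (LOT k m) →ₗ[Zq] K0 (LOT k N)))
      (X : ∀ n m : ℕ,
        (K0 (LOT k n) ⊗[Zq] K0 (LOT k m)) ≃ₗ[Zq] K0 ((LOT k n).tensor (LOT k m)))
      (D : ∀ {n m N : ℕ}, n + m = N → (K0 (LOT k N) →ₗ[Zq] K0 ((LOT k n).tensor (LOT k m)))),
      (∀ {n m N : ℕ} (h : n + m = N) (P : DGMod (LOT k n)) (Q : DGMod (LOT k m))
        (hP : P.IsPerf) (hQ : Q.IsPerf),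
        M h (K0.cls P hP) (K0.cls Q hQ) = K0.cls (Ind h P Q) (hInd h P Q hP hQ)) ∧
      (∀ (n m : ℕ) (P : DGMod (LOT k n)) (Q : DGMod (LOT k m)) (hP : P.IsPerf) (hQ : Q.IsPerf),
        X n m (K0.cls P hP ⊗ₜ[Zq] K0.cls Q hQ) = K0.cls (P.outer Q) (hOuter P Q hP hQ)) ∧
      (∀ {n m N : ℕ} (h : n + m = N) (P : DGMod (LOT k N)) (hP : P.IsPerf),
        D (n := n) (m := m) h (K0.cls P hP) = K0.cls (Res h P) (hRes h P hP)) ∧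
      -- the isomorphism with ℤ[q, q⁻¹, E₁] / (E₁²), compatible with units, generators,
      -- multiplication and comultiplication
      (∃ φ : (⨁ n : ℕ, K0 (LOT k n)) ≃ₗ[Zq] UZ,
        φ (DirectSum.lof Zq ℕ (fun n => K0 (LOT k n)) 0
          (K0.cls (DGMod.regular (LOT k 0)) (hfree 0))) = 1 ∧
        φ (DirectSum.lof Zq ℕ (fun n => K0 (LOT k n)) 1
          (K0.cls (DGMod.regular (LOT k 1)) (hfree 1))) = E₁ ∧
        (∀ {n m N : ℕ} (h : n + m = N) (x : K0 (LOT k n)) (y : K0 (LOT k m)),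
          φ (DirectSum.lof Zq ℕ (fun n => K0 (LOT k n)) N (M h x y)) =
            φ (DirectSum.lof Zq ℕ (fun n => K0 (LOT k n)) n x) *
              φ (DirectSum.lof Zq ℕ (fun n => K0 (LOT k n)) m y)) ∧
        (∀ (N : ℕ) (x : K0 (LOT k N)),
          UZΔ (φ (DirectSum.lof Zq ℕ (fun n => K0 (LOT k n)) N x)) =
            ∑ p : Finset.HasAntidiagonal.antidiagonal N,
              TensorProduct.map
                (φ.toLinearMap.comp (DirectSum.lof Zq ℕ (fun n => K0 (LOT k n)) p.1.1))
                (φ.toLinearMap.comp (DirectSum.lof Zq ℕ (fun n => K0 (LOT k n)) p.1.2))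
                ((X p.1.1 p.1.2).symm (D (Finset.HasAntidiagonal.mem_antidiagonal.1 p.2) x)))) ∧
      -- ℤ[q, q⁻¹, E₁] / (E₁²) is the integral form of the positive half of quantum gl(1|1)
      (∃ ψ : UZ ≃ₐ[Zq] UQint, (ψ E₁ : UQ) = AdjoinRoot.root _) := by
  choose E hE using fun n => exists_eulerMap k n
  have hEb : ∀ n ≤ 1, Function.Bijective (E n) := fun n hn => (hE n hn).1
  have hEe : ∀ n ≤ 1, ∀ P hP, E n (K0.cls P hP) = P.euler := fun n hn => (hE n hn).2
  have hE1 : ∀ n ≤ 1, E n (K0.cls _ (regular_LOT_isPerf n)) = 1 := fun n hn => by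
    rw [hEe n hn, (LOT_isBase hn).euler_regular]
  have hfree : ∀ n ≤ 1, ∃ e : Zq ≃ₗ[Zq] K0 (LOT k n), e 1 = K0.cls _ (regular_LOT_isPerf n) :=
    fun n hn => ⟨(LinearEquiv.ofBijective (E n) (hEb n hn)).symm,
      (LinearEquiv.symm_apply_eq _).2 (hE1 n hn).symm⟩
  choose M hM using fun n m N (h : n + m = N) => exists_indMap (k := k) h
  choose X hX using fun n m => exists_outerEquiv k n m
  choose D hD using fun n m N (h : n + m = N) => exists_resMap (k := k) n m h
  obtain ⟨φ, hφ⟩ := exists_K0_equiv_UZ E hEb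
  refine ⟨regular_LOT_isPerf, fun h P Q hP hQ => Ind_isPerf h hP hQ,
    fun P Q hP hQ => outer_isPerf hP hQ, fun h P hP => Res_isPerf h hP, hfree 0 zero_le_one,
    hfree 1 le_rfl, fun n hn => (LOT_isAcyc hn).subsingleton_K0, fun {n m N} h => M n m N h, X,
    fun {n m N} h => D n m N h, fun h => hM _ _ _ h, hX, fun h => hD _ _ _ h,
    ⟨φ, ?_, ?_, fun {n m N} h x y => ?_, fun N x => ?_⟩, exists_integralForm_equiv⟩
  · rw [hφ, hE1 0 zero_le_one, one_smul, pow_zero]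
  · rw [hφ, hE1 1 le_rfl, one_smul, pow_one]
  · rw [hφ, hφ, hφ, smul_mul_smul_comm, ← pow_add, h]
    -- For N ≥ 2 both sides are multiples of E₁^N = 0, even when n = m = 1 and the factors are
    -- nonzero; otherwise the Euler characteristic of an induced class is the product.
    rcases Nat.lt_or_ge 1 N with hN | hN
    · rw [E₁_pow_eq_zero hN, smul_zero, smul_zero]
    · rw [eulerMap_ind h hN hEe (hM n m N h)]
  -- For N ≥ 2 the class itself is zero. For N ≤ 1 both sides are sums over n + m = N of χ(x) E₁ⁿ ⊗
  -- E₁ᵐ, compared term by term.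
  · rcases Nat.lt_or_ge 1 N with hN | hN
    · have := (LOT_isAcyc (k := k) hN).subsingleton_K0
      rw [Subsingleton.elim x 0]
      simp
    · rw [hφ, map_smul, UZΔ_pow hN, ← Finset.sum_coe_sort, Finset.smul_sum]
      refine Finset.sum_congr rfl fun p _ => ?_
      have hp := Finset.HasAntidiagonal.mem_antidiagonal.1 p.2
      rw [resMap_eq hp hN hEe (hX _ _) (hD _ _ _ hp), map_smul, TensorProduct.map_tmul,
        LinearMap.comp_apply, LinearMap.comp_apply, LinearEquiv.coe_coe, hφ, hφ,
        hE1 _ (by omega), hE1 _ (by omega), one_smul, one_smul]
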